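/- Let $M$ be a smooth finite-dimensional manifold with tangent bundle $T$, and equip $T\oplus T^*$ with the inner product $\langle X+\xi,Y+\eta\rangle=\tfrac12(\xi(Y)+\eta(X))$ and with the Courant bracket $$[X+\xi,Y+\eta]=[X,Y]+\mathcal L_X\eta-\mathcal L_Y\xi-\tfrac12 d(i_X\eta-i_Y\xi),$$ extended complex bilinearly to $(T\oplus T^*)\otimes\mathbb C$. A subbundle is *Courant involutive* if its smooth local sections are closed under this bracket. An *almost generalized Kähler structure* is a pair $(\mathcal J_1,\mathcal J_2)$ of commuting smooth orthogonal endomorphisms of $T\oplus T^*$ with $\mathcal J_k^2=-1$, such that $G=-\mathcal J_1\mathcal J_2$ is positive definite, i.e. $\langle Gv,v\rangle>0$ for $v\neq0$. Let $L_k$ be the $+i$-eigenbundle of $\mathcal J_k$ in $(T\oplus T^*)\otimes\mathbb C$, and let $L_1^\pm$ be the $\pm i$-eigenbundle of $\mathcal J_2$ in $L_1$. The structure is *integrable* (a generalized Kähler structure) if $L_1$ and $L_2$ are Courant involutive. An *almost bi-Hermitian structure with b-field* is a quadruple $(g,b,J_+,J_-)$ of a Riemannian metric, a 2-form and two $g$-orthogonal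 almost complex structures, all smooth. It is *associated* with $(\mathcal J_1,\mathcal J_2)$ if the $\pm1$-eigenbundle $C_\pm$ of $G$ is the graph of $b\pm g:T\to T^*$ and $J_\pm$ is obtained from $\mathcal J_1|_{C_\pm}$ by the projection $C_\pm\cong T$, i.e. $J_\pm X$ is the $T$-component of $\mathcal J_1(X+(b\pm g)X)$. **Theorem.** Every almost generalized Kähler structure has exactly one associated quadruple $(g,b,J_+,J_-)$, and every almost bi-Hermitian structure with b-field is associated with exactly one almost generalized Kähler structure. Let $(\mathcal J_1,\mathcal J_2)$ and $(g,b,J_\pm)$ be associated, and put $h=db$, $\omega_\pm=gJ_\pm$ (that is, $\omega_\pm(X,Y)=g(J_\pm X,Y)$), $d^c_\pm=i(\bar\partial_\pm-\partial_\pm)$ and $\nabla^\pm=\nabla\pm\tfrac12 g^{-1}h$, where $\nabla$ is the Levi-Civita connection of $g$. Then $\nabla^\pm$ are metric connections with torsion $\pm g^{-1}h$, and the following are equivalent: - the structure $(\mathcal J_1,\mathcal J_2)$ is integrable; - (i) $L_1^+$ and $L_1^-$ are Courant involutive; - (ii) $J_\pm$ are integrable (their $+i$-eigenbundles in $T\otimes\mathbb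 C$ are closed under the Lie bracket) and $d^c_-\omega_-=-d^c_+\omega_+=h$; - (ii') $J_\pm$ are integrable and $h(X,Y,Z)=d\omega_+(J_+X,J_+Y,J_+Z)=-d\omega_-(J_-X,J_-Y,J_-Z)$ for all $X,Y,Z$; - (iii) $\nabla^+J_+=0$, $\nabla^-J_-=0$, and $h$ is of type $(2,1)+(1,2)$ with respect to both $J_+$ and $J_-$; - (iii') $\nabla^+J_+=0$, $\nabla^-J_-=0$, and $J_\pm$ are integrable. If these conditions hold, $\nabla^\pm$ is the Bismut connection of $(g,J_\pm)$: it is the unique connection that preserves $g$ and $J_\pm$ and has totally skew-symmetric torsion. -/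

import Mathlib

open Bundle Manifold ContDiff VectorField TensorProduct

namespace GenKahler

noncomputable section

section

/-! ### Tensor fields on a manifold modelled on a real normed space `E` -/

/-- Rough vector fields on `M`. -/
abbrev VField (E : Type*) [NormedAddCommGroup E] [NormedSpace ℝ E]
    (M : Type*) [TopologicalSpace M] [ChartedSpace E M] : Type _ :=
  Π x : M, TangentSpace 𝓘(ℝ, E) x

/-- Rough 1-forms on `M`. -/
abbrev OneForm (E : Type*) [NormedAddCommGroup E] [NormedSpace ℝ E]
    (M : Type*) [TopologicalSpace M] [ChartedSpace E M] : Type _ :=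
  Π x : M, TangentSpace 𝓘(ℝ, E) x →L[ℝ] ℝ

/-- Rough endomorphism fields of `T`. -/
abbrev EndField (E : Type*) [NormedAddCommGroup E] [NormedSpace ℝ E]
    (M : Type*) [TopologicalSpace M] [ChartedSpace E M] : Type _ :=
  Π x : M, TangentSpace 𝓘(ℝ, E) x →L[ℝ] TangentSpace 𝓘(ℝ, E) x

/-- Rough fields of bilinear forms on `T`, equivalently of maps `T → T*`, `u ↦ B(u, ·)`. -/
abbrev BForm (E : Type*) [NormedAddCommGroup E] [NormedSpace ℝ E]
    (M : Type*) [TopologicalSpace M] [ChartedSpace E M] : Type _ :=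
  Π x : M, TangentSpace 𝓘(ℝ, E) x →L[ℝ] TangentSpace 𝓘(ℝ, E) x →L[ℝ] ℝ

/-- The fibre of `T ⊕ T*` at `x`. -/
abbrev GT (E : Type*) [NormedAddCommGroup E] [NormedSpace ℝ E]
    {M : Type*} [TopologicalSpace M] [ChartedSpace E M] (x : M) : Type _ :=
  TangentSpace 𝓘(ℝ, E) x × (TangentSpace 𝓘(ℝ, E) x →L[ℝ] ℝ)

/-- Rough sections of `T ⊕ T*`. -/
abbrev GSection (E : Type*) [NormedAddCommGroup E] [NormedSpace ℝ E]
    (M : Type*) [TopologicalSpace M] [ChartedSpace E M] : Type _ :=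
  Π x : M, GT E x

/-- Rough endomorphism fields of `T ⊕ T*`. -/
abbrev GEndField (E : Type*) [NormedAddCommGroup E] [NormedSpace ℝ E]
    (M : Type*) [TopologicalSpace M] [ChartedSpace E M] : Type _ :=
  Π x : M, GT E x →L[ℝ] GT E x

/-- The type of Riemannian metrics on `M`. -/
abbrev Metric (E : Type*) [NormedAddCommGroup E] [NormedSpace ℝ E]
    (M : Type*) [TopologicalSpace M] [ChartedSpace E M] [IsManifold 𝓘(ℝ, E) ∞ M] : Type _ :=
  ContMDiffRiemannianMetric 𝓘(ℝ, E) ∞ E (fun x : M ↦ TangentSpace 𝓘(ℝ, E) x)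

/-- Affine connections on `M`; `∇ Y x (X x)` is `(∇_X Y)(x)`. -/
abbrev Connection (E : Type*) [NormedAddCommGroup E] [NormedSpace ℝ E]
    (M : Type*) [TopologicalSpace M] [ChartedSpace E M] [IsManifold 𝓘(ℝ, E) ∞ M] : Type _ :=
  CovariantDerivative 𝓘(ℝ, E) E (fun x : M ↦ TangentSpace 𝓘(ℝ, E) x)

variable {E : Type*} [NormedAddCommGroup E] [NormedSpace ℝ E]
  {M : Type*} [TopologicalSpace M] [ChartedSpace E M] [IsManifold 𝓘(ℝ, E) ∞ M]

def SmoothVField (X : VField E M) (U : Set M) : Prop :=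
  ContMDiffOn 𝓘(ℝ, E) (𝓘(ℝ, E).prod 𝓘(ℝ, E)) ∞ (fun x ↦ TotalSpace.mk' E x (X x)) U

def SmoothEndField (J : EndField E M) : Prop :=
  ContMDiff 𝓘(ℝ, E) (𝓘(ℝ, E).prod 𝓘(ℝ, E →L[ℝ] E)) ∞
    (fun x ↦ TotalSpace.mk' (E →L[ℝ] E)
      (E := fun x : M ↦ TangentSpace 𝓘(ℝ, E) x →L[ℝ] TangentSpace 𝓘(ℝ, E) x) x (J x))

def SmoothBForm (B : BForm E M) : Prop :=
  ContMDiff 𝓘(ℝ, E) (𝓘(ℝ, E).prod 𝓘(ℝ, E →L[ℝ] E →L[ℝ] ℝ)) ∞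
    (fun x ↦ TotalSpace.mk' (E →L[ℝ] E →L[ℝ] ℝ) x (B x))

def SmoothGSection (A : GSection E M) (U : Set M) : Prop :=
  ContMDiffOn 𝓘(ℝ, E) (𝓘(ℝ, E).prod 𝓘(ℝ, E × (E →L[ℝ] ℝ))) ∞
    (fun x ↦ TotalSpace.mk' (E × (E →L[ℝ] ℝ)) (E := fun x : M ↦ GT E x) x (A x)) U

def SmoothGEndField (J : GEndField E M) : Prop :=
  ContMDiff 𝓘(ℝ, E) (𝓘(ℝ, E).prod 𝓘(ℝ, (E × (E →L[ℝ] ℝ)) →L[ℝ] (E × (E →L[ℝ] ℝ)))) ∞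
    (fun x ↦ TotalSpace.mk' ((E × (E →L[ℝ] ℝ)) →L[ℝ] (E × (E →L[ℝ] ℝ)))
      (E := fun x : M ↦ GT E x →L[ℝ] GT E x) x (J x))

/-! ### Exterior derivative of a 2-form -/

/-- For a 2-form `B` and vector fields `X, Y, Z` this is
`dB(X,Y,Z) = X B(Y,Z) - B([X,Y],Z) + cyclic permutations`, at the point `x`. -/
def extDerivAux (B : BForm E M) (X Y Z : VField E M) (x : M) : ℝ :=
  (mvfderiv 𝓘(ℝ, E) (fun y ↦ B y (Y y) (Z y)) x (X x) - B x (mlieBracket 𝓘(ℝ, E) X Y x) (Z x))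
    + (mvfderiv 𝓘(ℝ, E) (fun y ↦ B y (Z y) (X y)) x (Y x) - B x (mlieBracket 𝓘(ℝ, E) Y Z x) (X x))
    + (mvfderiv 𝓘(ℝ, E) (fun y ↦ B y (X y) (Y y)) x (Z x) - B x (mlieBracket 𝓘(ℝ, E) Z X x) (Y x))

/-- The exterior derivative `(dB)_x(u,v,w)` of a 2-form `B`; the tangent vectors `u, v, w` at `x` are
extended to local vector fields (the result does not depend on the extensions). -/
def extDeriv₂ (B : BForm E M) (x : M) (u v w : TangentSpace 𝓘(ℝ, E) x) : ℝ :=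
  extDerivAux B (FiberBundle.extend E u) (FiberBundle.extend E v) (FiberBundle.extend E w) x

theorem extDeriv₂_cyc (B : BForm E M) (x : M) (u v w : TangentSpace 𝓘(ℝ, E) x) :
    extDeriv₂ B x u v w = extDeriv₂ B x v w u := by
  simp only [extDeriv₂, extDerivAux]
  ring

theorem SmoothBForm.mdiff {B : BForm E M} (hB : SmoothBForm B) {X Y : VField E M} {x : M}
    (hX : MDiffAt (T% X) x) (hY : MDiffAt (T% Y) x) : MDiffAt (fun y ↦ B y (X y) (Y y)) x := by
  have : MDifferentiableAt 𝓘(ℝ, E) (𝓘(ℝ, E).prod 𝓘(ℝ))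
      (fun m ↦ TotalSpace.mk' ℝ (E := Bundle.Trivial M ℝ) m (B m (X m) (Y m))) x := by
    apply MDifferentiableAt.clm_bundle_apply₂ (F₁ := E) (F₂ := E)
    · exact ContMDiff.mdifferentiableAt hB (by simp)
    · exact hX
    · exact hY
  simp only [mdifferentiableAt_totalSpace] at this
  exact this.2

theorem SmoothBForm.deriv_smul_left {B : BForm E M} (hB : SmoothBForm B) {X Y : VField E M} {x : M}
    {f : M → ℝ} (hf : MDiffAt f x) (hX : MDiffAt (T% X) x) (hY : MDiffAt (T% Y) x)
    (v : TangentSpace 𝓘(ℝ, E) x) :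
    mvfderiv 𝓘(ℝ, E) (fun y ↦ B y ((f • X) y) (Y y)) x v
      = f x * mvfderiv 𝓘(ℝ, E) (fun y ↦ B y (X y) (Y y)) x v
        + mvfderiv 𝓘(ℝ, E) f x v * B x (X x) (Y x) := by
  have : (fun y ↦ B y ((f • X) y) (Y y)) = f * (fun y ↦ B y (X y) (Y y)) := by
    ext y; simp
  rw [this, mvfderiv_mul hf (hB.mdiff hX hY)]
  simp; ring

theorem SmoothBForm.deriv_smul_right {B : BForm E M} (hB : SmoothBForm B) {X Y : VField E M} {x : M}
    {f : M → ℝ} (hf : MDiffAt f x) (hX : MDiffAt (T% X) x) (hY : MDiffAt (T% Y) x)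
    (v : TangentSpace 𝓘(ℝ, E) x) :
    mvfderiv 𝓘(ℝ, E) (fun y ↦ B y (X y) ((f • Y) y)) x v
      = f x * mvfderiv 𝓘(ℝ, E) (fun y ↦ B y (X y) (Y y)) x v
        + mvfderiv 𝓘(ℝ, E) f x v * B x (X x) (Y x) := by
  have : (fun y ↦ B y (X y) ((f • Y) y)) = f * (fun y ↦ B y (X y) (Y y)) := by
    ext y; simp
  rw [this, mvfderiv_mul hf (hB.mdiff hX hY)]
  simp; ring

theorem SmoothBForm.deriv_add_left {B : BForm E M} (hB : SmoothBForm B) {X X' Y : VField E M} {x : M}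
    (hX : MDiffAt (T% X) x) (hX' : MDiffAt (T% X') x) (hY : MDiffAt (T% Y) x)
    (v : TangentSpace 𝓘(ℝ, E) x) :
    mvfderiv 𝓘(ℝ, E) (fun y ↦ B y ((X + X') y) (Y y)) x v
      = mvfderiv 𝓘(ℝ, E) (fun y ↦ B y (X y) (Y y)) x v
        + mvfderiv 𝓘(ℝ, E) (fun y ↦ B y (X' y) (Y y)) x v := by
  have : (fun y ↦ B y ((X + X') y) (Y y))
      = (fun y ↦ B y (X y) (Y y)) + (fun y ↦ B y (X' y) (Y y)) := by
    ext y; simp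
  rw [this, mvfderiv_add (hB.mdiff hX hY) (hB.mdiff hX' hY)]
  simp

theorem SmoothBForm.deriv_add_right {B : BForm E M} (hB : SmoothBForm B) {X Y Y' : VField E M}
    {x : M} (hX : MDiffAt (T% X) x) (hY : MDiffAt (T% Y) x) (hY' : MDiffAt (T% Y') x)
    (v : TangentSpace 𝓘(ℝ, E) x) :
    mvfderiv 𝓘(ℝ, E) (fun y ↦ B y (X y) ((Y + Y') y)) x v
      = mvfderiv 𝓘(ℝ, E) (fun y ↦ B y (X y) (Y y)) x v
        + mvfderiv 𝓘(ℝ, E) (fun y ↦ B y (X y) (Y' y)) x v := by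
  have : (fun y ↦ B y (X y) ((Y + Y') y))
      = (fun y ↦ B y (X y) (Y y)) + (fun y ↦ B y (X y) (Y' y)) := by
    ext y; simp
  rw [this, mvfderiv_add (hB.mdiff hX hY) (hB.mdiff hX hY')]
  simp

variable [FiniteDimensional ℝ E]

theorem extDerivAux_tensorial {B : BForm E M} (hB : SmoothBForm B)
    (hs : ∀ x u v, B x u v = -B x v u) {Y Z : VField E M} {x : M}
    (hY : MDiffAt (T% Y) x) (hZ : MDiffAt (T% Z) x) :
    TensorialAt 𝓘(ℝ, E) E (fun X ↦ extDerivAux B X Y Z x) x where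
  smul {f X} hf hX := by
    have := FiniteDimensional.complete ℝ E
    simp only [extDerivAux, hB.deriv_smul_left hf hX hY, hB.deriv_smul_right hf hZ hX,
      mlieBracket_smul_left hf hX, mlieBracket_smul_right hf hX]
    simp [hs x (Z x)]
    ring
  add {X X'} hX hX' := by
    have := FiniteDimensional.complete ℝ E
    simp only [extDerivAux, hB.deriv_add_left hX hX' hY, hB.deriv_add_right hZ hX hX',
      mlieBracket_add_left hX hX', mlieBracket_add_right hX hX']
    simp
    ring

theorem extDeriv₂_add {B : BForm E M} (hB : SmoothBForm B) (hs : ∀ x u v, B x u v = -B x v u)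
    (x : M) (u u' v w : TangentSpace 𝓘(ℝ, E) x) :
    extDeriv₂ B x (u + u') v w = extDeriv₂ B x u v w + extDeriv₂ B x u' v w :=
  (TensorialAt.mkHom _ x (extDerivAux_tensorial hB hs
    (FiberBundle.mdifferentiableAt_extend 𝓘(ℝ, E) E v) (FiberBundle.mdifferentiableAt_extend 𝓘(ℝ, E) E w))).map_add u u'

theorem extDeriv₂_smul {B : BForm E M} (hB : SmoothBForm B) (hs : ∀ x u v, B x u v = -B x v u)
    (x : M) (c : ℝ) (u v w : TangentSpace 𝓘(ℝ, E) x) :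
    extDeriv₂ B x (c • u) v w = c * extDeriv₂ B x u v w :=
  (TensorialAt.mkHom _ x (extDerivAux_tensorial hB hs
    (FiberBundle.mdifferentiableAt_extend 𝓘(ℝ, E) E v) (FiberBundle.mdifferentiableAt_extend 𝓘(ℝ, E) E w))).map_smul c u

/-- The map `g_x⁻¹ : T*_x → T_x`. -/
def sharp (g : Metric E M) (x : M) :
    (TangentSpace 𝓘(ℝ, E) x →L[ℝ] ℝ) →L[ℝ] TangentSpace 𝓘(ℝ, E) x :=
  (g.inner x).inverse

theorem sharp_inner (g : Metric E M) (x : M) (u : TangentSpace 𝓘(ℝ, E) x) :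
    sharp g x (g.inner x u) = u := by
  have : FiniteDimensional ℝ (TangentSpace 𝓘(ℝ, E) x) := ‹FiniteDimensional ℝ E›
  have : T2Space (TangentSpace 𝓘(ℝ, E) x) := inferInstanceAs (T2Space E)
  have e₁ : Module.Dual ℝ (TangentSpace 𝓘(ℝ, E) x) ≃ₗ[ℝ] (TangentSpace 𝓘(ℝ, E) x →L[ℝ] ℝ) :=
    LinearMap.toContinuousLinearMap
  have : FiniteDimensional ℝ (TangentSpace 𝓘(ℝ, E) x →L[ℝ] ℝ) := Module.Finite.equiv e₁
  have hinj : Function.Injective (g.inner x).toLinearMap := by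
    rw [injective_iff_map_eq_zero]
    intro a ha
    by_contra h
    have h' := g.pos x a h
    have ha' : g.inner x a = 0 := ha
    simp [ha'] at h'
  have hfr : Module.finrank ℝ (TangentSpace 𝓘(ℝ, E) x)
      = Module.finrank ℝ (TangentSpace 𝓘(ℝ, E) x →L[ℝ] ℝ) := by
    rw [← e₁.finrank_eq, Subspace.dual_finrank_eq]
  let e := LinearEquiv.ofInjectiveOfFinrankEq (g.inner x).toLinearMap hinj hfr
  have h : (g.inner x) = (e.toContinuousLinearEquiv : _ →L[ℝ] _) := by ext1 v; rfl
  unfold sharp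
  rw [h, ContinuousLinearMap.inverse_equiv]
  simp

/-! ### The Levi-Civita connection and connections with torsion -/

/-- The right hand side of the Koszul formula for `2 g(∇_X Y, Z)`, at `x`. -/
def koszul (g : Metric E M) (X Y Z : VField E M) (x : M) : ℝ :=
  mvfderiv 𝓘(ℝ, E) (fun y ↦ g.inner y (Y y) (Z y)) x (X x)
    + mvfderiv 𝓘(ℝ, E) (fun y ↦ g.inner y (Z y) (X y)) x (Y x)
    - mvfderiv 𝓘(ℝ, E) (fun y ↦ g.inner y (X y) (Y y)) x (Z x)
    + g.inner x (mlieBracket 𝓘(ℝ, E) X Y x) (Z x)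
    - g.inner x (mlieBracket 𝓘(ℝ, E) Y Z x) (X x)
    + g.inner x (mlieBracket 𝓘(ℝ, E) Z X x) (Y x)

theorem koszul_tensorial₁ (g : Metric E M) {Y Z : VField E M} {x : M}
    (hY : MDiffAt (T% Y) x) (hZ : MDiffAt (T% Z) x) :
    TensorialAt 𝓘(ℝ, E) E (fun X ↦ koszul g X Y Z x) x where
  smul {f X} hf hX := by
    have := FiniteDimensional.complete ℝ E
    have hB : SmoothBForm g.inner := g.contMDiff
    simp only [koszul, hB.deriv_smul_left hf hX hY, hB.deriv_smul_right hf hZ hX,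
      mlieBracket_smul_left hf hX, mlieBracket_smul_right hf hX]
    simp [g.symm x (Z x)]
    ring
  add {X X'} hX hX' := by
    have := FiniteDimensional.complete ℝ E
    have hB : SmoothBForm g.inner := g.contMDiff
    simp only [koszul, hB.deriv_add_left hX hX' hY, hB.deriv_add_right hZ hX hX',
      mlieBracket_add_left hX hX', mlieBracket_add_right hX hX']
    simp
    ring

theorem koszul_tensorial₂ (g : Metric E M) {X Y : VField E M} {x : M}
    (hX : MDiffAt (T% X) x) (hY : MDiffAt (T% Y) x) :
    TensorialAt 𝓘(ℝ, E) E (fun Z ↦ koszul g X Y Z x) x where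
  smul {f Z} hf hZ := by
    have := FiniteDimensional.complete ℝ E
    have hB : SmoothBForm g.inner := g.contMDiff
    simp only [koszul, hB.deriv_smul_left hf hZ hX, hB.deriv_smul_right hf hY hZ,
      mlieBracket_smul_left hf hZ, mlieBracket_smul_right hf hZ]
    simp [g.symm x (Z x)]
    rw [g.symm x (Y x)]
    ring
  add {Z Z'} hZ hZ' := by
    have := FiniteDimensional.complete ℝ E
    have hB : SmoothBForm g.inner := g.contMDiff
    simp only [koszul, hB.deriv_add_left hZ hZ' hX, hB.deriv_add_right hY hZ hZ',
      mlieBracket_add_left hZ hZ', mlieBracket_add_right hZ hZ']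
    simp
    ring

theorem koszul_add (g : Metric E M) {X Y Y' Z : VField E M} {x : M} (hX : MDiffAt (T% X) x)
    (hY : MDiffAt (T% Y) x) (hY' : MDiffAt (T% Y') x) (hZ : MDiffAt (T% Z) x) :
    koszul g X (Y + Y') Z x = koszul g X Y Z x + koszul g X Y' Z x := by
  have := FiniteDimensional.complete ℝ E
  have hB : SmoothBForm g.inner := g.contMDiff
  simp only [koszul, hB.deriv_add_left hY hY' hZ, hB.deriv_add_right hX hY hY',
    mlieBracket_add_left hY hY', mlieBracket_add_right hY hY']
  simp
  ring

theorem koszul_smul (g : Metric E M) {X Y Z : VField E M} {x : M} {f : M → ℝ} (hf : MDiffAt f x)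
    (hX : MDiffAt (T% X) x) (hY : MDiffAt (T% Y) x) (hZ : MDiffAt (T% Z) x) :
    koszul g X (f • Y) Z x
      = f x * koszul g X Y Z x + 2 * (mvfderiv 𝓘(ℝ, E) f x (X x) * g.inner x (Y x) (Z x)) := by
  have := FiniteDimensional.complete ℝ E
  have hB : SmoothBForm g.inner := g.contMDiff
  simp only [koszul, hB.deriv_smul_left hf hY hZ, hB.deriv_smul_right hf hX hY,
    mlieBracket_smul_left hf hY, mlieBracket_smul_right hf hY]
  simp [g.symm x (X x)]
  ring

/-- The bilinear form `(u, w) ↦ koszul(u, Y, w)` on `T_x`, for `Y` differentiable at `x`. -/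
def koszulForm (g : Metric E M) (Y : VField E M) (x : M) (hY : MDiffAt (T% Y) x) :
    TangentSpace 𝓘(ℝ, E) x →L[ℝ] TangentSpace 𝓘(ℝ, E) x →L[ℝ] ℝ :=
  TensorialAt.mkHom₂ (I := 𝓘(ℝ, E)) (F := E) (F' := E)
    (V := fun x : M ↦ TangentSpace 𝓘(ℝ, E) x) (V' := fun x : M ↦ TangentSpace 𝓘(ℝ, E) x)
    (fun X Z ↦ koszul g X Y Z x) x
    (fun _ hZ ↦ koszul_tensorial₁ g hY hZ) (fun _ hX ↦ koszul_tensorial₂ g hX hY)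

theorem koszulForm_apply (g : Metric E M) (Y : VField E M) (x : M) (hY : MDiffAt (T% Y) x)
    (u w : TangentSpace 𝓘(ℝ, E) x) :
    koszulForm g Y x hY u w
      = koszul g (FiberBundle.extend E u) Y (FiberBundle.extend E w) x := by
  rw [koszulForm, TensorialAt.mkHom₂_apply_eq_extend]

open Classical in
/-- The Levi-Civita connection of `g`, determined by the Koszul formula
`2 g(∇_X Y, Z) = koszul(X, Y, Z)`. Its values on vector fields that are not differentiable at the
given point are irrelevant, and set to `0`. -/
def leviCivita (g : Metric E M) : Connection E M where
  toFun Y x := if hY : MDiffAt (T% Y) x then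
    (1 / 2 : ℝ) • (sharp g x ∘L koszulForm g Y x hY) else 0
  isCovariantDerivativeOnUniv :=
    { add := by
        intro Y Y' x hY hY' _
        have hYY : MDiffAt (T% (Y + Y')) x := mdifferentiableAt_add_section hY hY'
        have h : koszulForm g (Y + Y') x hYY = koszulForm g Y x hY + koszulForm g Y' x hY' := by
          ext u w
          simp only [koszulForm_apply, add_apply]
          exact koszul_add g (FiberBundle.mdifferentiableAt_extend 𝓘(ℝ, E) E u) hY hY'
            (FiberBundle.mdifferentiableAt_extend 𝓘(ℝ, E) E w)
        simp only [dif_pos hY, dif_pos hY', dif_pos hYY, h]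
        ext u
        simp
      leibniz := by
        intro Y f x hY hf _
        have hfY : MDiffAt (T% (f • Y)) x := hf.smul_section hY
        have h : koszulForm g (f • Y) x hfY
            = f x • koszulForm g Y x hY
              + (2 : ℝ) • (mvfderiv 𝓘(ℝ, E) f x).smulRight (g.inner x (Y x)) := by
          ext u w
          simp only [koszulForm_apply]
          rw [koszul_smul g hf (FiberBundle.mdifferentiableAt_extend 𝓘(ℝ, E) E u) hY
            (FiberBundle.mdifferentiableAt_extend 𝓘(ℝ, E) E w)]
          simp [koszulForm_apply]
        simp only [dif_pos hY, dif_pos hfY, h]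
        ext u
        simp [sharp_inner, smul_smul]
        ring_nf }

/-- For a smooth 2-form `b` with `h = db`: the `T`-valued 2-form `g⁻¹h`, that is, the tensor with
`g((g⁻¹h)(u,v), w) = h(u,v,w)`. -/
def raisedDeriv (g : Metric E M) (b : BForm E M) (hb : SmoothBForm b)
    (hskew : ∀ x u v, b x u v = -b x v u) (x : M) :
    TangentSpace 𝓘(ℝ, E) x →ₗ[ℝ] TangentSpace 𝓘(ℝ, E) x →ₗ[ℝ] TangentSpace 𝓘(ℝ, E) x :=
  have : FiniteDimensional ℝ (TangentSpace 𝓘(ℝ, E) x) := ‹FiniteDimensional ℝ E›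
  have : T2Space (TangentSpace 𝓘(ℝ, E) x) := inferInstanceAs (T2Space E)
  let h (u v : TangentSpace 𝓘(ℝ, E) x) : TangentSpace 𝓘(ℝ, E) x →L[ℝ] ℝ :=
    LinearMap.toContinuousLinearMap
      { toFun := fun w ↦ extDeriv₂ b x u v w
        map_add' := fun w w' ↦ by
          simp only [← extDeriv₂_cyc b x _ u v, extDeriv₂_add hb hskew]
        map_smul' := fun c w ↦ by
          simp only [← extDeriv₂_cyc b x _ u v, extDeriv₂_smul hb hskew, smul_eq_mul,
            RingHom.id_apply] }
  have hh (u v w : TangentSpace 𝓘(ℝ, E) x) : h u v w = extDeriv₂ b x u v w := rfl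
  LinearMap.mk₂ ℝ (fun u v ↦ sharp g x (h u v))
    (fun u u' v ↦ by
      rw [← map_add]; congr 1; ext w
      simp only [hh, add_apply, extDeriv₂_add hb hskew])
    (fun c u v ↦ by
      rw [← map_smul]; congr 1; ext w
      simp [hh, extDeriv₂_smul hb hskew])
    (fun u v v' ↦ by
      rw [← map_add]; congr 1; ext w
      simp only [hh, add_apply, extDeriv₂_cyc b x u, extDeriv₂_add hb hskew])
    (fun c u v ↦ by
      rw [← map_smul]; congr 1; ext w
      simp [hh, extDeriv₂_cyc b x u, extDeriv₂_smul hb hskew])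

/-- The connection `∇_X Y + (c/2) g⁻¹h(X, Y, ·)` with `h = db`, where `∇` is the Levi-Civita
connection of `g`. The first argument of the added one-form is the section `Y`. -/
def torsionConnection (g : Metric E M) (b : BForm E M) (hb : SmoothBForm b)
    (hskew : ∀ x u v, b x u v = -b x v u) (c : ℝ) : Connection E M :=
  (leviCivita g).addOneForm (fun x ↦
    have : FiniteDimensional ℝ (TangentSpace 𝓘(ℝ, E) x) := ‹FiniteDimensional ℝ E›
    have : T2Space (TangentSpace 𝓘(ℝ, E) x) := inferInstanceAs (T2Space E)
    (c / 2) • (raisedDeriv g b hb hskew x).flip.toContinuousBilinearMap)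

/-- `∇` is a metric connection: `X g(Y,Z) = g(∇_X Y, Z) + g(Y, ∇_X Z)`. -/
def IsMetricConnection (g : Metric E M) (nabla : Connection E M) : Prop :=
  ∀ (x : M) (Y Z : VField E M), MDiffAt (T% Y) x → MDiffAt (T% Z) x →
    ∀ u : TangentSpace 𝓘(ℝ, E) x,
      mvfderiv 𝓘(ℝ, E) (fun y ↦ g.inner y (Y y) (Z y)) x u
        = g.inner x (nabla Y x u) (Z x) + g.inner x (Y x) (nabla Z x u)

/-- `∇J = 0`: `∇_X (JY) = J ∇_X Y`. -/
def IsParallel (J : EndField E M) (nabla : Connection E M) : Prop :=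
  ∀ (x : M) (Y : VField E M), MDiffAt (T% Y) x → ∀ u : TangentSpace 𝓘(ℝ, E) x,
    nabla (fun y ↦ J y (Y y)) x u = J x (nabla Y x u)

/-- `∇` is a `U(n)`-connection (it preserves `g` and `J`) with totally skew-symmetric torsion, that
is, a Bismut connection of the Hermitian structure `(g, J)`. -/
structure IsBismut (g : Metric E M) (J : EndField E M) (nabla : Connection E M) : Prop where
  metric : IsMetricConnection g nabla
  parallel : IsParallel J nabla
  skew_torsion : ∀ (x : M) (u v w : TangentSpace 𝓘(ℝ, E) x),
    g.inner x (nabla.torsion x u v) w = -g.inner x (nabla.torsion x u w) v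

end

section

variable {E : Type*} [NormedAddCommGroup E] [NormedSpace ℝ E]
  {M : Type*} [TopologicalSpace M] [ChartedSpace E M]

/-! ### Types of 3-forms -/

section Types

variable {V : Type*} [AddCommGroup V] [Module ℝ V]

/-- The `ℂ`-trilinear extension of the real 3-form `τ`, evaluated on `a.1 + i a.2`, `b.1 + i b.2`,
`c.1 + i c.2`. -/
def complexEval (τ : V → V → V → ℝ) (a b c : V × V) : ℂ :=
  ⟨τ a.1 b.1 c.1 - τ a.1 b.2 c.2 - τ a.2 b.1 c.2 - τ a.2 b.2 c.1,
    τ a.2 b.1 c.1 + τ a.1 b.2 c.1 + τ a.1 b.1 c.2 - τ a.2 b.2 c.2⟩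

/-- The real and imaginary parts of the `(1,0)`-component `(u - iJu)/2` of a real vector `u`. -/
def proj10 (J : V → V) (u : V) : V × V := ((1 / 2 : ℝ) • u, -((1 / 2 : ℝ) • J u))

/-- The real and imaginary parts of the `(0,1)`-component `(u + iJu)/2` of a real vector `u`. -/
def proj01 (J : V → V) (u : V) : V × V := ((1 / 2 : ℝ) • u, (1 / 2 : ℝ) • J u)

/-- The `(3,0)`-component of `τ` with respect to `J`. -/
def part30 (J : V → V) (τ : V → V → V → ℝ) (u v w : V) : ℂ :=
  complexEval τ (proj10 J u) (proj10 J v) (proj10 J w)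

/-- The `(2,1)`-component of `τ` with respect to `J`. -/
def part21 (J : V → V) (τ : V → V → V → ℝ) (u v w : V) : ℂ :=
  complexEval τ (proj10 J u) (proj10 J v) (proj01 J w)
    + complexEval τ (proj10 J u) (proj01 J v) (proj10 J w)
    + complexEval τ (proj01 J u) (proj10 J v) (proj10 J w)

/-- The `(1,2)`-component of `τ` with respect to `J`. -/
def part12 (J : V → V) (τ : V → V → V → ℝ) (u v w : V) : ℂ :=
  complexEval τ (proj10 J u) (proj01 J v) (proj01 J w)
    + complexEval τ (proj01 J u) (proj10 J v) (proj01 J w)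
    + complexEval τ (proj01 J u) (proj01 J v) (proj10 J w)

/-- The `(0,3)`-component of `τ` with respect to `J`. -/
def part03 (J : V → V) (τ : V → V → V → ℝ) (u v w : V) : ℂ :=
  complexEval τ (proj01 J u) (proj01 J v) (proj01 J w)

end Types

/-! ### Complexified bundles and involutivity -/

/-- The element `u + iv` of the complexification `V ⊗ ℂ`. -/
def cx {V : Type*} [AddCommGroup V] [Module ℝ V] (u v : V) : ℂ ⊗[ℝ] V :=
  (1 : ℂ) ⊗ₜ[ℝ] u + Complex.I ⊗ₜ[ℝ] v

/-- The `z`-eigenspace of the complex linear extension of `J` to `V ⊗ ℂ`. -/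
def cxEigenspace {V : Type*} [AddCommGroup V] [Module ℝ V] (J : V →ₗ[ℝ] V) (z : ℂ) :
    Submodule ℂ (ℂ ⊗[ℝ] V) :=
  Module.End.eigenspace (J.baseChange ℂ) z

variable [IsManifold 𝓘(ℝ, E) ∞ M]

/-- The sections of the subbundle `L` of `T ⊗ ℂ` are closed under the complex bilinear extension of
the Lie bracket. Sections over an open set `U` are written `X + iX'` with `X, X'` real. -/
def LieInvolutive (L : Π x : M, Submodule ℂ (ℂ ⊗[ℝ] TangentSpace 𝓘(ℝ, E) x)) : Prop :=
  ∀ U : Set M, IsOpen U → ∀ X X' Y Y' : VField E M,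
    SmoothVField X U → SmoothVField X' U → SmoothVField Y U → SmoothVField Y' U →
    (∀ x ∈ U, cx (X x) (X' x) ∈ L x) → (∀ x ∈ U, cx (Y x) (Y' x) ∈ L x) →
    ∀ x ∈ U,
      cx (mlieBracket 𝓘(ℝ, E) X Y x - mlieBracket 𝓘(ℝ, E) X' Y' x)
        (mlieBracket 𝓘(ℝ, E) X Y' x + mlieBracket 𝓘(ℝ, E) X' Y x) ∈ L x

/-- The bundle `T^{1,0}`, the `+i`-eigenbundle of `J`. -/
def T10 (J : EndField E M) (x : M) : Submodule ℂ (ℂ ⊗[ℝ] TangentSpace 𝓘(ℝ, E) x) :=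
  cxEigenspace (J x).toLinearMap Complex.I

/-- Integrability of an almost complex structure: the `+i`-eigenbundle is closed under the Lie
bracket. -/
def IsIntegrableACS (J : EndField E M) : Prop := LieInvolutive (T10 J)

/-! ### The Courant bracket -/

section Courant

variable [FiniteDimensional ℝ E]

theorem lieDeriv_tensorial (X : VField E M) {η : OneForm E M} {x : M}
    (hη : MDifferentiableAt 𝓘(ℝ, E) (𝓘(ℝ, E).prod 𝓘(ℝ, E →L[ℝ] ℝ))
      (fun x ↦ TotalSpace.mk' (E →L[ℝ] ℝ)
        (E := fun x : M ↦ TangentSpace 𝓘(ℝ, E) x →L[ℝ] ℝ) x (η x)) x) :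
    TensorialAt 𝓘(ℝ, E) E
      (fun Z : VField E M ↦ mvfderiv 𝓘(ℝ, E) (fun y ↦ η y (Z y)) x (X x)
        - η x (mlieBracket 𝓘(ℝ, E) X Z x)) x := by
  have := FiniteDimensional.complete ℝ E
  have key (Z : VField E M) (hZ : MDiffAt (T% Z) x) : MDiffAt (fun y ↦ η y (Z y)) x := by
    have : MDifferentiableAt 𝓘(ℝ, E) (𝓘(ℝ, E).prod 𝓘(ℝ))
        (fun m ↦ TotalSpace.mk' ℝ (E := Bundle.Trivial M ℝ) m (η m (Z m))) x := by
      apply MDifferentiableAt.clm_bundle_apply (F₁ := E)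
      · exact hη
      · exact hZ
    simp only [mdifferentiableAt_totalSpace] at this
    exact this.2
  constructor
  · intro f Z hf hZ
    have h : (fun y ↦ η y ((f • Z) y)) = f * (fun y ↦ η y (Z y)) := by ext y; simp
    rw [h, mvfderiv_mul hf (key Z hZ), mlieBracket_smul_right hf hZ]
    simp
    ring
  · intro Z Z' hZ hZ'
    have h : (fun y ↦ η y ((Z + Z') y)) = (fun y ↦ η y (Z y)) + (fun y ↦ η y (Z' y)) := by
      ext y; simp
    rw [h, mvfderiv_add (key Z hZ) (key Z' hZ'), mlieBracket_add_right hZ hZ']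
    simp
    ring

open Classical in
/-- The Lie derivative of a 1-form, `(𝓛_X η)(Z) = X(η(Z)) - η([X,Z])`; it is set to `0` where `η` is
not differentiable. -/
def lieDeriv (X : VField E M) (η : OneForm E M) : OneForm E M := fun x ↦
  if hη : MDifferentiableAt 𝓘(ℝ, E) (𝓘(ℝ, E).prod 𝓘(ℝ, E →L[ℝ] ℝ))
      (fun x ↦ TotalSpace.mk' (E →L[ℝ] ℝ)
        (E := fun x : M ↦ TangentSpace 𝓘(ℝ, E) x →L[ℝ] ℝ) x (η x)) x
  then TensorialAt.mkHom _ x (lieDeriv_tensorial X hη) else 0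

/-- The Courant bracket
`[X + ξ, Y + η] = [X,Y] + 𝓛_X η - 𝓛_Y ξ - ½ d(i_X η - i_Y ξ)` on sections of `T ⊕ T*`. -/
def courant (A B : GSection E M) : GSection E M := fun x ↦
  (mlieBracket 𝓘(ℝ, E) (fun y ↦ (A y).1) (fun y ↦ (B y).1) x,
    lieDeriv (fun y ↦ (A y).1) (fun y ↦ (B y).2) x
      - lieDeriv (fun y ↦ (B y).1) (fun y ↦ (A y).2) x
      - (1 / 2 : ℝ) • mvfderiv 𝓘(ℝ, E) (fun y ↦ (B y).2 (A y).1 - (A y).2 (B y).1) x)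

/-- The sections of the subbundle `L` of `(T ⊕ T*) ⊗ ℂ` are closed under the complex bilinear
extension of the Courant bracket. Sections over an open set `U` are written `A + iA'` with `A, A'`
real. -/
def CourantInvolutive (L : Π x : M, Submodule ℂ (ℂ ⊗[ℝ] GT E x)) : Prop :=
  ∀ U : Set M, IsOpen U → ∀ A A' B B' : GSection E M,
    SmoothGSection A U → SmoothGSection A' U → SmoothGSection B U → SmoothGSection B' U →
    (∀ x ∈ U, cx (A x) (A' x) ∈ L x) → (∀ x ∈ U, cx (B x) (B' x) ∈ L x) →
    ∀ x ∈ U, cx (courant A B x - courant A' B' x) (courant A B' x + courant A' B x) ∈ L x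

end Courant

/-! ### Almost generalized Kähler and almost bi-Hermitian structures -/

/-- The inner product `⟨X + ξ, Y + η⟩ = ½(ξ(Y) + η(X))` on `T ⊕ T*`. -/
def pairing {x : M} (v w : GT E x) : ℝ := (1 / 2) * (v.2 w.1 + w.2 v.1)

variable (E M) in
/-- An almost generalized Kähler structure: two commuting generalized almost complex structures
`𝒥₁, 𝒥₂` such that `G = -𝒥₁𝒥₂` is positive definite. -/
structure AlmostGenKahler where
  J₁ : GEndField E M
  J₂ : GEndField E M
  smooth₁ : SmoothGEndField J₁
  smooth₂ : SmoothGEndField J₂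
  sq₁ : ∀ x v, J₁ x (J₁ x v) = -v
  sq₂ : ∀ x v, J₂ x (J₂ x v) = -v
  orth₁ : ∀ x v w, pairing (J₁ x v) (J₁ x w) = pairing v w
  orth₂ : ∀ x v w, pairing (J₂ x v) (J₂ x w) = pairing v w
  comm : ∀ x v, J₁ x (J₂ x v) = J₂ x (J₁ x v)
  pos : ∀ x v, v ≠ 0 → 0 < pairing (-J₁ x (J₂ x v)) v

variable (E M) in
/-- An almost bi-Hermitian structure with b-field: a Riemannian metric `g`, a 2-form `b` and two
`g`-orthogonal almost complex structures `J₊, J₋`. -/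
structure AlmostBiHermitian where
  g : Metric E M
  b : BForm E M
  Jp : EndField E M
  Jm : EndField E M
  smooth_b : SmoothBForm b
  skew_b : ∀ x u v, b x u v = -b x v u
  smooth_Jp : SmoothEndField Jp
  smooth_Jm : SmoothEndField Jm
  sq_Jp : ∀ x u, Jp x (Jp x u) = -u
  sq_Jm : ∀ x u, Jm x (Jm x u) = -u
  orth_Jp : ∀ x u v, g.inner x (Jp x u) (Jp x v) = g.inner x u v
  orth_Jm : ∀ x u v, g.inner x (Jm x u) (Jm x v) = g.inner x u v

namespace AlmostGenKahler

variable (K : AlmostGenKahler E M)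

/-- `G = -𝒥₁𝒥₂`. -/
def G (x : M) (v : GT E x) : GT E x := -K.J₁ x (K.J₂ x v)

/-- The `+i`-eigenbundle of `𝒥₁`. -/
def L₁ (x : M) : Submodule ℂ (ℂ ⊗[ℝ] GT E x) := cxEigenspace (K.J₁ x).toLinearMap Complex.I

/-- The `+i`-eigenbundle of `𝒥₂`. -/
def L₂ (x : M) : Submodule ℂ (ℂ ⊗[ℝ] GT E x) := cxEigenspace (K.J₂ x).toLinearMap Complex.I

/-- `L₁⁺`, the `+i`-eigenbundle of `𝒥₂` in `L₁`. -/
def L₁p (x : M) : Submodule ℂ (ℂ ⊗[ℝ] GT E x) :=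
  K.L₁ x ⊓ cxEigenspace (K.J₂ x).toLinearMap Complex.I

/-- `L₁⁻`, the `-i`-eigenbundle of `𝒥₂` in `L₁`. -/
def L₁m (x : M) : Submodule ℂ (ℂ ⊗[ℝ] GT E x) :=
  K.L₁ x ⊓ cxEigenspace (K.J₂ x).toLinearMap (-Complex.I)

/-- `(𝒥₁, 𝒥₂)` is a generalized Kähler structure: both `+i`-eigenbundles are Courant involutive. -/
def IsIntegrable [FiniteDimensional ℝ E] : Prop :=
  CourantInvolutive K.L₁ ∧ CourantInvolutive K.L₂

/-- `(g, b, J₊, J₋)` are the data associated with `(𝒥₁, 𝒥₂)`: the `±1`-eigenbundles `C±` of `G` are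
the graphs of `b ± g : T → T*`, and `J±` are obtained by transporting `𝒥₁|C±` to `T` along the
projections `C± ≅ T`. -/
structure IsAssociated (D : AlmostBiHermitian E M) : Prop where
  graph_p : ∀ (x : M) (v : GT E x), K.G x v = v ↔ v.2 = D.b x v.1 + D.g.inner x v.1
  graph_m : ∀ (x : M) (v : GT E x), K.G x v = -v ↔ v.2 = D.b x v.1 - D.g.inner x v.1
  transport_p : ∀ (x : M) (u : TangentSpace 𝓘(ℝ, E) x),
    (K.J₁ x (u, D.b x u + D.g.inner x u)).1 = D.Jp x u
  transport_m : ∀ (x : M) (u : TangentSpace 𝓘(ℝ, E) x),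
    (K.J₁ x (u, D.b x u - D.g.inner x u)).1 = D.Jm x u

end AlmostGenKahler

namespace AlmostBiHermitian

variable (D : AlmostBiHermitian E M)

/-- `ω₊ = gJ₊`, that is `ω₊(u, v) = g(J₊u, v)`. -/
def ωp : BForm E M := fun x ↦ D.g.inner x ∘L D.Jp x

/-- `ω₋ = gJ₋`, that is `ω₋(u, v) = g(J₋u, v)`. -/
def ωm : BForm E M := fun x ↦ D.g.inner x ∘L D.Jm x

/-- The torsion `h = db`. -/
def h (x : M) (u v w : TangentSpace 𝓘(ℝ, E) x) : ℝ := extDeriv₂ D.b x u v w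

end AlmostBiHermitian

/-- `d^c = i(∂̄ - ∂)` applied to a 2-form `om` of type `(1,1)` with respect to `J`; for such a form
`∂om` and `∂̄om` are the components of `d(om)` of type `(2,1)` and `(1,2)`. -/
def dc (J : EndField E M) (om : BForm E M) (x : M) (u v w : TangentSpace 𝓘(ℝ, E) x) : ℂ :=
  Complex.I * (part12 (J x) (extDeriv₂ om x) u v w - part21 (J x) (extDeriv₂ om x) u v w)

namespace AlmostBiHermitian

variable (D : AlmostBiHermitian E M)

/-- `d^c_- ω_- = -d^c_+ ω_+ = h`. -/
def DcCondition : Prop :=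
  ∀ (x : M) (u v w : TangentSpace 𝓘(ℝ, E) x),
    dc D.Jm D.ωm x u v w = (D.h x u v w : ℂ) ∧ -dc D.Jp D.ωp x u v w = (D.h x u v w : ℂ)

/-- `h(X,Y,Z) = dω₊(J₊X, J₊Y, J₊Z) = -dω₋(J₋X, J₋Y, J₋Z)`. -/
def RealDcCondition : Prop :=
  ∀ (x : M) (u v w : TangentSpace 𝓘(ℝ, E) x),
    D.h x u v w = extDeriv₂ D.ωp x (D.Jp x u) (D.Jp x v) (D.Jp x w) ∧
    D.h x u v w = -extDeriv₂ D.ωm x (D.Jm x u) (D.Jm x v) (D.Jm x w)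

/-- `h` is of type `(2,1)+(1,2)` with respect to both `J₊` and `J₋`. -/
def TypeCondition : Prop :=
  ∀ (x : M) (u v w : TangentSpace 𝓘(ℝ, E) x),
    part30 (D.Jp x) (D.h x) u v w = 0 ∧ part03 (D.Jp x) (D.h x) u v w = 0 ∧
    part30 (D.Jm x) (D.h x) u v w = 0 ∧ part03 (D.Jm x) (D.h x) u v w = 0

variable [FiniteDimensional ℝ E]

/-- The tensor `g⁻¹h`. -/
def gInvH (x : M) :
    TangentSpace 𝓘(ℝ, E) x →ₗ[ℝ] TangentSpace 𝓘(ℝ, E) x →ₗ[ℝ] TangentSpace 𝓘(ℝ, E) x :=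
  raisedDeriv D.g D.b D.smooth_b D.skew_b x

/-- `∇⁺ = ∇ + ½ g⁻¹h`. -/
def nablaP : Connection E M := torsionConnection D.g D.b D.smooth_b D.skew_b 1

/-- `∇⁻ = ∇ - ½ g⁻¹h`. -/
def nablaM : Connection E M := torsionConnection D.g D.b D.smooth_b D.skew_b (-1)

end AlmostBiHermitian

end

end

end GenKahler

/-!
The statement compares two descriptions of one structure, and the proof rests on three ideas.

**Splitting `T ⊕ T*`.** A metric `g` and a 2-form `b` decompose `T ⊕ T*` into the graphs `C±` of
`b ± g`, each identified with `T` (`plusPart`, `minusPart`, `joinParts`). In this decomposition the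
pairing is `g ⊕ -g`, the operator `G` is `1 ⊕ -1`, and for associated structures `𝒥₁ = J₊ ⊕ J₋` and
`𝒥₂ = J₊ ⊕ -J₋` (`IsAssociated.J₁_eq`, `IsAssociated.J₂_eq`). This gives existence and uniqueness of
`(𝒥₁, 𝒥₂)`. Conversely the block of `G` that maps `T*` to `T` is positive definite, its inverse is
`g`, and the block that maps `T` to `T` is `-g⁻¹b`, which recovers `(g, b)`
(`AlmostGenKahler.toBiHermitian`).

**Reduction to pointwise algebra.** As the Levi-Civita connection `∇` is metric and torsion-free,
Lie brackets, exterior derivatives and Courant brackets can be written with `∇`. For a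
`g`-orthogonal almost complex structure `J` put `a(u, v, w) = g((∇_u J)v, w)` (`nablaForm`). Then
`dω` is the cyclic sum of `a`, `J` is integrable exactly when `a(u, v, w) = a(Ju, v, Jw)`
(`isIntegrableACS_iff`), and `J` is parallel for `∇ + (c/2) g⁻¹h` exactly when
`2a(u, v, w) = -c(h(u, Jv, w) + h(u, v, Jw))` (`isParallel_torsionConnection_iff`). The conditions
(ii), (ii'), (iii), (iii') become linear identities between `a` and `h` at a point, compared in
`IsParallelForm.type21`, `IsParallelForm.eq_cyclicSum` and `IsIntegrableForm.parallelForm`.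

**The Courant bracket.** For sections with parts `(P, Q)` and `(R, S)` the `+`-part `Z` of the
Courant bracket satisfies
`2g(Z, z) = 2g(∇⁺_{P+Q} R - ∇⁺_{R+S} P, z) - 2h(P, R, z) + g(R, ∇⁺_z P) - g(P, ∇⁺_z R)
- g(S, ∇⁻_z Q) + g(Q, ∇⁻_z S)`, and the `-`-part is similar (`inner_plusPart_courant`,
`inner_minusPart_courant`). If `J±` are parallel for `∇±`, then each term except the torsion term
respects the eigenbundles of `J±`, and the torsion term does so when `h` has type `(2,1) + (1,2)`;
hence the eigenbundles `L₁` and `L₂` of `𝒥₁` and `𝒥₂` are involutive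
(`courantInvolutive_of_parallel`). Conversely, if `L₁⁺`, which lies in `C₊ ⊗ ℂ`, is involutive, then
its projection to `T ⊗ ℂ` is closed under the Lie bracket, and the vanishing of the `-`-part of the
bracket, which is `g(P, ∇⁺_z R) - g(R, ∇⁺_z P)` up to a factor, says that `J₊` is parallel
(`isIntegrableACS_of_plus`, `isParallel_of_plus`).

The Bismut connection is unique because the difference of two of them is a totally skew form which
is invariant under `J` in its last two arguments, and such a form vanishes
(`eq_zero_of_skew_of_invariant`).
-/

open Bundle Manifold ContDiff VectorField TensorProduct

set_option linter.unusedSectionVars false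

namespace GenKahler

noncomputable section

section BundleCalculus

/-! ### Smooth bundle maps -/

section Bundles

variable {F₁ F₂ B : Type*}
  {E₁ : B → Type*} [∀ x, AddCommGroup (E₁ x)] [∀ x, Module ℝ (E₁ x)] [NormedAddCommGroup F₁]
  [NormedSpace ℝ F₁] [TopologicalSpace (TotalSpace F₁ E₁)] [∀ x, TopologicalSpace (E₁ x)]
  {E₂ : B → Type*} [∀ x, AddCommGroup (E₂ x)] [∀ x, Module ℝ (E₂ x)] [NormedAddCommGroup F₂]
  [NormedSpace ℝ F₂] [TopologicalSpace (TotalSpace F₂ E₂)] [∀ x, TopologicalSpace (E₂ x)]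
  {EB : Type*} [NormedAddCommGroup EB] [NormedSpace ℝ EB] {HB : Type*} [TopologicalSpace HB]
  {IB : ModelWithCorners ℝ EB HB} [TopologicalSpace B] [ChartedSpace HB B]
  [FiberBundle F₁ E₁] [VectorBundle ℝ F₁ E₁] [FiberBundle F₂ E₂] [VectorBundle ℝ F₂ E₂]
  {n : WithTop ℕ∞}

theorem contMDiffAt_section_prod_iff {s : ∀ x, E₁ x × E₂ x} {x₀ : B} :
    ContMDiffAt IB (IB.prod 𝓘(ℝ, F₁ × F₂)) n
      (fun x ↦ TotalSpace.mk' (F₁ × F₂) (E := fun x ↦ E₁ x × E₂ x) x (s x)) x₀ ↔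
    ContMDiffAt IB (IB.prod 𝓘(ℝ, F₁)) n (fun x ↦ TotalSpace.mk' F₁ x (s x).1) x₀ ∧
      ContMDiffAt IB (IB.prod 𝓘(ℝ, F₂)) n (fun x ↦ TotalSpace.mk' F₂ x (s x).2) x₀ := by
  rw [Bundle.contMDiffAt_section, Bundle.contMDiffAt_section, Bundle.contMDiffAt_section]
  exact contMDiffAt_prod_module_iff _

variable [∀ x, IsTopologicalAddGroup (E₂ x)] [∀ x, ContinuousSMul ℝ (E₂ x)]

/-- A field of linear maps between vector bundles is smooth at a point once it sends every smooth
local section to a smooth one: it suffices to evaluate it on the constant sections of a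
trivialization, since the fibre is finite-dimensional. -/
theorem contMDiffAt_hom_of_apply [FiniteDimensional ℝ F₁]
    [ContMDiffVectorBundle n F₁ E₁ IB] {φ : ∀ x, E₁ x →L[ℝ] E₂ x} {x₀ : B}
    (h : ∀ s : ∀ x, E₁ x,
      ContMDiffAt IB (IB.prod 𝓘(ℝ, F₁)) n (fun x ↦ TotalSpace.mk' F₁ x (s x)) x₀ →
      ContMDiffAt IB (IB.prod 𝓘(ℝ, F₂)) n (fun x ↦ TotalSpace.mk' F₂ x (φ x (s x))) x₀) :
    ContMDiffAt IB (IB.prod 𝓘(ℝ, F₁ →L[ℝ] F₂)) n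
      (fun x ↦ TotalSpace.mk' (F₁ →L[ℝ] F₂) (E := fun x ↦ E₁ x →L[ℝ] E₂ x) x (φ x)) x₀ := by
  rw [contMDiffAt_hom_bundle]
  refine ⟨contMDiffAt_id, ?_⟩
  set e := trivializationAt F₁ E₁ x₀
  have hx : x₀ ∈ e.baseSet := FiberBundle.mem_baseSet_trivializationAt F₁ E₁ x₀
  have hpt (v : F₁) : ContMDiffAt IB 𝓘(ℝ, F₂) n
      (fun x ↦ ContinuousLinearMap.inCoordinates F₁ E₁ F₂ E₂ x₀ x x₀ x (φ x) v) x₀ := by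
    have hs : ContMDiffAt IB (IB.prod 𝓘(ℝ, F₁)) n
        (fun x ↦ TotalSpace.mk' F₁ x (e.symmL ℝ x v)) x₀ := by
      rw [Bundle.contMDiffAt_section]
      refine (contMDiffAt_const (c := v)).congr_of_eventuallyEq ?_
      filter_upwards [e.open_baseSet.mem_nhds hx] with y hy
      rw [← e.continuousLinearMapAt_apply_of_mem ℝ hy, e.continuousLinearMapAt_symmL hy]
    have h2 := h _ hs
    rw [Bundle.contMDiffAt_section] at h2
    refine h2.congr_of_eventuallyEq ?_
    have hx2 : x₀ ∈ (trivializationAt F₂ E₂ x₀).baseSet :=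
      FiberBundle.mem_baseSet_trivializationAt F₂ E₂ x₀
    filter_upwards [(trivializationAt F₂ E₂ x₀).open_baseSet.mem_nhds hx2] with y hy2
    exact Bundle.Trivialization.continuousLinearMapAt_apply_of_mem ℝ _ hy2 _
  let b := Module.finBasis ℝ F₁
  have key (L : F₁ →L[ℝ] F₂) : L = ∑ i, (LinearMap.toContinuousLinearMap (b.coord i)).smulRight
      (L (b i)) := by
    ext v
    conv_lhs => rw [← b.sum_repr v, map_sum]
    simp
  refine ContMDiffAt.congr_of_eventuallyEq (f := fun x ↦ ∑ i,
    (LinearMap.toContinuousLinearMap (b.coord i)).smulRight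
      (ContinuousLinearMap.inCoordinates F₁ E₁ F₂ E₂ x₀ x x₀ x (φ x) (b i))) ?_
    (Filter.Eventually.of_forall fun x ↦ key _)
  refine contMDiffAt_finsetSum fun i _ ↦ ?_
  exact ((ContinuousLinearMap.smulRightL ℝ F₁ F₂
    (LinearMap.toContinuousLinearMap (b.coord i))).contDiff.contMDiff.contMDiffAt).comp x₀
      (hpt (b i))

/-- The fibrewise inverse of a smooth bundle isomorphism is smooth. -/
theorem contMDiffAt_hom_inverse [CompleteSpace F₁] [∀ x, IsTopologicalAddGroup (E₁ x)]
    [∀ x, ContinuousSMul ℝ (E₁ x)]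
    {φ : ∀ x, E₁ x →L[ℝ] E₂ x} {ψ : ∀ x, E₂ x →L[ℝ] E₁ x}
    (h₁ : ∀ x v, ψ x (φ x v) = v) (h₂ : ∀ x w, φ x (ψ x w) = w) {x₀ : B}
    (h : ContMDiffAt IB (IB.prod 𝓘(ℝ, F₁ →L[ℝ] F₂)) n
      (fun x ↦ TotalSpace.mk' (F₁ →L[ℝ] F₂) (E := fun x ↦ E₁ x →L[ℝ] E₂ x) x (φ x)) x₀) :
    ContMDiffAt IB (IB.prod 𝓘(ℝ, F₂ →L[ℝ] F₁)) n
      (fun x ↦ TotalSpace.mk' (F₂ →L[ℝ] F₁) (E := fun x ↦ E₂ x →L[ℝ] E₁ x) x (ψ x)) x₀ := by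
  rw [contMDiffAt_hom_bundle] at h ⊢
  refine ⟨contMDiffAt_id, ?_⟩
  have hx1 : x₀ ∈ (trivializationAt F₁ E₁ x₀).baseSet :=
    FiberBundle.mem_baseSet_trivializationAt F₁ E₁ x₀
  have hx2 : x₀ ∈ (trivializationAt F₂ E₂ x₀).baseSet :=
    FiberBundle.mem_baseSet_trivializationAt F₂ E₂ x₀
  have key (y : B) (hy1 : y ∈ (trivializationAt F₁ E₁ x₀).baseSet)
      (hy2 : y ∈ (trivializationAt F₂ E₂ x₀).baseSet) :
      ∃ e : F₁ ≃L[ℝ] F₂,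
        ContinuousLinearMap.inCoordinates F₁ E₁ F₂ E₂ x₀ y x₀ y (φ y) = e ∧
        ContinuousLinearMap.inCoordinates F₂ E₂ F₁ E₁ x₀ y x₀ y (ψ y) = e.symm := by
    refine ⟨ContinuousLinearEquiv.equivOfInverse
      (ContinuousLinearMap.inCoordinates F₁ E₁ F₂ E₂ x₀ y x₀ y (φ y))
      (ContinuousLinearMap.inCoordinates F₂ E₂ F₁ E₁ x₀ y x₀ y (ψ y)) ?_ ?_, ?_, ?_⟩
    · intro v
      rw [ContinuousLinearMap.inCoordinates_eq hy1 hy2,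
        ContinuousLinearMap.inCoordinates_eq hy2 hy1]
      simp only [ContinuousLinearMap.comp_apply, ContinuousLinearEquiv.coe_coe,
        ContinuousLinearEquiv.symm_apply_apply, ContinuousLinearEquiv.apply_symm_apply, h₁]
    · intro v
      rw [ContinuousLinearMap.inCoordinates_eq hy1 hy2,
        ContinuousLinearMap.inCoordinates_eq hy2 hy1]
      simp only [ContinuousLinearMap.comp_apply, ContinuousLinearEquiv.coe_coe,
        ContinuousLinearEquiv.symm_apply_apply, ContinuousLinearEquiv.apply_symm_apply, h₂]
    · rfl
    · rfl
  obtain ⟨e₀, he₀, -⟩ := key x₀ hx1 hx2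
  have hinv : ContDiffAt ℝ n ContinuousLinearMap.inverse
      (ContinuousLinearMap.inCoordinates F₁ E₁ F₂ E₂ x₀ x₀ x₀ x₀ (φ x₀)) := by
    rw [he₀]; exact contDiffAt_map_inverse e₀
  refine (hinv.contMDiffAt.comp x₀ h.2).congr_of_eventuallyEq ?_
  filter_upwards [(trivializationAt F₁ E₁ x₀).open_baseSet.mem_nhds hx1,
    (trivializationAt F₂ E₂ x₀).open_baseSet.mem_nhds hx2] with y hy1 hy2
  obtain ⟨e, he, he'⟩ := key y hy1 hy2
  simp only [Function.comp_def, he, he', ContinuousLinearMap.inverse_equiv]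

end Bundles

end BundleCalculus

section Calculus

/-! ### The Levi-Civita connection and connections with skew torsion -/

variable {E : Type*} [NormedAddCommGroup E] [NormedSpace ℝ E] [FiniteDimensional ℝ E]
  {M : Type*} [TopologicalSpace M] [ChartedSpace E M] [IsManifold 𝓘(ℝ, E) ∞ M]

instance finiteDimensional_tangentSpace (x : M) :
    FiniteDimensional ℝ (TangentSpace 𝓘(ℝ, E) x) := ‹FiniteDimensional ℝ E›

instance t2Space_tangentSpace (x : M) : T2Space (TangentSpace 𝓘(ℝ, E) x) :=
  inferInstanceAs (T2Space E)

instance finiteDimensional_cotangentSpace (x : M) :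
    FiniteDimensional ℝ (TangentSpace 𝓘(ℝ, E) x →L[ℝ] ℝ) :=
  inferInstanceAs (FiniteDimensional ℝ (E →L[ℝ] ℝ))

theorem finrank_cotangentSpace (x : M) : Module.finrank ℝ (TangentSpace 𝓘(ℝ, E) x →L[ℝ] ℝ)
    = Module.finrank ℝ (TangentSpace 𝓘(ℝ, E) x) := by
  rw [← (LinearMap.toContinuousLinearMap : Module.Dual ℝ (TangentSpace 𝓘(ℝ, E) x) ≃ₗ[ℝ]
    (TangentSpace 𝓘(ℝ, E) x →L[ℝ] ℝ)).finrank_eq, Subspace.dual_finrank_eq]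

theorem inner_sharp (g : Metric E M) (x : M) (ξ : TangentSpace 𝓘(ℝ, E) x →L[ℝ] ℝ) :
    g.inner x (sharp g x ξ) = ξ := by
  have hinj : Function.Injective (g.inner x).toLinearMap :=
    Function.LeftInverse.injective (sharp_inner g x)
  obtain ⟨u, rfl⟩ := (LinearMap.injective_iff_surjective_of_finrank_eq_finrank
    (finrank_cotangentSpace x).symm).1 hinj ξ
  exact congrArg (g.inner x) (sharp_inner g x u)

/-- Tangent vectors are determined by their inner products; identities of vectors are proved in this
form throughout. -/
theorem inner_ext (g : Metric E M) {x : M} {u v : TangentSpace 𝓘(ℝ, E) x}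
    (h : ∀ w, g.inner x u w = g.inner x v w) : u = v := by
  rw [← sharp_inner g x u, ← sharp_inner g x v]
  congr 1
  ext w
  exact h w

theorem mdifferentiableAt_extend_tangent {x : M} (u : TangentSpace 𝓘(ℝ, E) x) :
    MDiffAt (T% (FiberBundle.extend E u)) x :=
  FiberBundle.mdifferentiableAt_extend 𝓘(ℝ, E) E u

/-- The Koszul formula. -/
theorem leviCivita_inner (g : Metric E M) {X Y Z : VField E M} {x : M} (hX : MDiffAt (T% X) x)
    (hY : MDiffAt (T% Y) x) (hZ : MDiffAt (T% Z) x) :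
    g.inner x (leviCivita g Y x (X x)) (Z x) = (1 / 2) * koszul g X Y Z x := by
  have h : leviCivita g Y x = (1 / 2 : ℝ) • (sharp g x ∘L koszulForm g Y x hY) := dif_pos hY
  rw [h]
  simp only [smul_apply, ContinuousLinearMap.comp_apply, map_smul, inner_sharp,
    smul_eq_mul]
  congr 1
  exact TensorialAt.mkHom₂_apply _ _ hX hZ

theorem leviCivita_metric (g : Metric E M) : IsMetricConnection g (leviCivita g) := by
  intro x Y Z hY hZ u
  have hX := mdifferentiableAt_extend_tangent u
  have hu : FiberBundle.extend E u x = u := FiberBundle.extend_apply_self E u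
  have h₁ := leviCivita_inner g hX hY hZ
  have h₂ := leviCivita_inner g hX hZ hY
  rw [g.symm x (Y x), ← hu, h₁, h₂]
  simp only [koszul, g.symm _ (Z _) (Y _), g.symm _ (Z _) (FiberBundle.extend E u _),
    g.symm _ (FiberBundle.extend E u _) (Y _)]
  rw [mlieBracket_swap_apply (V := Z) (W := Y),
    mlieBracket_swap_apply (V := Y) (W := FiberBundle.extend E u),
    mlieBracket_swap_apply (V := FiberBundle.extend E u) (W := Z)]
  simp only [map_neg, neg_apply]
  ring

/-- The Levi-Civita connection is torsion-free. -/
theorem mlieBracket_eq_leviCivita (g : Metric E M) {X Y : VField E M} {x : M}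
    (hX : MDiffAt (T% X) x) (hY : MDiffAt (T% Y) x) :
    mlieBracket 𝓘(ℝ, E) X Y x = leviCivita g Y x (X x) - leviCivita g X x (Y x) := by
  refine inner_ext g fun w ↦ ?_
  have hZ := mdifferentiableAt_extend_tangent w
  have hw : FiberBundle.extend E w x = w := FiberBundle.extend_apply_self E w
  rw [← hw, map_sub, sub_apply, leviCivita_inner g hX hY hZ,
    leviCivita_inner g hY hX hZ]
  simp only [koszul, g.symm _ (FiberBundle.extend E w _) (X _),
    g.symm _ (FiberBundle.extend E w _) (Y _), g.symm _ (Y _) (X _)]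
  rw [mlieBracket_swap_apply (V := Y) (W := X),
    mlieBracket_swap_apply (V := FiberBundle.extend E w) (W := X),
    mlieBracket_swap_apply (V := FiberBundle.extend E w) (W := Y)]
  simp only [map_neg, neg_apply]
  ring

theorem extDeriv₂_skew {B : BForm E M} (hs : ∀ x u v, B x u v = -B x v u) (x : M)
    (u v w : TangentSpace 𝓘(ℝ, E) x) : extDeriv₂ B x u v w = -extDeriv₂ B x v u w := by
  have hd (X Y : VField E M) (t : TangentSpace 𝓘(ℝ, E) x) :
      mvfderiv 𝓘(ℝ, E) (fun y ↦ B y (X y) (Y y)) x t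
        = -mvfderiv 𝓘(ℝ, E) (fun y ↦ B y (Y y) (X y)) x t := by
    have : (fun y ↦ B y (X y) (Y y)) = -(fun y ↦ B y (Y y) (X y)) := by
      ext y; exact hs y _ _
    rw [this, mvfderiv_neg]
    rfl
  simp only [extDeriv₂, extDerivAux]
  rw [hd (FiberBundle.extend E v) (FiberBundle.extend E w), hd (FiberBundle.extend E w)
    (FiberBundle.extend E u), hd (FiberBundle.extend E u) (FiberBundle.extend E v),
    mlieBracket_swap_apply (V := FiberBundle.extend E v) (W := FiberBundle.extend E u),
    mlieBracket_swap_apply (V := FiberBundle.extend E w) (W := FiberBundle.extend E v),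
    mlieBracket_swap_apply (V := FiberBundle.extend E u) (W := FiberBundle.extend E w)]
  simp only [map_neg, neg_apply]
  ring

/-- `dB(X, Y, Z)` may be computed with arbitrary vector fields extending the given values. -/
theorem extDerivAux_eq {B : BForm E M} (hB : SmoothBForm B) (hs : ∀ x u v, B x u v = -B x v u)
    {X Y Z : VField E M} {x : M} (hX : MDiffAt (T% X) x) (hY : MDiffAt (T% Y) x)
    (hZ : MDiffAt (T% Z) x) :
    extDerivAux B X Y Z x = extDeriv₂ B x (X x) (Y x) (Z x) := by
  have hcyc (X Y Z : VField E M) : extDerivAux B X Y Z x = extDerivAux B Y Z X x := by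
    simp only [extDerivAux]; ring
  have hpt {X X' Y Z : VField E M} (hX : MDiffAt (T% X) x) (hX' : MDiffAt (T% X') x)
      (hY : MDiffAt (T% Y) x) (hZ : MDiffAt (T% Z) x) (h : X x = X' x) :
      extDerivAux B X Y Z x = extDerivAux B X' Y Z x :=
    (extDerivAux_tensorial hB hs hY hZ).pointwise hX hX' h
  have hX' := mdifferentiableAt_extend_tangent (X x)
  have hY' := mdifferentiableAt_extend_tangent (Y x)
  have hZ' := mdifferentiableAt_extend_tangent (Z x)
  unfold extDeriv₂
  rw [hpt hX hX' hY hZ (FiberBundle.extend_apply_self E _).symm, hcyc,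
    hpt hY hY' hZ hX' (FiberBundle.extend_apply_self E _).symm, hcyc,
    hpt hZ hZ' hX' hY' (FiberBundle.extend_apply_self E _).symm, hcyc]

theorem inner_raisedDeriv (g : Metric E M) (b : BForm E M) (hb : SmoothBForm b)
    (hskew : ∀ x u v, b x u v = -b x v u) (x : M) (u v w : TangentSpace 𝓘(ℝ, E) x) :
    g.inner x (raisedDeriv g b hb hskew x u v) w = extDeriv₂ b x u v w := by
  simp only [raisedDeriv, LinearMap.mk₂_apply]
  rw [inner_sharp]
  rfl

theorem torsionConnection_apply (g : Metric E M) (b : BForm E M) (hb : SmoothBForm b)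
    (hskew : ∀ x u v, b x u v = -b x v u) (c : ℝ) (Y : VField E M) (x : M)
    (u : TangentSpace 𝓘(ℝ, E) x) :
    torsionConnection g b hb hskew c Y x u
      = leviCivita g Y x u + (c / 2) • raisedDeriv g b hb hskew x u (Y x) := by
  rfl

theorem inner_torsionConnection (g : Metric E M) (b : BForm E M) (hb : SmoothBForm b)
    (hskew : ∀ x u v, b x u v = -b x v u) (c : ℝ) (Y : VField E M) (x : M)
    (u w : TangentSpace 𝓘(ℝ, E) x) :
    g.inner x (torsionConnection g b hb hskew c Y x u) w
      = g.inner x (leviCivita g Y x u) w + c / 2 * extDeriv₂ b x u (Y x) w := by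
  rw [torsionConnection_apply, map_add, map_smul, add_apply,
    smul_apply, inner_raisedDeriv, smul_eq_mul]

theorem torsionConnection_metric (g : Metric E M) (b : BForm E M) (hb : SmoothBForm b)
    (hskew : ∀ x u v, b x u v = -b x v u) (c : ℝ) :
    IsMetricConnection g (torsionConnection g b hb hskew c) := by
  intro x Y Z hY hZ u
  rw [leviCivita_metric g x Y Z hY hZ u, g.symm x (Y x), g.symm x (Y x), inner_torsionConnection,
    inner_torsionConnection, extDeriv₂_cyc b x u (Z x), extDeriv₂_skew hskew x (Z x) (Y x) u,
    extDeriv₂_cyc b x u (Y x)]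
  ring

theorem torsionConnection_torsion (g : Metric E M) (b : BForm E M) (hb : SmoothBForm b)
    (hskew : ∀ x u v, b x u v = -b x v u) (c : ℝ) (x : M) (u v : TangentSpace 𝓘(ℝ, E) x) :
    (torsionConnection g b hb hskew c).torsion x u v = c • raisedDeriv g b hb hskew x u v := by
  refine inner_ext g fun w ↦ ?_
  have hu : FiberBundle.extend E u x = u := FiberBundle.extend_apply_self E u
  have hv : FiberBundle.extend E v x = v := FiberBundle.extend_apply_self E v
  rw [CovariantDerivative.torsion_apply_eq_extend,
    mlieBracket_eq_leviCivita g (mdifferentiableAt_extend_tangent u)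
      (mdifferentiableAt_extend_tangent v)]
  simp only [map_sub, sub_apply, inner_torsionConnection, map_smul,
    smul_apply, inner_raisedDeriv, smul_eq_mul, hu, hv]
  rw [extDeriv₂_skew hskew x v u]
  ring

end Calculus

section HermitianAlgebra

/-! ### Pointwise Hermitian algebra -/

variable {V : Type*} [AddCommGroup V] [Module ℝ V]

/-- A real trilinear form, as a bare function of three vectors: homogeneity in each argument is all
that the type decomposition uses. -/
structure Homogeneous₃ (τ : V → V → V → ℝ) : Prop where
  smul₁ : ∀ (c : ℝ) u v w, τ (c • u) v w = c * τ u v w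
  smul₂ : ∀ (c : ℝ) u v w, τ u (c • v) w = c * τ u v w
  smul₃ : ∀ (c : ℝ) u v w, τ u v (c • w) = c * τ u v w

namespace Homogeneous₃

variable {τ : V → V → V → ℝ} (h : Homogeneous₃ τ)
include h

theorem neg₁ (u v w : V) : τ (-u) v w = -τ u v w := by simpa using h.smul₁ (-1) u v w

theorem neg₂ (u v w : V) : τ u (-v) w = -τ u v w := by simpa using h.smul₂ (-1) u v w

theorem neg₃ (u v w : V) : τ u v (-w) = -τ u v w := by simpa using h.smul₃ (-1) u v w

theorem const_mul (c : ℝ) : Homogeneous₃ fun u v w ↦ c * τ u v w :=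
  ⟨fun d u v w ↦ by rw [h.smul₁, mul_left_comm], fun d u v w ↦ by rw [h.smul₂, mul_left_comm],
    fun d u v w ↦ by rw [h.smul₃, mul_left_comm]⟩

theorem neg : Homogeneous₃ fun u v w ↦ -τ u v w :=
  ⟨fun c u v w ↦ by rw [h.smul₁, mul_neg], fun c u v w ↦ by rw [h.smul₂, mul_neg],
    fun c u v w ↦ by rw [h.smul₃, mul_neg]⟩

end Homogeneous₃

/-- The real form of the condition that a 3-form has no components of type `(3,0)` and `(0,3)`. -/
def IsType21 (J : V → V) (τ : V → V → V → ℝ) : Prop :=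
  ∀ u v w, τ u v w = τ (J u) (J v) w + τ (J u) v (J w) + τ u (J v) (J w)

theorem IsType21.const_mul {J : V → V} {τ : V → V → V → ℝ} (h : IsType21 J τ) (c : ℝ) :
    IsType21 J fun u v w ↦ c * τ u v w := by
  intro u v w
  simp only [← mul_add, ← h u v w]

theorem IsType21.neg {J : V → V} {τ : V → V → V → ℝ} (h : IsType21 J τ) :
    IsType21 J fun u v w ↦ -τ u v w := by
  intro u v w
  linarith [h u v w]

/-- For `a(u, v, w) = g((∇_u J)v, w)` this is the condition `∇_{Ju} J = J ∘ ∇_u J`, which is the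
vanishing of the Nijenhuis tensor. -/
def IsIntegrableForm (J : V → V) (a : V → V → V → ℝ) : Prop :=
  ∀ u v w, a u v w = a (J u) v (J w)

/-- For `a(u, v, w) = g((∇_u J)v, w)` this is the condition that `J` is parallel for
`∇ + ½ g⁻¹h`. -/
def IsParallelForm (J : V → V) (a h : V → V → V → ℝ) : Prop :=
  ∀ u v w, a u v w = -(1 / 2) * (h u (J v) w + h u v (J w))

/-- The cyclic sum of a trilinear form. -/
def cyclicSum (a : V → V → V → ℝ) (u v w : V) : ℝ := a u v w + a v w u + a w u v

variable {J : V → V} {a h τ : V → V → V → ℝ}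

/-- A form symmetric in its first two arguments and skew in its last two vanishes; this is applied
to `a(u, v, w) - a(Ju, v, Jw)`. -/
theorem IsIntegrableForm.of_symm (hskew : ∀ u v w, a u v w = -a u w v)
    (hanti : ∀ u v w, a u (J v) w = a u v (J w))
    (hsymm : ∀ u v w, a u v w - a (J u) v (J w) = a v u w - a (J v) u (J w)) :
    IsIntegrableForm J a := by
  have hb (u v w : V) : a u v w - a (J u) v (J w) = -(a u w v - a (J u) w (J v)) := by
    rw [hskew u v w, hskew (J u) v (J w), hanti]; ring
  intro u v w
  linarith [hsymm u v w, hb v u w, hsymm v w u, hb w v u, hsymm w u v, hb u w v]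

theorem IsIntegrableForm.symm (ha : IsIntegrableForm J a) (u v w : V) :
    a u v w - a (J u) v (J w) = a v u w - a (J v) u (J w) := by
  rw [← ha u v w, ← ha v u w]; ring

/-- If `J` is integrable and parallel for `∇ + ½ g⁻¹h`, then `h` has type `(2,1) + (1,2)`. -/
theorem IsParallelForm.type21 (hJ : ∀ u, J (J u) = -u) (hh : Homogeneous₃ h)
    (hp : IsParallelForm J a h) (ha : IsIntegrableForm J a) : IsType21 J h := by
  intro u v w
  have := ha (J u) v w
  rw [hp (J u) v w, hp (J (J u)) v (J w), hJ, hJ, hh.neg₁, hh.neg₁, hh.neg₃] at this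
  linarith

/-- If `J` is parallel for `∇ + ½ g⁻¹h` and `h` has type `(2,1) + (1,2)`, then
`h = dω(J·, J·, J·)`, where `dω` is the cyclic sum of `a`. -/
theorem IsParallelForm.eq_cyclicSum (hJ : ∀ u, J (J u) = -u) (hh : Homogeneous₃ h)
    (hcyc : ∀ u v w, h u v w = h v w u) (hp : IsParallelForm J a h) (ht : IsType21 J h)
    (u v w : V) : h u v w = cyclicSum a (J u) (J v) (J w) := by
  simp only [cyclicSum, hp _ _ _, hJ, hh.neg₂, hh.neg₃]
  rw [← hcyc u (J v) (J w), ← hcyc (J u) (J v) w, hcyc (J w) u (J v), hcyc (J w) (J u) v, ht u v w]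
  ring

/-- If `J` is integrable and `h = dω(J·, J·, J·)`, then `J` is parallel for `∇ + ½ g⁻¹h`. -/
theorem IsIntegrableForm.parallelForm (hJ : ∀ u, J (J u) = -u) (ha' : Homogeneous₃ a)
    (hskew : ∀ u v w, a u v w = -a u w v) (hanti : ∀ u v w, a u (J v) w = a u v (J w))
    (ha : IsIntegrableForm J a) (hh : ∀ u v w, h u v w = cyclicSum a (J u) (J v) (J w)) :
    IsParallelForm J a h := by
  have h₁ (u v w : V) : a (J u) v w = -a u v (J w) := by
    have := ha u v (J w)
    rw [hJ, ha'.neg₃] at this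
    linarith
  intro u v w
  simp only [hh, cyclicSum, h₁, hJ, hanti, ha'.neg₁, ha'.neg₂, ha'.neg₃]
  rw [hskew v w u, hskew w u v]
  ring

/-- The cyclic sum of an integrable form has type `(2,1) + (1,2)`, expressed after substituting `Ju`
for `u`. -/
theorem IsIntegrableForm.cyclicSum_apply (hJ : ∀ u, J (J u) = -u) (ha' : Homogeneous₃ a)
    (hanti : ∀ u v w, a u (J v) w = a u v (J w)) (ha : IsIntegrableForm J a) (u v w : V) :
    cyclicSum a (J u) (J v) (J w)
      = cyclicSum a (J u) v w + cyclicSum a u (J v) w + cyclicSum a u v (J w) := by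
  have h₁ (u v w : V) : a (J u) v w = -a u v (J w) := by
    have := ha u v (J w)
    rw [hJ, ha'.neg₃] at this
    linarith
  have hJn (u : V) : J (-u) = -J u := by rw [← hJ u, hJ (J u)]
  simp only [cyclicSum, h₁, hJ, hanti, hJn, ha'.neg₃]
  ring

/-- `i(∂̄ - ∂)` acts on forms of type `(2,1) + (1,2)` as `τ ↦ -τ(J·, J·, J·)`. -/
theorem I_mul_part12_sub_part21 (hτ : Homogeneous₃ τ)
    (ht : ∀ u v w, τ (J u) (J v) (J w) = τ (J u) v w + τ u (J v) w + τ u v (J w)) (u v w : V) :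
    Complex.I * (part12 J τ u v w - part21 J τ u v w) = ((-τ (J u) (J v) (J w) : ℝ) : ℂ) := by
  have := ht u v w
  apply Complex.ext <;>
  simp only [part12, part21, complexEval, proj10, proj01, hτ.smul₁, hτ.smul₂, hτ.smul₃, hτ.neg₁,
    hτ.neg₂, hτ.neg₃, Complex.mul_re, Complex.mul_im, Complex.I_re, Complex.I_im, Complex.sub_re,
    Complex.sub_im, Complex.add_re, Complex.add_im, Complex.ofReal_re, Complex.ofReal_im] <;>
  linarith

theorem isType21_iff_part30_part03 (hJ : ∀ u, J (J u) = -u) (hτ : Homogeneous₃ τ) :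
    IsType21 J τ ↔ ∀ u v w, part30 J τ u v w = 0 ∧ part03 J τ u v w = 0 := by
  constructor
  · intro h u v w
    have h₁ := h u v w
    have h₂ := h (J u) v w
    rw [hJ, hτ.neg₁, hτ.neg₁] at h₂
    constructor <;> apply Complex.ext <;>
    simp only [part30, part03, complexEval, proj10, proj01, hτ.smul₁, hτ.smul₂, hτ.smul₃, hτ.neg₁,
      hτ.neg₂, hτ.neg₃, Complex.zero_re, Complex.zero_im] <;>
    linarith
  · intro h u v w
    have := congrArg Complex.re (h u v w).1
    simp only [part30, complexEval, proj10, hτ.smul₁, hτ.smul₂, hτ.smul₃, hτ.neg₁,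
      hτ.neg₂, hτ.neg₃, Complex.zero_re] at this
    linarith

/-- A totally skew form with `a(u, Jv, Jw) = a(u, v, w)` vanishes. -/
theorem eq_zero_of_skew_of_invariant (hJ : ∀ u, J (J u) = -u) (ha : Homogeneous₃ a)
    (h₁₂ : ∀ u v w, a u v w = -a v u w) (h₂₃ : ∀ u v w, a u v w = -a u w v)
    (hinv : ∀ u v w, a u (J v) (J w) = a u v w) (u v w : V) : a u v w = 0 := by
  have h₁ (u v w : V) : a u (J v) w = -a u v (J w) := by
    have := hinv u v (J w)
    rw [hJ, ha.neg₃] at this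
    linarith
  have hcyc (u v w : V) : a u v w = a w u v := by rw [h₂₃, h₁₂, neg_neg]
  have h₃ (u v w : V) : a (J u) v w = 0 := by
    have e₁ : a (J u) v w = a u (J v) w := by rw [h₁₂, h₁, h₁₂, h₁, neg_neg]
    have e₂ : a (J u) v w = -a u (J v) w := by rw [hcyc, h₁, ← hcyc]
    linarith
  have := h₃ (J u) v w
  rw [hJ, ha.neg₁] at this
  linarith

end HermitianAlgebra

section CovariantDerivative

/-! ### The covariant derivative of an endomorphism field -/

variable {E : Type*} [NormedAddCommGroup E] [NormedSpace ℝ E] [FiniteDimensional ℝ E]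
  {M : Type*} [TopologicalSpace M] [ChartedSpace E M] [IsManifold 𝓘(ℝ, E) ∞ M]

/-- The vector `(∇_u J) v`, where `v` is extended to a local vector field. -/
def covDerivEnd (nabla : Connection E M) (J : EndField E M) (x : M)
    (u v : TangentSpace 𝓘(ℝ, E) x) : TangentSpace 𝓘(ℝ, E) x :=
  nabla (fun y ↦ J y (FiberBundle.extend E v y)) x u - J x (nabla (FiberBundle.extend E v) x u)

theorem SmoothEndField.mdifferentiableAt {J : EndField E M} (hJ : SmoothEndField J) {Y : VField E M}
    {x : M} (hY : MDiffAt (T% Y) x) : MDiffAt (T% (fun y ↦ J y (Y y))) x :=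
  MDifferentiableAt.clm_bundle_apply (F₁ := E) (F₂ := E)
    (ContMDiff.mdifferentiableAt hJ (by simp)) hY

theorem Connection.map_add (nabla : Connection E M) {Y Z : VField E M} {x : M}
    (hY : MDiffAt (T% Y) x) (hZ : MDiffAt (T% Z) x) :
    nabla (fun y ↦ Y y + Z y) x = nabla Y x + nabla Z x :=
  nabla.isCovariantDerivativeOnUniv.add hY hZ

theorem Connection.map_smul (nabla : Connection E M) {Y : VField E M} {x : M} {f : M → ℝ}
    (hf : MDiffAt f x) (hY : MDiffAt (T% Y) x) (u : TangentSpace 𝓘(ℝ, E) x) :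
    nabla (fun y ↦ f y • Y y) x u = f x • nabla Y x u + mvfderiv 𝓘(ℝ, E) f x u • Y x := by
  have := congrArg (fun L ↦ L u) (nabla.isCovariantDerivativeOnUniv.leibniz hY hf (x := x))
  change nabla (f • Y) x u = _
  simpa using this

theorem Connection.map_neg (nabla : Connection E M) {Y : VField E M} {x : M}
    (hY : MDiffAt (T% Y) x) (u : TangentSpace 𝓘(ℝ, E) x) :
    nabla (fun y ↦ -Y y) x u = -nabla Y x u := by
  have := Connection.map_smul nabla (f := fun _ ↦ -1) mdifferentiableAt_const hY u
  simpa [mvfderiv_const] using this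

theorem covDerivEnd_tensorial (nabla : Connection E M) {J : EndField E M} (hJ : SmoothEndField J)
    (x : M) (u : TangentSpace 𝓘(ℝ, E) x) :
    TensorialAt 𝓘(ℝ, E) E
      (fun Y : VField E M ↦ nabla (fun y ↦ J y (Y y)) x u - J x (nabla Y x u)) x where
  smul {f Y} hf hY := by
    have h₁ := Connection.map_smul nabla hf hY u
    have h₂ := Connection.map_smul nabla hf (hJ.mdifferentiableAt hY) u
    have h₃ : (fun y ↦ J y ((f • Y) y)) = fun y ↦ f y • J y (Y y) := by ext y; simp
    have h₄ : f • Y = fun y ↦ f y • Y y := rfl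
    rw [h₃, h₄, h₂, h₁]
    simp only [_root_.map_add, _root_.map_smul]
    module
  add {Y Z} hY hZ := by
    have h₁ := Connection.map_add nabla hY hZ
    have h₂ := Connection.map_add nabla (hJ.mdifferentiableAt hY) (hJ.mdifferentiableAt hZ)
    have h₃ : (fun y ↦ J y ((Y + Z) y)) = fun y ↦ J y (Y y) + J y (Z y) := by ext y; simp
    have h₄ : Y + Z = fun y ↦ Y y + Z y := rfl
    rw [h₃, h₄, h₂, h₁]
    simp only [add_apply, _root_.map_add]
    module

/-- The product rule `∇_u (JY) = J ∇_u Y + (∇_u J) Y`. -/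
theorem covDeriv_apply (nabla : Connection E M) {J : EndField E M} (hJ : SmoothEndField J)
    {Y : VField E M} {x : M} (hY : MDiffAt (T% Y) x) (u : TangentSpace 𝓘(ℝ, E) x) :
    nabla (fun y ↦ J y (Y y)) x u = J x (nabla Y x u) + covDerivEnd nabla J x u (Y x) := by
  have := (covDerivEnd_tensorial nabla hJ x u).pointwise hY
    (mdifferentiableAt_extend_tangent (Y x)) (FiberBundle.extend_apply_self E _).symm
  rw [covDerivEnd, ← this]
  abel

theorem isParallel_iff (nabla : Connection E M) {J : EndField E M} (hJ : SmoothEndField J) :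
    IsParallel J nabla ↔ ∀ x u v, covDerivEnd nabla J x u v = 0 := by
  constructor
  · intro h x u v
    rw [covDerivEnd, h x _ (mdifferentiableAt_extend_tangent v), sub_self]
  · intro h x Y hY u
    rw [covDeriv_apply nabla hJ hY, h, add_zero]

/-- The trilinear form `(u, v, w) ↦ g((∇_u J)v, w)` with `∇` the Levi-Civita connection. -/
def nablaForm (g : Metric E M) (J : EndField E M) (x : M) (u v w : TangentSpace 𝓘(ℝ, E) x) : ℝ :=
  g.inner x (covDerivEnd (leviCivita g) J x u v) w

/-- The fundamental form `ω = gJ`. -/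
def fundForm (g : Metric E M) (J : EndField E M) : BForm E M := fun x ↦ g.inner x ∘L J x

section Hermitian

variable {g : Metric E M} {J : EndField E M}

theorem inner_skew (hJ : ∀ x u, J x (J x u) = -u)
    (ho : ∀ x u v, g.inner x (J x u) (J x v) = g.inner x u v) (x : M)
    (u v : TangentSpace 𝓘(ℝ, E) x) : g.inner x (J x u) v = -g.inner x u (J x v) := by
  rw [← ho x u (J x v), hJ, _root_.map_neg, neg_neg]

/-- `∇_u J` anticommutes with `J`, by differentiating `J² = -1`. -/
theorem covDerivEnd_anti (nabla : Connection E M) (hs : SmoothEndField J)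
    (hJ : ∀ x u, J x (J x u) = -u) (x : M) (u v : TangentSpace 𝓘(ℝ, E) x) :
    covDerivEnd nabla J x u (J x v) = -J x (covDerivEnd nabla J x u v) := by
  have hY := mdifferentiableAt_extend_tangent v
  have h₁ := covDeriv_apply nabla hs hY u
  have h₂ := covDeriv_apply nabla hs (hs.mdifferentiableAt hY) u
  simp only [hJ] at h₂
  rw [Connection.map_neg nabla hY, h₁, FiberBundle.extend_apply_self, _root_.map_add, hJ] at h₂
  rw [eq_neg_iff_add_eq_zero, add_comm]
  rw [← sub_eq_zero] at h₂
  rw [← neg_eq_zero, ← h₂]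
  abel

/-- `∇_u J` is skew-adjoint for a metric connection, by differentiating the skewness of `J`. -/
theorem covDerivEnd_skew {nabla : Connection E M} (hn : IsMetricConnection g nabla)
    (hs : SmoothEndField J) (hJ : ∀ x u, J x (J x u) = -u)
    (ho : ∀ x u v, g.inner x (J x u) (J x v) = g.inner x u v) (x : M)
    (u v w : TangentSpace 𝓘(ℝ, E) x) :
    g.inner x (covDerivEnd nabla J x u v) w = -g.inner x (covDerivEnd nabla J x u w) v := by
  have hv := mdifferentiableAt_extend_tangent v
  have hw := mdifferentiableAt_extend_tangent w
  have h₁ := hn x _ _ (hs.mdifferentiableAt hv) hw u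
  have h₂ := hn x _ _ hv (hs.mdifferentiableAt hw) u
  have h₃ : (fun y ↦ g.inner y (J y (FiberBundle.extend E v y)) (FiberBundle.extend E w y))
      = -fun y ↦ g.inner y (FiberBundle.extend E v y) (J y (FiberBundle.extend E w y)) := by
    ext y
    exact inner_skew hJ ho y _ _
  rw [h₃, mvfderiv_neg, neg_apply, h₂, covDeriv_apply _ hs hv, covDeriv_apply _ hs hw] at h₁
  simp only [FiberBundle.extend_apply_self, _root_.map_add, add_apply] at h₁
  rw [inner_skew hJ ho, inner_skew hJ ho] at h₁
  rw [g.symm x (covDerivEnd _ _ _ u w)]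
  linarith

theorem nablaForm_skew (hs : SmoothEndField J) (hJ : ∀ x u, J x (J x u) = -u)
    (ho : ∀ x u v, g.inner x (J x u) (J x v) = g.inner x u v) (x : M)
    (u v w : TangentSpace 𝓘(ℝ, E) x) : nablaForm g J x u v w = -nablaForm g J x u w v :=
  covDerivEnd_skew (leviCivita_metric g) hs hJ ho x u v w

theorem nablaForm_anti (hs : SmoothEndField J) (hJ : ∀ x u, J x (J x u) = -u)
    (ho : ∀ x u v, g.inner x (J x u) (J x v) = g.inner x u v) (x : M)
    (u v w : TangentSpace 𝓘(ℝ, E) x) :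
    nablaForm g J x u (J x v) w = nablaForm g J x u v (J x w) := by
  unfold nablaForm
  rw [covDerivEnd_anti _ hs hJ, _root_.map_neg, neg_apply, inner_skew hJ ho, neg_neg]

theorem nablaForm_homogeneous (hs : SmoothEndField J) (hJ : ∀ x u, J x (J x u) = -u)
    (ho : ∀ x u v, g.inner x (J x u) (J x v) = g.inner x u v) (x : M) :
    Homogeneous₃ (nablaForm g J x) := by
  have h₃ (c : ℝ) (u v w : TangentSpace 𝓘(ℝ, E) x) :
      nablaForm g J x u v (c • w) = c * nablaForm g J x u v w := by
    simp [nablaForm]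
  refine ⟨fun c u v w ↦ ?_, fun c u v w ↦ ?_, h₃⟩
  · have : covDerivEnd (leviCivita g) J x (c • u) v = c • covDerivEnd (leviCivita g) J x u v := by
      simp only [covDerivEnd, _root_.map_smul, smul_sub]
    simp [nablaForm, this]
  · rw [nablaForm_skew hs hJ ho, h₃, nablaForm_skew hs hJ ho x u w v]
    ring

/-- `dω` is the cyclic sum of `g((∇_u J)v, w)`, as `∇` is metric and torsion-free. -/
theorem extDeriv₂_fundForm (hs : SmoothEndField J) (hJ : ∀ x u, J x (J x u) = -u)
    (ho : ∀ x u v, g.inner x (J x u) (J x v) = g.inner x u v) (x : M) :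
    extDeriv₂ (fundForm g J) x = cyclicSum (nablaForm g J x) := by
  ext u v w
  have hd (a b c : TangentSpace 𝓘(ℝ, E) x) :
      mvfderiv 𝓘(ℝ, E) (fun y ↦ fundForm g J y (FiberBundle.extend E a y)
        (FiberBundle.extend E b y)) x c
      = nablaForm g J x c a b - g.inner x (leviCivita g (FiberBundle.extend E a) x c) (J x b)
        + g.inner x (J x a) (leviCivita g (FiberBundle.extend E b) x c) := by
    have ha := mdifferentiableAt_extend_tangent a
    have h := leviCivita_metric g x _ _ (hs.mdifferentiableAt ha)
      (mdifferentiableAt_extend_tangent b) c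
    rw [covDeriv_apply _ hs ha] at h
    simp only [FiberBundle.extend_apply_self, _root_.map_add, add_apply] at h
    rw [inner_skew hJ ho] at h
    refine h.trans ?_
    unfold nablaForm
    ring
  simp only [extDeriv₂, extDerivAux, FiberBundle.extend_apply_self]
  rw [hd, hd, hd, mlieBracket_eq_leviCivita g (mdifferentiableAt_extend_tangent u)
      (mdifferentiableAt_extend_tangent v), mlieBracket_eq_leviCivita g
      (mdifferentiableAt_extend_tangent v) (mdifferentiableAt_extend_tangent w),
    mlieBracket_eq_leviCivita g (mdifferentiableAt_extend_tangent w)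
      (mdifferentiableAt_extend_tangent u)]
  simp only [fundForm, ContinuousLinearMap.comp_apply, _root_.map_sub, sub_apply, cyclicSum,
    FiberBundle.extend_apply_self]
  simp only [inner_skew hJ ho x (leviCivita g _ x _)]
  simp only [g.symm x (J x _)]
  ring

end Hermitian

theorem extDeriv₂_homogeneous {b : BForm E M} (hb : SmoothBForm b)
    (hskew : ∀ x u v, b x u v = -b x v u) (x : M) : Homogeneous₃ (extDeriv₂ b x) := by
  have h₁ := extDeriv₂_smul hb hskew x
  refine ⟨h₁, fun c u v w ↦ ?_, fun c u v w ↦ ?_⟩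
  · rw [extDeriv₂_cyc, h₁, extDeriv₂_cyc b x u v w]
  · rw [← extDeriv₂_cyc, h₁, extDeriv₂_cyc]

/-- `J` is parallel for `∇ + (c/2) g⁻¹h` exactly when `∇J` is the commutator of `J` with
`-(c/2) g⁻¹h`. -/
theorem isParallel_torsionConnection_iff {g : Metric E M} {J : EndField E M}
    (hs : SmoothEndField J) (hJ : ∀ x u, J x (J x u) = -u)
    (ho : ∀ x u v, g.inner x (J x u) (J x v) = g.inner x u v) {b : BForm E M} (hb : SmoothBForm b)
    (hskew : ∀ x u v, b x u v = -b x v u) (c : ℝ) :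
    IsParallel J (torsionConnection g b hb hskew c) ↔
      ∀ x, IsParallelForm (J x) (nablaForm g J x) (fun u v w ↦ c * extDeriv₂ b x u v w) := by
  rw [isParallel_iff _ hs]
  have key (x : M) (u v w : TangentSpace 𝓘(ℝ, E) x) :
      g.inner x (covDerivEnd (torsionConnection g b hb hskew c) J x u v) w
        = nablaForm g J x u v w
          + c / 2 * (extDeriv₂ b x u (J x v) w + extDeriv₂ b x u v (J x w)) := by
    simp only [covDerivEnd, nablaForm, _root_.map_sub, sub_apply, inner_torsionConnection,
      inner_skew hJ ho, FiberBundle.extend_apply_self]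
    ring
  constructor
  · intro h x u v w
    have := key x u v w
    rw [h, _root_.map_zero, zero_apply] at this
    linarith
  · intro h x u v
    refine inner_ext g fun w ↦ ?_
    rw [key, h x u v w, _root_.map_zero, zero_apply]
    ring

end CovariantDerivative

section Complexification

/-! ### Complexified vectors and eigenspaces -/

section CxAlgebra

variable {V : Type*} [AddCommGroup V] [Module ℝ V]

theorem cx_inj {u v u' v' : V} : cx u v = cx u' v' ↔ u = u' ∧ v = v' := by
  refine ⟨fun h ↦ ?_, by rintro ⟨rfl, rfl⟩; rfl⟩
  let re : ℂ ⊗[ℝ] V →ₗ[ℝ] V := TensorProduct.lift ((LinearMap.lsmul ℝ V).comp Complex.reLm)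
  let im : ℂ ⊗[ℝ] V →ₗ[ℝ] V := TensorProduct.lift ((LinearMap.lsmul ℝ V).comp Complex.imLm)
  have hre := congrArg re h
  have him := congrArg im h
  simp [re, im, cx] at hre him
  exact ⟨hre, him⟩

theorem mem_cxEigenspace_I {J : V →ₗ[ℝ] V} (hJ : ∀ u, J (J u) = -u) {u v : V} :
    cx u v ∈ cxEigenspace J Complex.I ↔ v = -J u := by
  have h₁ : J.baseChange ℂ (cx u v) = cx (J u) (J v) := by simp [cx]
  have h₂ : Complex.I • cx u v = cx (-v) u := by
    simp [cx, smul_add, TensorProduct.smul_tmul', TensorProduct.neg_tmul, TensorProduct.tmul_neg,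
      add_comm]
  rw [cxEigenspace, Module.End.mem_eigenspace_iff, h₁, h₂, cx_inj]
  constructor
  · rintro ⟨h, -⟩
    rw [h, neg_neg]
  · rintro rfl
    simp [hJ]

theorem mem_cxEigenspace_neg_I {J : V →ₗ[ℝ] V} (hJ : ∀ u, J (J u) = -u) {u v : V} :
    cx u v ∈ cxEigenspace J (-Complex.I) ↔ v = J u := by
  have h₁ : J.baseChange ℂ (cx u v) = cx (J u) (J v) := by simp [cx]
  have h₂ : (-Complex.I) • cx u v = cx v (-u) := by
    simp [cx, smul_add, TensorProduct.smul_tmul', TensorProduct.neg_tmul, TensorProduct.tmul_neg,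
      add_comm]
  rw [cxEigenspace, Module.End.mem_eigenspace_iff, h₁, h₂, cx_inj]
  constructor
  · rintro ⟨h, -⟩
    exact h.symm
  · rintro rfl
    simp [hJ]

end CxAlgebra

end Complexification

section Integrability

/-! ### Integrability of almost complex structures -/

variable {E : Type*} [NormedAddCommGroup E] [NormedSpace ℝ E] [FiniteDimensional ℝ E]
  {M : Type*} [TopologicalSpace M] [ChartedSpace E M] [IsManifold 𝓘(ℝ, E) ∞ M]

theorem mem_T10 {J : EndField E M} (hJ : ∀ x u, J x (J x u) = -u) {x : M}
    {u v : TangentSpace 𝓘(ℝ, E) x} : cx u v ∈ T10 J x ↔ v = -J x u :=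
  mem_cxEigenspace_I (hJ x)

theorem mlieBracket_neg_left {X Y : VField E M} {x : M} (hX : MDiffAt (T% X) x) :
    mlieBracket 𝓘(ℝ, E) (fun y ↦ -X y) Y x = -mlieBracket 𝓘(ℝ, E) X Y x := by
  have h : (fun y ↦ -X y) = (-1 : ℝ) • X := by ext y; simp
  rw [h, mlieBracket_const_smul_left hX, neg_one_smul]

theorem mlieBracket_neg_right {X Y : VField E M} {x : M} (hY : MDiffAt (T% Y) x) :
    mlieBracket 𝓘(ℝ, E) X (fun y ↦ -Y y) x = -mlieBracket 𝓘(ℝ, E) X Y x := by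
  have h : (fun y ↦ -Y y) = (-1 : ℝ) • Y := by ext y; simp
  rw [h, mlieBracket_const_smul_right hY, neg_one_smul]

theorem SmoothVField.mdifferentiableAt {X : VField E M} {U : Set M} (hX : SmoothVField X U)
    (hU : IsOpen U) {x : M} (hx : x ∈ U) : MDiffAt (T% X) x :=
  ((hX x hx).contMDiffAt (hU.mem_nhds hx)).mdifferentiableAt (by simp)

theorem SmoothEndField.smoothVField {J : EndField E M} (hJ : SmoothEndField J) {X : VField E M}
    {U : Set M} (hX : SmoothVField X U) : SmoothVField (fun y ↦ J y (X y)) U :=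
  ContMDiffOn.clm_bundle_apply (F₁ := E) (F₂ := E) (ContMDiff.contMDiffOn hJ) hX

/-- Every tangent vector is the value of a smooth vector field on an open neighbourhood. -/
theorem exists_smoothVField_extend {x : M} (u v : TangentSpace 𝓘(ℝ, E) x) :
    ∃ U : Set M, IsOpen U ∧ x ∈ U ∧ SmoothVField (FiberBundle.extend E u) U ∧
      SmoothVField (FiberBundle.extend E v) U := by
  obtain ⟨s, hs, hu⟩ := FiberBundle.exists_contMDiffOn_extend (k := ∞) 𝓘(ℝ, E) E u
  obtain ⟨t, ht, hv⟩ := FiberBundle.exists_contMDiffOn_extend (k := ∞) 𝓘(ℝ, E) E v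
  obtain ⟨U, hUst, hU, hx⟩ := mem_nhds_iff.1 (Filter.inter_mem hs ht)
  exact ⟨U, hU, hx, hu.mono (hUst.trans Set.inter_subset_left),
    hv.mono (hUst.trans Set.inter_subset_right)⟩

/-- The failure of a complex bracket of sections of `T^{1,0}` to lie in `T^{1,0}` is measured by
the difference of `(∇_X J)Y + J(∇_{JX} J)Y` and its transpose. -/
theorem nijenhuis_eq {g : Metric E M} {J : EndField E M} (hs : SmoothEndField J)
    (hJ : ∀ x u, J x (J x u) = -u) {X Y : VField E M} {x : M} (hX : MDiffAt (T% X) x)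
    (hY : MDiffAt (T% Y) x) :
    J x (mlieBracket 𝓘(ℝ, E) X Y x
        - mlieBracket 𝓘(ℝ, E) (fun y ↦ J y (X y)) (fun y ↦ J y (Y y)) x)
      - mlieBracket 𝓘(ℝ, E) X (fun y ↦ J y (Y y)) x - mlieBracket 𝓘(ℝ, E) (fun y ↦ J y (X y)) Y x
    = (covDerivEnd (leviCivita g) J x (Y x) (X x)
        + J x (covDerivEnd (leviCivita g) J x (J x (Y x)) (X x)))
      - (covDerivEnd (leviCivita g) J x (X x) (Y x)
        + J x (covDerivEnd (leviCivita g) J x (J x (X x)) (Y x))) := by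
  have hX' := hs.mdifferentiableAt hX
  have hY' := hs.mdifferentiableAt hY
  rw [mlieBracket_eq_leviCivita g hX hY, mlieBracket_eq_leviCivita g hX' hY',
    mlieBracket_eq_leviCivita g hX hY', mlieBracket_eq_leviCivita g hX' hY]
  simp only [covDeriv_apply _ hs hX, covDeriv_apply _ hs hY, map_sub, map_add, hJ]
  abel

/-- An almost complex structure is integrable exactly when `∇_{Ju} J = J ∘ ∇_u J`. -/
theorem isIntegrableACS_iff {g : Metric E M} {J : EndField E M} (hs : SmoothEndField J)
    (hJ : ∀ x u, J x (J x u) = -u) (ho : ∀ x u v, g.inner x (J x u) (J x v) = g.inner x u v) :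
    IsIntegrableACS J ↔ ∀ x, IsIntegrableForm (J x) (nablaForm g J x) := by
  constructor
  · intro h x
    refine IsIntegrableForm.of_symm (nablaForm_skew hs hJ ho x) (nablaForm_anti hs hJ ho x)
      fun u v w ↦ ?_
    obtain ⟨U, hU, hxU, hX, hY⟩ := exists_smoothVField_extend u v
    have hX' := hs.smoothVField hX
    have hY' := hs.smoothVField hY
    have hn {X : VField E M} (hX : SmoothVField X U) : SmoothVField (fun y ↦ -X y) U :=
      ContMDiffOn.neg_section hX
    have hm := h U hU _ _ _ _ hX (hn hX') hY (hn hY') (fun y _ ↦ (mem_T10 hJ).2 rfl)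
      (fun y _ ↦ (mem_T10 hJ).2 rfl) x hxU
    have dX := hX.mdifferentiableAt hU hxU
    have dY := hY.mdifferentiableAt hU hxU
    have dX' := hX'.mdifferentiableAt hU hxU
    have dY' := hY'.mdifferentiableAt hU hxU
    rw [mem_T10 hJ, mlieBracket_neg_left dX', mlieBracket_neg_right dY', mlieBracket_neg_right dY',
      mlieBracket_neg_left dX', neg_neg] at hm
    have hN := nijenhuis_eq (g := g) hs hJ dX dY
    rw [sub_sub, sub_eq_zero.2 (by rw [← neg_inj, neg_add, hm])] at hN
    simp only [FiberBundle.extend_apply_self] at hN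
    have := congrArg (fun z ↦ g.inner x z w) (sub_eq_zero.1 hN.symm)
    simp only [map_add, add_apply, inner_skew hJ ho] at this
    unfold nablaForm
    linarith
  · intro h U hU X X' Y Y' hX hX' hY hY' hXX' hYY' x hx
    have dX := hX.mdifferentiableAt hU hx
    have dY := hY.mdifferentiableAt hU hx
    have eX : X' =ᶠ[nhds x] fun y ↦ -J y (X y) := by
      filter_upwards [hU.mem_nhds hx] with y hy using (mem_T10 hJ).1 (hXX' y hy)
    have eY : Y' =ᶠ[nhds x] fun y ↦ -J y (Y y) := by
      filter_upwards [hU.mem_nhds hx] with y hy using (mem_T10 hJ).1 (hYY' y hy)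
    have dX' := hs.mdifferentiableAt dX
    have dY' := hs.mdifferentiableAt dY
    rw [mem_T10 hJ, eX.mlieBracket_vectorField_eq eY,
      Filter.EventuallyEq.rfl.mlieBracket_vectorField_eq eY,
      eX.mlieBracket_vectorField_eq (W := Y) (Filter.EventuallyEq.refl _ _),
      mlieBracket_neg_left dX', mlieBracket_neg_right dY', mlieBracket_neg_right dY',
      mlieBracket_neg_left dX', neg_neg]
    have hN := nijenhuis_eq (g := g) hs hJ dX dY
    have h0 : (covDerivEnd (leviCivita g) J x (Y x) (X x)
        + J x (covDerivEnd (leviCivita g) J x (J x (Y x)) (X x)))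
      - (covDerivEnd (leviCivita g) J x (X x) (Y x)
        + J x (covDerivEnd (leviCivita g) J x (J x (X x)) (Y x))) = 0 := by
      rw [sub_eq_zero]
      refine inner_ext g fun w ↦ ?_
      have := (h x).symm (X x) (Y x) w
      unfold nablaForm at this
      simp only [map_add, add_apply, inner_skew hJ ho]
      linarith
    rw [h0, sub_sub, sub_eq_zero] at hN
    rw [hN, neg_add]

end Integrability

section CourantBracket

/-! ### The Courant bracket in terms of the connections `∇±` -/

variable {E : Type*} [NormedAddCommGroup E] [NormedSpace ℝ E] [FiniteDimensional ℝ E]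
  {M : Type*} [TopologicalSpace M] [ChartedSpace E M] [IsManifold 𝓘(ℝ, E) ∞ M]

/-- Differentiability of a 1-form at a point. -/
def MDiffOneForm (η : OneForm E M) (x : M) : Prop :=
  MDifferentiableAt 𝓘(ℝ, E) (𝓘(ℝ, E).prod 𝓘(ℝ, E →L[ℝ] ℝ))
    (fun x ↦ TotalSpace.mk' (E →L[ℝ] ℝ) (E := fun x : M ↦ TangentSpace 𝓘(ℝ, E) x →L[ℝ] ℝ) x (η x)) x

theorem lieDeriv_apply (X : VField E M) {η : OneForm E M} {x : M} (hη : MDiffOneForm η x)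
    {Z : VField E M} (hZ : MDiffAt (T% Z) x) :
    lieDeriv X η x (Z x) = mvfderiv 𝓘(ℝ, E) (fun y ↦ η y (Z y)) x (X x)
      - η x (mlieBracket 𝓘(ℝ, E) X Z x) := by
  have : lieDeriv X η x = TensorialAt.mkHom _ x (lieDeriv_tensorial X hη) := dif_pos hη
  rw [this]
  exact TensorialAt.mkHom_apply (lieDeriv_tensorial X hη) hZ

theorem mvfderiv_congr {f f' : M → ℝ} {x : M} (h : f =ᶠ[nhds x] f') :
    mvfderiv 𝓘(ℝ, E) f x = mvfderiv 𝓘(ℝ, E) f' x := by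
  rw [mvfderiv, mvfderiv, h.mfderiv_eq]
  rfl

theorem lieDeriv_congr {X X' : VField E M} {η η' : OneForm E M} {x : M}
    (hX : ∀ᶠ y in nhds x, X y = X' y) (hη : ∀ᶠ y in nhds x, η y = η' y) :
    lieDeriv X η x = lieDeriv X' η' x := by
  have hd : MDiffOneForm η x ↔ MDiffOneForm η' x :=
    Filter.EventuallyEq.mdifferentiableAt_iff (hη.mono fun y hy ↦ by simp only [hy])
  by_cases h : MDiffOneForm η x
  · ext u
    rw [← FiberBundle.extend_apply_self E u,
      lieDeriv_apply X h (mdifferentiableAt_extend_tangent u),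
      lieDeriv_apply X' (hd.1 h) (mdifferentiableAt_extend_tangent u), hX.self_of_nhds,
      hη.self_of_nhds, Filter.EventuallyEq.mlieBracket_vectorField_eq (W := FiberBundle.extend E u)
        hX (Filter.EventuallyEq.refl _ _)]
    have : (fun y ↦ η y (FiberBundle.extend E u y)) =ᶠ[nhds x]
        fun y ↦ η' y (FiberBundle.extend E u y) := hη.mono fun y hy ↦ by simp only [hy]
    rw [mvfderiv_congr this]
  · have h₁ : lieDeriv X η x = 0 := dif_neg h
    have h₂ : lieDeriv X' η' x = 0 := dif_neg (fun h' ↦ h (hd.2 h'))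
    rw [h₁, h₂]

/-- The Courant bracket at a point depends only on the germs of the two sections. -/
theorem courant_congr {A A' B B' : GSection E M} {x : M} (hA : ∀ᶠ y in nhds x, A y = A' y)
    (hB : ∀ᶠ y in nhds x, B y = B' y) : courant A B x = courant A' B' x := by
  have hA₁ : ∀ᶠ y in nhds x, (A y).1 = (A' y).1 := hA.mono fun y hy ↦ by rw [hy]
  have hA₂ : ∀ᶠ y in nhds x, (A y).2 = (A' y).2 := hA.mono fun y hy ↦ by rw [hy]
  have hB₁ : ∀ᶠ y in nhds x, (B y).1 = (B' y).1 := hB.mono fun y hy ↦ by rw [hy]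
  have hB₂ : ∀ᶠ y in nhds x, (B y).2 = (B' y).2 := hB.mono fun y hy ↦ by rw [hy]
  have h : (fun y ↦ (B y).2 (A y).1 - (A y).2 (B y).1) =ᶠ[nhds x]
      fun y ↦ (B' y).2 (A' y).1 - (A' y).2 (B' y).1 := by
    filter_upwards [hA, hB] with y h₁ h₂
    rw [h₁, h₂]
  have h' : mvfderiv 𝓘(ℝ, E) (fun y ↦ (B y).2 (A y).1 - (A y).2 (B y).1) x
      = mvfderiv 𝓘(ℝ, E) (fun y ↦ (B' y).2 (A' y).1 - (A' y).2 (B' y).1) x :=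
    mvfderiv_congr h
  unfold courant
  rw [lieDeriv_congr hA₁ hB₂, lieDeriv_congr hB₁ hA₂, h',
    Filter.EventuallyEq.mlieBracket_vectorField_eq (V₁ := fun y ↦ (A y).1) (W₁ := fun y ↦ (B y).1)
      (V := fun y ↦ (A' y).1) (W := fun y ↦ (B' y).1) hA₁ hB₁]

theorem SmoothBForm.mdiffOneForm {B : BForm E M} (hB : SmoothBForm B) {X : VField E M} {x : M}
    (hX : MDiffAt (T% X) x) : MDiffOneForm (fun y ↦ B y (X y)) x :=
  MDifferentiableAt.clm_bundle_apply (F₁ := E) (F₂ := E →L[ℝ] ℝ)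
    (ContMDiff.mdifferentiableAt hB (by simp)) hX

theorem MDiffOneForm.add {η θ : OneForm E M} {x : M} (hη : MDiffOneForm η x)
    (hθ : MDiffOneForm θ x) : MDiffOneForm (fun y ↦ η y + θ y) x :=
  mdifferentiableAt_add_section hη hθ

variable (g : Metric E M) (b : BForm E M)

/-- The section `X + bX + gW` of `T ⊕ T*`. -/
def formSection (X W : VField E M) : GSection E M :=
  fun y ↦ (X y, b y (X y) + g.inner y (W y))

variable {g b}

/-- The 1-form component of a Courant bracket, written with the Levi-Civita connection. -/
theorem courant_formSection_snd (hb : SmoothBForm b) (hs : ∀ x u v, b x u v = -b x v u)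
    {X W Y V : VField E M} {x : M} (hX : MDiffAt (T% X) x) (hW : MDiffAt (T% W) x)
    (hY : MDiffAt (T% Y) x) (hV : MDiffAt (T% V) x) (z : TangentSpace 𝓘(ℝ, E) x) :
    (courant (formSection g b X W) (formSection g b Y V) x).2 z
      = b x (mlieBracket 𝓘(ℝ, E) X Y x) z + extDeriv₂ b x (X x) (Y x) z
        + g.inner x (leviCivita g V x (X x)) z - g.inner x (leviCivita g W x (Y x)) z
        + (1 / 2) * (g.inner x (V x) (leviCivita g X x z) - g.inner x (leviCivita g V x z) (X x)
          + g.inner x (leviCivita g W x z) (Y x) - g.inner x (W x) (leviCivita g Y x z)) := by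
  have hg : SmoothBForm g.inner := g.contMDiff
  have hZ := mdifferentiableAt_extend_tangent z
  have hz : FiberBundle.extend E z x = z := FiberBundle.extend_apply_self E z
  have hadd {f₁ f₂ : M → ℝ} (h₁ : MDiffAt f₁ x) (h₂ : MDiffAt f₂ x)
      (t : TangentSpace 𝓘(ℝ, E) x) : mvfderiv 𝓘(ℝ, E) (fun y ↦ f₁ y + f₂ y) x t
        = mvfderiv 𝓘(ℝ, E) f₁ x t + mvfderiv 𝓘(ℝ, E) f₂ x t := by
    have := mvfderiv_add h₁ h₂
    exact congrArg (fun L ↦ L t) this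
  have hsub {f₁ f₂ : M → ℝ} (h₁ : MDiffAt f₁ x) (h₂ : MDiffAt f₂ x)
      (t : TangentSpace 𝓘(ℝ, E) x) : mvfderiv 𝓘(ℝ, E) (fun y ↦ f₁ y - f₂ y) x t
        = mvfderiv 𝓘(ℝ, E) f₁ x t - mvfderiv 𝓘(ℝ, E) f₂ x t := by
    have := mvfderiv_sub h₁ h₂
    exact congrArg (fun L ↦ L t) this
  have hd (X Y : VField E M) (t : TangentSpace 𝓘(ℝ, E) x) :
      mvfderiv 𝓘(ℝ, E) (fun y ↦ b y (X y) (Y y)) x t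
        = -mvfderiv 𝓘(ℝ, E) (fun y ↦ b y (Y y) (X y)) x t := by
    have : (fun y ↦ b y (X y) (Y y)) = -(fun y ↦ b y (Y y) (X y)) := by
      ext y; exact hs y _ _
    rw [this, mvfderiv_neg]
    rfl
  have hη : MDiffOneForm (fun y ↦ b y (Y y) + g.inner y (V y)) x :=
    (hb.mdiffOneForm hY).add (hg.mdiffOneForm hV)
  have hξ : MDiffOneForm (fun y ↦ b y (X y) + g.inner y (W y)) x :=
    (hb.mdiffOneForm hX).add (hg.mdiffOneForm hW)
  have h₁ := lieDeriv_apply X hη hZ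
  have h₂ := lieDeriv_apply Y hξ hZ
  simp only [add_apply] at h₁ h₂
  rw [hadd (hb.mdiff hY hZ) (hg.mdiff hV hZ), leviCivita_metric g x V _ hV hZ] at h₁
  rw [hadd (hb.mdiff hX hZ) (hg.mdiff hW hZ), leviCivita_metric g x W _ hW hZ] at h₂
  have h₃ : mvfderiv 𝓘(ℝ, E) (fun y ↦ (b y (Y y) + g.inner y (V y)) (X y)
      - (b y (X y) + g.inner y (W y)) (Y y)) x z
      = -2 * mvfderiv 𝓘(ℝ, E) (fun y ↦ b y (X y) (Y y)) x z
        + (g.inner x (leviCivita g V x z) (X x) + g.inner x (V x) (leviCivita g X x z))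
        - (g.inner x (leviCivita g W x z) (Y x) + g.inner x (W x) (leviCivita g Y x z)) := by
    simp only [add_apply]
    rw [hsub (f₁ := fun y ↦ b y (Y y) (X y) + g.inner y (V y) (X y))
      (f₂ := fun y ↦ b y (X y) (Y y) + g.inner y (W y) (Y y))
      ((hb.mdiff hY hX).add (hg.mdiff hV hX)) ((hb.mdiff hX hY).add (hg.mdiff hW hY)),
      hadd (hb.mdiff hY hX) (hg.mdiff hV hX), hadd (hb.mdiff hX hY) (hg.mdiff hW hY),
      leviCivita_metric g x V X hV hX, leviCivita_metric g x W Y hW hY, hd Y X]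
    ring
  have h₄ := extDerivAux_eq hb hs hX hY hZ
  rw [hz] at h₁ h₂ h₄
  have h₅ : (courant (formSection g b X W) (formSection g b Y V) x).2 z
      = lieDeriv X (fun y ↦ b y (Y y) + g.inner y (V y)) x z
        - lieDeriv Y (fun y ↦ b y (X y) + g.inner y (W y)) x z
        - (1 / 2) * mvfderiv 𝓘(ℝ, E) (fun y ↦ (b y (Y y) + g.inner y (V y)) (X y)
            - (b y (X y) + g.inner y (W y)) (Y y)) x z := rfl
  rw [h₅, h₁, h₂, h₃, ← h₄, extDerivAux, hz, hd (FiberBundle.extend E z) X,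
    mlieBracket_swap_apply (V := FiberBundle.extend E z) (W := X),
    mlieBracket_eq_leviCivita g hX hZ, mlieBracket_eq_leviCivita g hY hZ]
  simp only [map_sub, map_neg, sub_apply, neg_apply, hz, hs x (Y x), hs x (X x)]
  ring

end CourantBracket

section Splitting

/-! ### The splitting of `T ⊕ T*` into the graphs of `b ± g` -/

variable {E : Type*} [NormedAddCommGroup E] [NormedSpace ℝ E] [FiniteDimensional ℝ E]
  {M : Type*} [TopologicalSpace M] [ChartedSpace E M] [IsManifold 𝓘(ℝ, E) ∞ M]

variable (g : Metric E M) (b : BForm E M)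

/-- The vector `p` in the decomposition `v = (p + (b + g)p) + (q + (b - g)q)`. -/
def plusPart (x : M) : GT E x →L[ℝ] TangentSpace 𝓘(ℝ, E) x :=
  (1 / 2 : ℝ) • (ContinuousLinearMap.fst ℝ _ _ + sharp g x ∘L
    (ContinuousLinearMap.snd ℝ _ _ - b x ∘L ContinuousLinearMap.fst ℝ _ _))

/-- The vector `q` in the decomposition `v = (p + (b + g)p) + (q + (b - g)q)`. -/
def minusPart (x : M) : GT E x →L[ℝ] TangentSpace 𝓘(ℝ, E) x :=
  (1 / 2 : ℝ) • (ContinuousLinearMap.fst ℝ _ _ - sharp g x ∘L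
    (ContinuousLinearMap.snd ℝ _ _ - b x ∘L ContinuousLinearMap.fst ℝ _ _))

/-- The vector `(p + (b + g)p) + (q + (b - g)q)` of `T ⊕ T*`. -/
def joinParts (x : M) (p q : TangentSpace 𝓘(ℝ, E) x) : GT E x :=
  (p + q, b x (p + q) + g.inner x (p - q))

variable {g b}

theorem plusPart_apply (x : M) (v : GT E x) :
    plusPart g b x v = (1 / 2 : ℝ) • (v.1 + sharp g x (v.2 - b x v.1)) := rfl

theorem minusPart_apply (x : M) (v : GT E x) :
    minusPart g b x v = (1 / 2 : ℝ) • (v.1 - sharp g x (v.2 - b x v.1)) := rfl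

theorem plusPart_joinParts (x : M) (p q : TangentSpace 𝓘(ℝ, E) x) :
    plusPart g b x (joinParts g b x p q) = p := by
  rw [plusPart_apply, joinParts, add_sub_cancel_left, sharp_inner]
  module

theorem minusPart_joinParts (x : M) (p q : TangentSpace 𝓘(ℝ, E) x) :
    minusPart g b x (joinParts g b x p q) = q := by
  rw [minusPart_apply, joinParts, add_sub_cancel_left, sharp_inner]
  module

theorem plusPart_add_minusPart (x : M) (v : GT E x) :
    plusPart g b x v + minusPart g b x v = v.1 := by
  rw [plusPart_apply, minusPart_apply]
  module

theorem joinParts_parts (x : M) (v : GT E x) :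
    joinParts g b x (plusPart g b x v) (minusPart g b x v) = v := by
  have h : plusPart g b x v - minusPart g b x v = sharp g x (v.2 - b x v.1) := by
    rw [plusPart_apply, minusPart_apply]
    module
  rw [joinParts, plusPart_add_minusPart, h, inner_sharp, add_sub_cancel]

theorem ext_parts {x : M} {v w : GT E x} (hp : plusPart g b x v = plusPart g b x w)
    (hm : minusPart g b x v = minusPart g b x w) : v = w := by
  rw [← joinParts_parts (g := g) (b := b) x v, hp, hm, joinParts_parts]

theorem minusPart_eq_zero_iff (x : M) (v : GT E x) :
    minusPart g b x v = 0 ↔ v.2 = b x v.1 + g.inner x v.1 := by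
  rw [minusPart_apply, smul_eq_zero_iff_right (by norm_num), sub_eq_zero]
  constructor
  · intro h
    have := congrArg (g.inner x) h
    rw [inner_sharp] at this
    rw [this, add_sub_cancel]
  · intro h
    rw [h, add_sub_cancel_left, sharp_inner]

theorem plusPart_eq_zero_iff (x : M) (v : GT E x) :
    plusPart g b x v = 0 ↔ v.2 = b x v.1 - g.inner x v.1 := by
  rw [plusPart_apply, smul_eq_zero_iff_right (by norm_num), add_eq_zero_iff_eq_neg]
  constructor
  · intro h
    have := congrArg (g.inner x) h
    rw [map_neg, inner_sharp] at this
    rw [this]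
    abel
  · intro h
    rw [h, sub_sub_cancel_left, map_neg, sharp_inner, neg_neg]

/-- The `+`-part of `v`, paired with `z`; here `v.2 - b v.1` is the component of `v` in `T*`
after the shear by `b`. -/
theorem inner_plusPart (x : M) (v : GT E x) (z : TangentSpace 𝓘(ℝ, E) x) :
    g.inner x (plusPart g b x v) z = (1 / 2) * (g.inner x v.1 z + (v.2 z - b x v.1 z)) := by
  rw [plusPart_apply, map_smul, smul_apply, map_add, add_apply, inner_sharp, sub_apply, smul_eq_mul]

theorem inner_minusPart (x : M) (v : GT E x) (z : TangentSpace 𝓘(ℝ, E) x) :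
    g.inner x (minusPart g b x v) z = (1 / 2) * (g.inner x v.1 z - (v.2 z - b x v.1 z)) := by
  rw [minusPart_apply, map_smul, smul_apply, map_sub, sub_apply, inner_sharp, sub_apply,
    smul_eq_mul]

/-- The inner product on `T ⊕ T*` restricts to `±g` on the graph of `b ± g`, and the two graphs are
orthogonal. -/
theorem pairing_eq_inner (hs : ∀ x u v, b x u v = -b x v u) (x : M) (v w : GT E x) :
    pairing v w = g.inner x (plusPart g b x v) (plusPart g b x w)
      - g.inner x (minusPart g b x v) (minusPart g b x w) := by
  have key (p q r s : TangentSpace 𝓘(ℝ, E) x) :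
      pairing (joinParts g b x p q) (joinParts g b x r s) = g.inner x p r - g.inner x q s := by
    simp only [pairing, joinParts, map_add, map_sub, add_apply, sub_apply]
    rw [hs x r p, hs x s p, hs x r q, hs x s q, g.symm x r, g.symm x s, g.symm x r, g.symm x s]
    ring
  rw [← key, joinParts_parts, joinParts_parts]

/-- The expression for the `±`-parts of a Courant bracket of sections with parts `P, Q` and `R, S`;
here `p, q, r, s` are the values at a point and `dP, …` the covariant derivatives. -/
def bracketForm (g : Metric E M) (x : M)
    (h : TangentSpace 𝓘(ℝ, E) x → TangentSpace 𝓘(ℝ, E) x → TangentSpace 𝓘(ℝ, E) x → ℝ)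
    (p q r s : TangentSpace 𝓘(ℝ, E) x)
    (dP dQ dR dS : TangentSpace 𝓘(ℝ, E) x →L[ℝ] TangentSpace 𝓘(ℝ, E) x)
    (z : TangentSpace 𝓘(ℝ, E) x) : ℝ :=
  g.inner x (dR (p + q) - dP (r + s)) z - h p r z
    + (1 / 2) * (g.inner x r (dP z) - g.inner x p (dR z))
    - (1 / 2) * (g.inner x s (dQ z) - g.inner x q (dS z))

/-- If `J` and `J'` commute with the covariant derivatives and the torsion has type
`(2,1) + (1,2)`, the bracket of two sections with parts in the `+i`-eigenbundles of `J` and `J'` has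
its part in the `+i`-eigenbundle of `J`. -/
theorem bracketForm_closed {x : M}
    {h : TangentSpace 𝓘(ℝ, E) x → TangentSpace 𝓘(ℝ, E) x → TangentSpace 𝓘(ℝ, E) x → ℝ}
    {J J' : TangentSpace 𝓘(ℝ, E) x →L[ℝ] TangentSpace 𝓘(ℝ, E) x} (hJ : ∀ u, J (J u) = -u)
    (hJ' : ∀ u, J' (J' u) = -u) (hg : ∀ u v, g.inner x (J u) v = -g.inner x u (J v))
    (hg' : ∀ u v, g.inner x (J' u) v = -g.inner x u (J' v)) (hh : Homogeneous₃ h)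
    (ht : IsType21 J h) (p q r s : TangentSpace 𝓘(ℝ, E) x)
    (dP dQ dR dS : TangentSpace 𝓘(ℝ, E) x →L[ℝ] TangentSpace 𝓘(ℝ, E) x)
    (z : TangentSpace 𝓘(ℝ, E) x) :
    bracketForm g x h p q (-J r) (-J' s) dP dQ (-(J ∘L dR)) (-(J' ∘L dS)) z
      + bracketForm g x h (-J p) (-J' q) r s (-(J ∘L dP)) (-(J' ∘L dQ)) dR dS z
    = bracketForm g x h p q r s dP dQ dR dS (J z)
      - bracketForm g x h (-J p) (-J' q) (-J r) (-J' s) (-(J ∘L dP)) (-(J' ∘L dQ))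
          (-(J ∘L dR)) (-(J' ∘L dS)) (J z) := by
  have ht' := ht p r (J z)
  rw [hJ, hh.neg₃, hh.neg₃] at ht'
  simp only [bracketForm, map_add, map_sub, map_neg, add_apply, sub_apply, neg_apply,
    ContinuousLinearMap.comp_apply, hg, hg', hJ, hJ', hh.neg₁, hh.neg₂]
  linarith

variable (g b) in
/-- The section of `T ⊕ T*` with parts `P` and `Q`. -/
def joinSection (P Q : VField E M) : GSection E M := fun y ↦ joinParts g b y (P y) (Q y)

theorem courant_joinSection_fst (P Q R S : VField E M) (x : M) :
    (courant (joinSection g b P Q) (joinSection g b R S) x).1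
      = mlieBracket 𝓘(ℝ, E) (fun y ↦ P y + Q y) (fun y ↦ R y + S y) x := rfl

section Bracket

variable (hb : SmoothBForm b) (hs : ∀ x u v, b x u v = -b x v u) {P Q R S : VField E M} {x : M}
  (hP : MDiffAt (T% P) x) (hQ : MDiffAt (T% Q) x) (hR : MDiffAt (T% R) x) (hS : MDiffAt (T% S) x)
include hb hs hP hQ hR hS

/-- The 1-form component of the Courant bracket in terms of `±`-parts: the mixed terms of `P, R`
with `Q, S` cancel. -/
theorem courant_joinSection_snd (z : TangentSpace 𝓘(ℝ, E) x) :
    (courant (joinSection g b P Q) (joinSection g b R S) x).2 z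
      - b x (mlieBracket 𝓘(ℝ, E) (fun y ↦ P y + Q y) (fun y ↦ R y + S y) x) z
      = extDeriv₂ b x (P x + Q x) (R x + S x) z
        + g.inner x (leviCivita g R x (P x + Q x) - leviCivita g S x (P x + Q x)) z
        - g.inner x (leviCivita g P x (R x + S x) - leviCivita g Q x (R x + S x)) z
        + (g.inner x (R x) (leviCivita g P x z) - g.inner x (P x) (leviCivita g R x z))
        - (g.inner x (S x) (leviCivita g Q x z) - g.inner x (Q x) (leviCivita g S x z)) := by
  have hsub {X Y : VField E M} (hX : MDiffAt (T% X) x) (hY : MDiffAt (T% Y) x) :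
      leviCivita g (fun y ↦ X y - Y y) x = leviCivita g X x - leviCivita g Y x := by
    have h := Connection.map_add (leviCivita g) hX (mdifferentiableAt_neg_section hY)
    ext u
    have h' := congrArg (fun L ↦ L u) h
    have h'' := Connection.map_neg (leviCivita g) hY u
    simp only [sub_eq_add_neg, add_apply, neg_apply, ← h'']
    exact h'
  have h := courant_formSection_snd (g := g) hb hs (X := fun y ↦ P y + Q y)
    (W := fun y ↦ P y - Q y) (Y := fun y ↦ R y + S y) (V := fun y ↦ R y - S y)
    (mdifferentiableAt_add_section hP hQ) (mdifferentiableAt_sub_section hP hQ)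
    (mdifferentiableAt_add_section hR hS) (mdifferentiableAt_sub_section hR hS) z
  rw [hsub hP hQ, hsub hR hS, Connection.map_add _ hP hQ, Connection.map_add _ hR hS] at h
  refine (sub_eq_iff_eq_add.2 (h.trans ?_))
  simp only [map_add, map_sub, add_apply, sub_apply]
  rw [g.symm x (leviCivita g R x z), g.symm x (leviCivita g R x z), g.symm x (leviCivita g S x z),
    g.symm x (leviCivita g S x z), g.symm x (leviCivita g P x z), g.symm x (leviCivita g P x z),
    g.symm x (leviCivita g Q x z), g.symm x (leviCivita g Q x z)]
  ring

theorem inner_fst_courant (z : TangentSpace 𝓘(ℝ, E) x) :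
    g.inner x (courant (joinSection g b P Q) (joinSection g b R S) x).1 z
      = g.inner x (leviCivita g R x (P x + Q x) + leviCivita g S x (P x + Q x)) z
        - g.inner x (leviCivita g P x (R x + S x) + leviCivita g Q x (R x + S x)) z := by
  rw [courant_joinSection_fst, mlieBracket_eq_leviCivita g (X := fun y ↦ P y + Q y)
    (Y := fun y ↦ R y + S y) (mdifferentiableAt_add_section hP hQ)
    (mdifferentiableAt_add_section hR hS), Connection.map_add _ hP hQ, Connection.map_add _ hR hS,
    map_sub, sub_apply]
  rfl

/-- The `+`-part of the Courant bracket. With `∇⁺` acting on `+`-parts and `∇⁻` on `-`-parts, the only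
remaining term in `h` is the one pairing the two `+`-parts. -/
theorem inner_plusPart_courant (z : TangentSpace 𝓘(ℝ, E) x) :
    g.inner x (plusPart g b x (courant (joinSection g b P Q) (joinSection g b R S) x)) z
      = bracketForm g x (extDeriv₂ b x) (P x) (Q x) (R x) (S x)
        (torsionConnection g b hb hs 1 P x) (torsionConnection g b hb hs (-1) Q x)
        (torsionConnection g b hb hs 1 R x) (torsionConnection g b hb hs (-1) S x) z := by
  have hadd := extDeriv₂_add hb hs x
  have hcyc := extDeriv₂_cyc b x
  have hsk := extDeriv₂_skew hs x
  have hadd₂ (u v v' w) :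
      extDeriv₂ b x u (v + v') w = extDeriv₂ b x u v w + extDeriv₂ b x u v' w := by
    rw [hcyc, hadd, hcyc u v, hcyc u v']
  rw [inner_plusPart, inner_fst_courant hb hs hP hQ hR hS, courant_joinSection_fst,
    courant_joinSection_snd hb hs hP hQ hR hS]
  simp only [bracketForm]
  rw [g.symm x (R x) (torsionConnection g b hb hs 1 P x z),
    g.symm x (P x) (torsionConnection g b hb hs 1 R x z),
    g.symm x (S x) (torsionConnection g b hb hs (-1) Q x z),
    g.symm x (Q x) (torsionConnection g b hb hs (-1) S x z)]
  simp only [map_sub, sub_apply, map_add, add_apply, inner_torsionConnection, hadd, hadd₂]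
  rw [hcyc z, hcyc z, hcyc z, hcyc z, hsk (R x) (P x), hsk (S x) (P x), hsk (S x) (Q x),
    g.symm x (R x), g.symm x (P x), g.symm x (Q x), g.symm x (S x)]
  ring

/-- The `-`-part of the Courant bracket; it arises from the `+`-part by exchanging the parts and
replacing `h` with `-h`. -/
theorem inner_minusPart_courant (z : TangentSpace 𝓘(ℝ, E) x) :
    g.inner x (minusPart g b x (courant (joinSection g b P Q) (joinSection g b R S) x)) z
      = bracketForm g x (fun u v w ↦ -extDeriv₂ b x u v w) (Q x) (P x) (S x) (R x)
        (torsionConnection g b hb hs (-1) Q x) (torsionConnection g b hb hs 1 P x)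
        (torsionConnection g b hb hs (-1) S x) (torsionConnection g b hb hs 1 R x) z := by
  have hadd := extDeriv₂_add hb hs x
  have hcyc := extDeriv₂_cyc b x
  have hsk := extDeriv₂_skew hs x
  have hadd₂ (u v v' w) :
      extDeriv₂ b x u (v + v') w = extDeriv₂ b x u v w + extDeriv₂ b x u v' w := by
    rw [hcyc, hadd, hcyc u v, hcyc u v']
  rw [inner_minusPart, inner_fst_courant hb hs hP hQ hR hS, courant_joinSection_fst,
    courant_joinSection_snd hb hs hP hQ hR hS]
  simp only [bracketForm]
  rw [g.symm x (R x) (torsionConnection g b hb hs 1 P x z),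
    g.symm x (P x) (torsionConnection g b hb hs 1 R x z),
    g.symm x (S x) (torsionConnection g b hb hs (-1) Q x z),
    g.symm x (Q x) (torsionConnection g b hb hs (-1) S x z)]
  simp only [map_sub, sub_apply, map_add, add_apply, inner_torsionConnection, hadd, hadd₂]
  rw [hcyc z, hcyc z, hcyc z, hcyc z, hsk (R x) (P x), hsk (S x) (Q x), hsk (R x) (Q x),
    g.symm x (R x), g.symm x (P x), g.symm x (Q x), g.symm x (S x)]
  ring

end Bracket

end Splitting

section Involutivity

/-! ### Smooth sections and their parts -/

variable {E : Type*} [NormedAddCommGroup E] [NormedSpace ℝ E] [FiniteDimensional ℝ E]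
  {M : Type*} [TopologicalSpace M] [ChartedSpace E M] [IsManifold 𝓘(ℝ, E) ∞ M]

variable {g : Metric E M} {b : BForm E M}

/-- Smoothness of a 1-form at a point. -/
def SmoothOneFormAt (η : OneForm E M) (x : M) : Prop :=
  ContMDiffAt 𝓘(ℝ, E) (𝓘(ℝ, E).prod 𝓘(ℝ, E →L[ℝ] ℝ)) ∞
    (fun x ↦ TotalSpace.mk' (E →L[ℝ] ℝ) (E := fun x : M ↦ TangentSpace 𝓘(ℝ, E) x →L[ℝ] ℝ) x (η x)) x

/-- Smoothness of a vector field at a point. -/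
def SmoothVFieldAt (X : VField E M) (x : M) : Prop :=
  ContMDiffAt 𝓘(ℝ, E) (𝓘(ℝ, E).prod 𝓘(ℝ, E)) ∞ (fun x ↦ TotalSpace.mk' E x (X x)) x

/-- Smoothness of a section of `T ⊕ T*` at a point. -/
def SmoothGSectionAt (A : GSection E M) (x : M) : Prop :=
  ContMDiffAt 𝓘(ℝ, E) (𝓘(ℝ, E).prod 𝓘(ℝ, E × (E →L[ℝ] ℝ))) ∞
    (fun x ↦ TotalSpace.mk' (E × (E →L[ℝ] ℝ)) (E := fun x : M ↦ GT E x) x (A x)) x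

theorem smoothGSectionAt_iff {A : GSection E M} {x : M} :
    SmoothGSectionAt A x ↔
      SmoothVFieldAt (fun y ↦ (A y).1) x ∧ SmoothOneFormAt (fun y ↦ (A y).2) x :=
  contMDiffAt_section_prod_iff

theorem smoothGSection_iff {A : GSection E M} {U : Set M} (hU : IsOpen U) :
    SmoothGSection A U ↔ ∀ x ∈ U, SmoothGSectionAt A x :=
  ⟨fun h x hx ↦ (h x hx).contMDiffAt (hU.mem_nhds hx), fun h x hx ↦ (h x hx).contMDiffWithinAt⟩

theorem smoothVField_iff {X : VField E M} {U : Set M} (hU : IsOpen U) :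
    SmoothVField X U ↔ ∀ x ∈ U, SmoothVFieldAt X x :=
  ⟨fun h x hx ↦ (h x hx).contMDiffAt (hU.mem_nhds hx), fun h x hx ↦ (h x hx).contMDiffWithinAt⟩

theorem SmoothBForm.apply {B : BForm E M} (hB : SmoothBForm B) {X : VField E M} {x : M}
    (hX : SmoothVFieldAt X x) : SmoothOneFormAt (fun y ↦ B y (X y)) x :=
  ContMDiffAt.clm_bundle_apply (F₁ := E) (F₂ := E →L[ℝ] ℝ) (ContMDiff.contMDiffAt hB) hX

theorem smooth_sharp (g : Metric E M) {η : OneForm E M} {x : M} (hη : SmoothOneFormAt η x) :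
    SmoothVFieldAt (fun y ↦ sharp g y (η y)) x := by
  have hg : SmoothBForm g.inner := g.contMDiff
  have := contMDiffAt_hom_inverse (F₁ := E) (F₂ := E →L[ℝ] ℝ)
    (E₁ := fun x : M ↦ TangentSpace 𝓘(ℝ, E) x)
    (E₂ := fun x : M ↦ TangentSpace 𝓘(ℝ, E) x →L[ℝ] ℝ) (φ := g.inner) (ψ := sharp g)
    (sharp_inner g) (inner_sharp g) (ContMDiff.contMDiffAt hg (x := x))
  exact ContMDiffAt.clm_bundle_apply (F₁ := E →L[ℝ] ℝ) (F₂ := E) this hη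

theorem SmoothVFieldAt.add {X Y : VField E M} {x : M} (hX : SmoothVFieldAt X x)
    (hY : SmoothVFieldAt Y x) : SmoothVFieldAt (fun y ↦ X y + Y y) x :=
  ContMDiffAt.add_section hX hY

theorem SmoothVFieldAt.sub {X Y : VField E M} {x : M} (hX : SmoothVFieldAt X x)
    (hY : SmoothVFieldAt Y x) : SmoothVFieldAt (fun y ↦ X y - Y y) x :=
  ContMDiffAt.sub_section hX hY

theorem SmoothVFieldAt.neg {X : VField E M} {x : M} (hX : SmoothVFieldAt X x) :
    SmoothVFieldAt (fun y ↦ -X y) x :=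
  ContMDiffAt.neg_section hX

theorem SmoothVFieldAt.smul (c : ℝ) {X : VField E M} {x : M} (hX : SmoothVFieldAt X x) :
    SmoothVFieldAt (fun y ↦ c • X y) x :=
  ContMDiffAt.const_smul_section hX

theorem SmoothOneFormAt.add {η θ : OneForm E M} {x : M} (hη : SmoothOneFormAt η x)
    (hθ : SmoothOneFormAt θ x) : SmoothOneFormAt (fun y ↦ η y + θ y) x :=
  ContMDiffAt.add_section hη hθ

theorem SmoothOneFormAt.sub {η θ : OneForm E M} {x : M} (hη : SmoothOneFormAt η x)
    (hθ : SmoothOneFormAt θ x) : SmoothOneFormAt (fun y ↦ η y - θ y) x :=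
  ContMDiffAt.sub_section hη hθ

theorem SmoothVFieldAt.mdifferentiableAt {X : VField E M} {x : M} (hX : SmoothVFieldAt X x) :
    MDiffAt (T% X) x :=
  ContMDiffAt.mdifferentiableAt hX (by simp)

theorem SmoothEndField.apply {J : EndField E M} (hJ : SmoothEndField J) {X : VField E M} {x : M}
    (hX : SmoothVFieldAt X x) : SmoothVFieldAt (fun y ↦ J y (X y)) x :=
  ContMDiffAt.clm_bundle_apply (F₁ := E) (F₂ := E) (ContMDiff.contMDiffAt hJ) hX

theorem smooth_plusPart (hb : SmoothBForm b) {A : GSection E M} {x : M}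
    (hA : SmoothGSectionAt A x) : SmoothVFieldAt (fun y ↦ plusPart g b y (A y)) x := by
  obtain ⟨h₁, h₂⟩ := smoothGSectionAt_iff.1 hA
  exact (h₁.add (smooth_sharp g (h₂.sub (hb.apply h₁)))).smul _

theorem smooth_minusPart (hb : SmoothBForm b) {A : GSection E M} {x : M}
    (hA : SmoothGSectionAt A x) : SmoothVFieldAt (fun y ↦ minusPart g b y (A y)) x := by
  obtain ⟨h₁, h₂⟩ := smoothGSectionAt_iff.1 hA
  exact (h₁.sub (smooth_sharp g (h₂.sub (hb.apply h₁)))).smul _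

theorem smooth_joinSection (hb : SmoothBForm b) {P Q : VField E M} {x : M}
    (hP : SmoothVFieldAt P x) (hQ : SmoothVFieldAt Q x) :
    SmoothGSectionAt (joinSection g b P Q) x := by
  have hg : SmoothBForm g.inner := g.contMDiff
  exact smoothGSectionAt_iff.2 ⟨hP.add hQ, (hb.apply (hP.add hQ)).add (hg.apply (hP.sub hQ))⟩

/-! ### Involutivity from parallel complex structures -/

theorem Connection.neg_comp {nabla : Connection E M} {J : EndField E M} (hs : SmoothEndField J)
    (hp : IsParallel J nabla) {X : VField E M} {x : M} (hX : MDiffAt (T% X) x) :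
    nabla (fun y ↦ -J y (X y)) x = -(J x ∘L nabla X x) := by
  ext u
  rw [Connection.map_neg nabla (hs.mdifferentiableAt hX), hp x X hX u]
  rfl

/-- The condition for `φ((d - e) + i(a + c))` to lie in the `+i`-eigenspace of `j`, tested against all
vectors `z`. -/
theorem map_add_eq_neg_map_sub {x : M} {φ : GT E x →L[ℝ] TangentSpace 𝓘(ℝ, E) x}
    {j : TangentSpace 𝓘(ℝ, E) x →L[ℝ] TangentSpace 𝓘(ℝ, E) x}
    (hj : ∀ u v, g.inner x (j u) v = -g.inner x u (j v)) {a c d e : GT E x}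
    (h : ∀ z, g.inner x (φ a) z + g.inner x (φ c) z
      = g.inner x (φ d) (j z) - g.inner x (φ e) (j z)) : φ (a + c) = -j (φ (d - e)) := by
  refine inner_ext g fun z ↦ ?_
  have hneg (u v : TangentSpace 𝓘(ℝ, E) x) : g.inner x (-u) v = -g.inner x u v := by simp
  rw [φ.map_add, φ.map_sub, hneg, hj, neg_neg, (g.inner x).map_add,
    (g.inner x).map_sub, add_apply, sub_apply, h]

/-- A complex subbundle spanned by the `+i`-eigenbundles of `J` and `J'` on the graphs of `b + g`
and `b - g` is involutive if `J` and `J'` are parallel for `∇⁺` and `∇⁻` and `db` has type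
`(2,1) + (1,2)` for both. -/
theorem courantInvolutive_of_parallel (hb : SmoothBForm b) (hsk : ∀ x u v, b x u v = -b x v u)
    {J J' : EndField E M} (hs : SmoothEndField J) (hs' : SmoothEndField J')
    (hJ : ∀ x u, J x (J x u) = -u) (hJ' : ∀ x u, J' x (J' x u) = -u)
    (ho : ∀ x u v, g.inner x (J x u) (J x v) = g.inner x u v)
    (ho' : ∀ x u v, g.inner x (J' x u) (J' x v) = g.inner x u v)
    (hp : IsParallel J (torsionConnection g b hb hsk 1))
    (hp' : IsParallel J' (torsionConnection g b hb hsk (-1)))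
    (ht : ∀ x, IsType21 (J x) (extDeriv₂ b x)) (ht' : ∀ x, IsType21 (J' x) (extDeriv₂ b x))
    {L : Π x : M, Submodule ℂ (ℂ ⊗[ℝ] GT E x)}
    (hL : ∀ x (v w : GT E x), cx v w ∈ L x ↔
      plusPart g b x w = -J x (plusPart g b x v) ∧ minusPart g b x w = -J' x (minusPart g b x v)) :
    CourantInvolutive L := by
  intro U hU A A' B B' hA hA' hB hB' hAA' hBB' x hx
  have hhom := extDeriv₂_homogeneous hb hsk x
  -- Replace the sections by ones that have the prescribed parts everywhere.
  have hrepl {A A' : GSection E M} (h : ∀ y ∈ U, cx (A y) (A' y) ∈ L y) :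
      ∀ᶠ y in nhds x, A' y = joinSection g b (fun y ↦ -J y (plusPart g b y (A y)))
        (fun y ↦ -J' y (minusPart g b y (A y))) y := by
    filter_upwards [hU.mem_nhds hx] with y hy
    obtain ⟨h₁, h₂⟩ := (hL y _ _).1 (h y hy)
    rw [joinSection, ← h₁, ← h₂, joinParts_parts]
  have hself (A : GSection E M) : ∀ᶠ y in nhds x, A y
      = joinSection g b (fun y ↦ plusPart g b y (A y)) (fun y ↦ minusPart g b y (A y)) y :=
    Filter.Eventually.of_forall fun y ↦ (joinParts_parts y _).symm
  have hP := (smooth_plusPart (g := g) hb ((smoothGSection_iff hU).1 hA x hx)).mdifferentiableAt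
  have hQ := (smooth_minusPart (g := g) hb ((smoothGSection_iff hU).1 hA x hx)).mdifferentiableAt
  have hR := (smooth_plusPart (g := g) hb ((smoothGSection_iff hU).1 hB x hx)).mdifferentiableAt
  have hS := (smooth_minusPart (g := g) hb ((smoothGSection_iff hU).1 hB x hx)).mdifferentiableAt
  have hP' : MDiffAt (T% fun y ↦ -J y (plusPart g b y (A y))) x :=
    mdifferentiableAt_neg_section (hs.mdifferentiableAt hP)
  have hQ' : MDiffAt (T% fun y ↦ -J' y (minusPart g b y (A y))) x :=
    mdifferentiableAt_neg_section (hs'.mdifferentiableAt hQ)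
  have hR' : MDiffAt (T% fun y ↦ -J y (plusPart g b y (B y))) x :=
    mdifferentiableAt_neg_section (hs.mdifferentiableAt hR)
  have hS' : MDiffAt (T% fun y ↦ -J' y (minusPart g b y (B y))) x :=
    mdifferentiableAt_neg_section (hs'.mdifferentiableAt hS)
  rw [courant_congr (hself A) (hself B), courant_congr (hrepl hAA') (hrepl hBB'),
    courant_congr (hself A) (hrepl hBB'), courant_congr (hrepl hAA') (hself B), hL]
  constructor
  · refine map_add_eq_neg_map_sub (inner_skew hJ ho x) fun z ↦ ?_
    have h := bracketForm_closed (g := g) (h := extDeriv₂ b x) (J := J x) (J' := J' x)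
      (hJ x) (hJ' x)
      (inner_skew hJ ho x) (inner_skew hJ' ho' x) hhom (ht x)
      (plusPart g b x (A x)) (minusPart g b x (A x)) (plusPart g b x (B x)) (minusPart g b x (B x))
      (torsionConnection g b hb hsk 1 (fun y ↦ plusPart g b y (A y)) x)
      (torsionConnection g b hb hsk (-1) (fun y ↦ minusPart g b y (A y)) x)
      (torsionConnection g b hb hsk 1 (fun y ↦ plusPart g b y (B y)) x)
      (torsionConnection g b hb hsk (-1) (fun y ↦ minusPart g b y (B y)) x) z
    rw [← Connection.neg_comp hs hp hP, ← Connection.neg_comp hs hp hR,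
      ← Connection.neg_comp hs' hp' hQ, ← Connection.neg_comp hs' hp' hS] at h
    rw [inner_plusPart_courant hb hsk hP hQ hR' hS',
      inner_plusPart_courant hb hsk hP' hQ' hR hS, inner_plusPart_courant hb hsk hP hQ hR hS,
      inner_plusPart_courant hb hsk hP' hQ' hR' hS']
    exact h
  · refine map_add_eq_neg_map_sub (inner_skew hJ' ho' x) fun z ↦ ?_
    have h := bracketForm_closed (g := g) (h := fun u v w ↦ -extDeriv₂ b x u v w) (J := J' x)
      (J' := J x) (hJ' x) (hJ x) (inner_skew hJ' ho' x) (inner_skew hJ ho x)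
      hhom.neg (ht' x).neg
      (minusPart g b x (A x)) (plusPart g b x (A x)) (minusPart g b x (B x)) (plusPart g b x (B x))
      (torsionConnection g b hb hsk (-1) (fun y ↦ minusPart g b y (A y)) x)
      (torsionConnection g b hb hsk 1 (fun y ↦ plusPart g b y (A y)) x)
      (torsionConnection g b hb hsk (-1) (fun y ↦ minusPart g b y (B y)) x)
      (torsionConnection g b hb hsk 1 (fun y ↦ plusPart g b y (B y)) x) z
    rw [← Connection.neg_comp hs hp hP, ← Connection.neg_comp hs hp hR,
      ← Connection.neg_comp hs' hp' hQ, ← Connection.neg_comp hs' hp' hS] at h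
    rw [inner_minusPart_courant hb hsk hP hQ hR' hS',
      inner_minusPart_courant hb hsk hP' hQ' hR hS, inner_minusPart_courant hb hsk hP hQ hR hS,
      inner_minusPart_courant hb hsk hP' hQ' hR' hS']
    exact h

/-! ### Consequences of involutivity -/

/-- If the complex bilinear extension of `g(∇P, R) - g(P, ∇R)` has vanishing imaginary part on the
sections `P - iJP` and `R - iJR` of the `+i`-eigenbundle of `J`, then `J` is parallel: this imaginary
part is `-2g((∇J)P, R)`. -/
theorem isParallel_of_cross {nabla : Connection E M} (hn : IsMetricConnection g nabla)
    {J : EndField E M} (hs : SmoothEndField J) (hJ : ∀ x u, J x (J x u) = -u)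
    (ho : ∀ x u v, g.inner x (J x u) (J x v) = g.inner x u v)
    (h : ∀ U : Set M, IsOpen U → ∀ P R : VField E M, SmoothVField P U → SmoothVField R U →
      ∀ x ∈ U, ∀ z : TangentSpace 𝓘(ℝ, E) x,
      g.inner x (-J x (R x)) (nabla P x z) - g.inner x (P x) (nabla (fun y ↦ -J y (R y)) x z)
        + (g.inner x (R x) (nabla (fun y ↦ -J y (P y)) x z) - g.inner x (-J x (P x)) (nabla R x z))
        = 0) : IsParallel J nabla := by
  refine (isParallel_iff nabla hs).2 fun x z u ↦ inner_ext g fun v ↦ ?_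
  have hu := mdifferentiableAt_extend_tangent u
  have hv := mdifferentiableAt_extend_tangent v
  obtain ⟨U, hU, hx, hP, hR⟩ := exists_smoothVField_extend u v
  have h₁ := h U hU _ _ hP hR x hx z
  rw [Connection.map_neg nabla (hs.mdifferentiableAt hv),
    Connection.map_neg nabla (hs.mdifferentiableAt hu), covDeriv_apply nabla hs hu,
    covDeriv_apply nabla hs hv] at h₁
  simp only [FiberBundle.extend_apply_self, map_neg, map_add, neg_apply, inner_skew hJ ho] at h₁
  have h₂ := covDerivEnd_skew hn hs hJ ho x z u v
  rw [g.symm x v (covDerivEnd _ _ _ _ _), g.symm x u (covDerivEnd _ _ _ _ _)] at h₁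
  rw [map_zero, zero_apply]
  linarith

theorem smoothVFieldAt_zero (x : M) :
    SmoothVFieldAt (fun y ↦ (0 : TangentSpace 𝓘(ℝ, E) y)) x :=
  ContMDiff.contMDiffAt (contMDiff_zeroSection ℝ _)

theorem Connection.map_zero (nabla : Connection E M) (x : M) :
    nabla (fun y ↦ (0 : TangentSpace 𝓘(ℝ, E) y)) x = 0 := by
  have h := Connection.map_add nabla (Y := fun y ↦ 0) (Z := fun y ↦ 0)
    (smoothVFieldAt_zero x).mdifferentiableAt (smoothVFieldAt_zero x).mdifferentiableAt
  simpa using h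

section Converse

variable (hb : SmoothBForm b) (hsk : ∀ x u v, b x u v = -b x v u)
  {J : EndField E M} (hs : SmoothEndField J) (hJ : ∀ x u, J x (J x u) = -u)
  (ho : ∀ x u v, g.inner x (J x u) (J x v) = g.inner x u v)
  {L : Π x : M, Submodule ℂ (ℂ ⊗[ℝ] GT E x)} (hinv : CourantInvolutive L)
include hb hinv

/-- The `+i`-eigenbundle of `J` in the graph of `b + g` projects isomorphically onto `T^{1,0}`, and
this projection intertwines the Courant and the Lie bracket. -/
theorem isIntegrableACS_of_plus (hJ : ∀ x u, J x (J x u) = -u)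
    (hL : ∀ x (v w : GT E x), cx v w ∈ L x ↔ minusPart g b x v = 0 ∧ minusPart g b x w = 0 ∧
      plusPart g b x w = -J x (plusPart g b x v)) : IsIntegrableACS J := by
  intro U hU X X' Y Y' hX hX' hY hY' hXX hYY x hx
  have hsm {X : VField E M} (hX : SmoothVField X U) :
      SmoothGSection (joinSection g b X (fun _ ↦ 0)) U :=
    (smoothGSection_iff hU).2 fun y hy ↦
      smooth_joinSection hb ((smoothVField_iff hU).1 hX y hy) (smoothVFieldAt_zero y)
  have hmem {X X' : VField E M} (h : ∀ y ∈ U, cx (X y) (X' y) ∈ T10 J y) (y : M) (hy : y ∈ U) :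
      cx (joinSection g b X (fun _ ↦ 0) y) (joinSection g b X' (fun _ ↦ 0) y) ∈ L y := by
    rw [hL]
    simp only [joinSection, plusPart_joinParts, minusPart_joinParts, (mem_T10 hJ).1 (h y hy),
      and_self]
  obtain ⟨h₁, h₂, h₃⟩ := (hL x _ _).1 (hinv U hU _ _ _ _ (hsm hX) (hsm hX') (hsm hY) (hsm hY')
    (hmem hXX) (hmem hYY) x hx)
  have h₄ (v : GT E x) (hv : minusPart g b x v = 0) : plusPart g b x v = v.1 := by
    rw [← plusPart_add_minusPart (g := g) (b := b) x v, hv, add_zero]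
  rw [h₄ _ h₁, h₄ _ h₂] at h₃
  simp only [Prod.fst_sub, Prod.fst_add, courant_joinSection_fst, add_zero] at h₃
  exact (mem_T10 hJ).2 h₃

/-- The `+i`-eigenbundle of `J` in the graph of `b - g` projects isomorphically onto `T^{1,0}`, and
this projection intertwines the Courant and the Lie bracket. -/
theorem isIntegrableACS_of_minus (hJ : ∀ x u, J x (J x u) = -u)
    (hL : ∀ x (v w : GT E x), cx v w ∈ L x ↔ plusPart g b x v = 0 ∧ plusPart g b x w = 0 ∧
      minusPart g b x w = -J x (minusPart g b x v)) : IsIntegrableACS J := by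
  intro U hU X X' Y Y' hX hX' hY hY' hXX hYY x hx
  have hsm {X : VField E M} (hX : SmoothVField X U) :
      SmoothGSection (joinSection g b (fun _ ↦ 0) X) U :=
    (smoothGSection_iff hU).2 fun y hy ↦
      smooth_joinSection hb (smoothVFieldAt_zero y) ((smoothVField_iff hU).1 hX y hy)
  have hmem {X X' : VField E M} (h : ∀ y ∈ U, cx (X y) (X' y) ∈ T10 J y) (y : M) (hy : y ∈ U) :
      cx (joinSection g b (fun _ ↦ 0) X y) (joinSection g b (fun _ ↦ 0) X' y) ∈ L y := by
    rw [hL]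
    simp only [joinSection, minusPart_joinParts, plusPart_joinParts, (mem_T10 hJ).1 (h y hy),
      and_self]
  obtain ⟨h₁, h₂, h₃⟩ := (hL x _ _).1 (hinv U hU _ _ _ _ (hsm hX) (hsm hX') (hsm hY) (hsm hY')
    (hmem hXX) (hmem hYY) x hx)
  have h₄ (v : GT E x) (hv : plusPart g b x v = 0) : minusPart g b x v = v.1 := by
    rw [← plusPart_add_minusPart (g := g) (b := b) x v, hv, zero_add]
  rw [h₄ _ h₁, h₄ _ h₂] at h₃
  simp only [Prod.fst_sub, Prod.fst_add, courant_joinSection_fst, zero_add] at h₃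
  exact (mem_T10 hJ).2 h₃

include hs hJ ho

/-- For sections with vanishing `-`-part, the `-`-part of the Courant bracket is the
skew-symmetrization of `∇⁺`. -/
theorem isParallel_of_plus
    (hL : ∀ x (v w : GT E x), cx v w ∈ L x ↔ minusPart g b x v = 0 ∧ minusPart g b x w = 0 ∧
      plusPart g b x w = -J x (plusPart g b x v)) :
    IsParallel J (torsionConnection g b hb hsk 1) := by
  refine isParallel_of_cross (torsionConnection_metric g b hb hsk 1) hs hJ ho
    fun U hU P R hP hR x hx z ↦ ?_
  have hsm {X : VField E M} (hX : ∀ y ∈ U, SmoothVFieldAt X y) :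
      SmoothGSection (joinSection g b X (fun _ ↦ 0)) U :=
    (smoothGSection_iff hU).2 fun y hy ↦
      smooth_joinSection hb (hX y hy) (smoothVFieldAt_zero y)
  have hmem (X : VField E M) (y : M) (hy : y ∈ U) :
      cx (joinSection g b X (fun _ ↦ 0) y) (joinSection g b (fun y ↦ -J y (X y)) (fun _ ↦ 0) y)
        ∈ L y := by
    rw [hL]
    simp only [joinSection, plusPart_joinParts, minusPart_joinParts, and_self]
  have hP₁ := (smoothVField_iff hU).1 hP
  have hR₁ := (smoothVField_iff hU).1 hR
  have hP₂ := fun y hy ↦ (hs.apply (hP₁ y hy)).neg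
  have hR₂ := fun y hy ↦ (hs.apply (hR₁ y hy)).neg
  obtain ⟨-, h, -⟩ := (hL x _ _).1 (hinv U hU _ _ _ _ (hsm hP₁) (hsm hP₂) (hsm hR₁) (hsm hR₂)
    (hmem P) (hmem R) x hx)
  have h₀ := (smoothVFieldAt_zero (E := E) x).mdifferentiableAt
  have hi := congrArg (fun v ↦ g.inner x v z) h
  simp only [(minusPart g b x).map_add, (g.inner x).map_add, add_apply] at hi
  rw [inner_minusPart_courant hb hsk (hP₁ x hx).mdifferentiableAt h₀
      (hR₂ x hx).mdifferentiableAt h₀,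
    inner_minusPart_courant hb hsk (hP₂ x hx).mdifferentiableAt h₀
      (hR₁ x hx).mdifferentiableAt h₀] at hi
  have hhom := (extDeriv₂_homogeneous hb hsk x).smul₁ 0 0 0 z
  rw [zero_smul, zero_mul] at hhom
  simp only [bracketForm, Connection.map_zero, zero_apply, map_zero, hhom, sub_zero] at hi
  linarith

/-- For sections with vanishing `+`-part, the `+`-part of the Courant bracket is the
skew-symmetrization of `∇⁻`. -/
theorem isParallel_of_minus
    (hL : ∀ x (v w : GT E x), cx v w ∈ L x ↔ plusPart g b x v = 0 ∧ plusPart g b x w = 0 ∧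
      minusPart g b x w = -J x (minusPart g b x v)) :
    IsParallel J (torsionConnection g b hb hsk (-1)) := by
  refine isParallel_of_cross (torsionConnection_metric g b hb hsk (-1)) hs hJ ho
    fun U hU P R hP hR x hx z ↦ ?_
  have hsm {X : VField E M} (hX : ∀ y ∈ U, SmoothVFieldAt X y) :
      SmoothGSection (joinSection g b (fun _ ↦ 0) X) U :=
    (smoothGSection_iff hU).2 fun y hy ↦
      smooth_joinSection hb (smoothVFieldAt_zero y) (hX y hy)
  have hmem (X : VField E M) (y : M) (hy : y ∈ U) :
      cx (joinSection g b (fun _ ↦ 0) X y) (joinSection g b (fun _ ↦ 0) (fun y ↦ -J y (X y)) y)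
        ∈ L y := by
    rw [hL]
    simp only [joinSection, minusPart_joinParts, plusPart_joinParts, and_self]
  have hP₁ := (smoothVField_iff hU).1 hP
  have hR₁ := (smoothVField_iff hU).1 hR
  have hP₂ := fun y hy ↦ (hs.apply (hP₁ y hy)).neg
  have hR₂ := fun y hy ↦ (hs.apply (hR₁ y hy)).neg
  obtain ⟨-, h, -⟩ := (hL x _ _).1 (hinv U hU _ _ _ _ (hsm hP₁) (hsm hP₂) (hsm hR₁) (hsm hR₂)
    (hmem P) (hmem R) x hx)
  have h₀ := (smoothVFieldAt_zero (E := E) x).mdifferentiableAt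
  have hi := congrArg (fun v ↦ g.inner x v z) h
  simp only [(plusPart g b x).map_add, (g.inner x).map_add, add_apply] at hi
  rw [inner_plusPart_courant hb hsk h₀ (hP₁ x hx).mdifferentiableAt h₀
      (hR₂ x hx).mdifferentiableAt,
    inner_plusPart_courant hb hsk h₀ (hP₂ x hx).mdifferentiableAt h₀
      (hR₁ x hx).mdifferentiableAt] at hi
  have hhom := (extDeriv₂_homogeneous hb hsk x).smul₁ 0 0 0 z
  rw [zero_smul, zero_mul] at hhom
  simp only [bracketForm, Connection.map_zero, zero_apply, map_zero, hhom, sub_zero] at hi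
  linarith

end Converse

end Involutivity

section Correspondence

/-! ### The almost generalized Kähler structure of bi-Hermitian data -/

variable {E : Type*} [NormedAddCommGroup E] [NormedSpace ℝ E] [FiniteDimensional ℝ E]
  {M : Type*} [TopologicalSpace M] [ChartedSpace E M] [IsManifold 𝓘(ℝ, E) ∞ M]

section Block

variable (g : Metric E M) (b : BForm E M)

/-- The endomorphism of `T ⊕ T*` that acts by `J` on the graph of `b + g` and by `J'` on the graph
of `b - g`, both identified with `T`. -/
def blockEnd (J J' : EndField E M) : GEndField E M := fun x ↦
  (J x ∘L plusPart g b x + J' x ∘L minusPart g b x).prod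
    (b x ∘L (J x ∘L plusPart g b x + J' x ∘L minusPart g b x)
      + g.inner x ∘L (J x ∘L plusPart g b x - J' x ∘L minusPart g b x))

variable {g b} {J J' : EndField E M}

theorem joinParts_zero_right (x : M) (u : TangentSpace 𝓘(ℝ, E) x) :
    joinParts g b x u 0 = (u, b x u + g.inner x u) := by
  rw [joinParts, add_zero, sub_zero]

theorem joinParts_zero_left (x : M) (u : TangentSpace 𝓘(ℝ, E) x) :
    joinParts g b x 0 u = (u, b x u - g.inner x u) := by
  rw [joinParts, zero_add, zero_sub, (g.inner x).map_neg, sub_eq_add_neg]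

theorem blockEnd_apply (x : M) (v : GT E x) : blockEnd g b J J' x v
    = joinParts g b x (J x (plusPart g b x v)) (J' x (minusPart g b x v)) := rfl

theorem plusPart_blockEnd (x : M) (v : GT E x) :
    plusPart g b x (blockEnd g b J J' x v) = J x (plusPart g b x v) := by
  rw [blockEnd_apply, plusPart_joinParts]

theorem minusPart_blockEnd (x : M) (v : GT E x) :
    minusPart g b x (blockEnd g b J J' x v) = J' x (minusPart g b x v) := by
  rw [blockEnd_apply, minusPart_joinParts]

theorem smooth_blockEnd (hb : SmoothBForm b) (hs : SmoothEndField J) (hs' : SmoothEndField J') :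
    SmoothGEndField (blockEnd g b J J') := by
  intro x
  refine contMDiffAt_hom_of_apply (F₁ := E × (E →L[ℝ] ℝ)) (F₂ := E × (E →L[ℝ] ℝ))
    (E₁ := fun x : M ↦ GT E x) (E₂ := fun x : M ↦ GT E x) fun s h ↦ ?_
  exact smooth_joinSection hb (hs.apply (smooth_plusPart hb h)) (hs'.apply (smooth_minusPart hb h))

theorem blockEnd_sq (hJ : ∀ x u, J x (J x u) = -u) (hJ' : ∀ x u, J' x (J' x u) = -u) (x : M)
    (v : GT E x) : blockEnd g b J J' x (blockEnd g b J J' x v) = -v := by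
  refine ext_parts (g := g) (b := b) ?_ ?_
  · rw [plusPart_blockEnd, plusPart_blockEnd, hJ, (plusPart g b x).map_neg]
  · rw [minusPart_blockEnd, minusPart_blockEnd, hJ', (minusPart g b x).map_neg]

theorem blockEnd_orth (hsk : ∀ x u v, b x u v = -b x v u)
    (ho : ∀ x u v, g.inner x (J x u) (J x v) = g.inner x u v)
    (ho' : ∀ x u v, g.inner x (J' x u) (J' x v) = g.inner x u v) (x : M) (v w : GT E x) :
    pairing (blockEnd g b J J' x v) (blockEnd g b J J' x w) = pairing v w := by
  rw [pairing_eq_inner (g := g) hsk, pairing_eq_inner (g := g) hsk]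
  simp only [plusPart_blockEnd, minusPart_blockEnd, ho, ho']

end Block

/-- The almost generalized Kähler structure associated with bi-Hermitian data. -/
def AlmostBiHermitian.toGenKahler (D : AlmostBiHermitian E M) : AlmostGenKahler E M where
  J₁ := blockEnd D.g D.b D.Jp D.Jm
  J₂ := blockEnd D.g D.b D.Jp (fun x ↦ -D.Jm x)
  smooth₁ := smooth_blockEnd D.smooth_b D.smooth_Jp D.smooth_Jm
  smooth₂ := smooth_blockEnd D.smooth_b D.smooth_Jp D.smooth_Jm.neg_section
  sq₁ := blockEnd_sq D.sq_Jp D.sq_Jm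
  sq₂ := blockEnd_sq D.sq_Jp (fun x u ↦ by simp [D.sq_Jm])
  orth₁ := blockEnd_orth D.skew_b D.orth_Jp D.orth_Jm
  orth₂ := blockEnd_orth D.skew_b D.orth_Jp (fun x u v ↦ by simp [D.orth_Jm])
  comm x v := by
    refine ext_parts (g := D.g) (b := D.b) ?_ ?_
    · simp only [plusPart_blockEnd]
    · simp only [minusPart_blockEnd, neg_apply, map_neg]
  pos x v hv := by
    have hp : plusPart D.g D.b x (-blockEnd D.g D.b D.Jp D.Jm x
        (blockEnd D.g D.b D.Jp (fun x ↦ -D.Jm x) x v)) = plusPart D.g D.b x v := by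
      rw [(plusPart D.g D.b x).map_neg, plusPart_blockEnd, plusPart_blockEnd, D.sq_Jp, neg_neg]
    have hm : minusPart D.g D.b x (-blockEnd D.g D.b D.Jp D.Jm x
        (blockEnd D.g D.b D.Jp (fun x ↦ -D.Jm x) x v)) = -minusPart D.g D.b x v := by
      rw [(minusPart D.g D.b x).map_neg, minusPart_blockEnd, minusPart_blockEnd, neg_apply,
        (D.Jm x).map_neg, D.sq_Jm, neg_neg]
    rw [pairing_eq_inner (g := D.g) D.skew_b, hp, hm]
    have hneg (u v : TangentSpace 𝓘(ℝ, E) x) : D.g.inner x (-u) v = -D.g.inner x u v := by simp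
    have hnn (u : TangentSpace 𝓘(ℝ, E) x) : 0 ≤ D.g.inner x u u := by
      rcases eq_or_ne u 0 with rfl | hu
      · simp
      · exact (D.g.pos x u hu).le
    rw [hneg, sub_neg_eq_add]
    by_cases h : plusPart D.g D.b x v = 0
    · have h' : minusPart D.g D.b x v ≠ 0 := fun h' ↦ hv <|
        ext_parts (g := D.g) (b := D.b) (h.trans (map_zero _).symm) (h'.trans (map_zero _).symm)
      exact add_pos_of_nonneg_of_pos (hnn _) (D.g.pos x _ h')
    · exact add_pos_of_pos_of_nonneg (D.g.pos x _ h) (hnn _)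

namespace AlmostGenKahler

variable {K : AlmostGenKahler E M} {D : AlmostBiHermitian E M}

theorem IsAssociated.G_eq_iff (h : K.IsAssociated D) (x : M) (v : GT E x) :
    K.G x v = v ↔ minusPart D.g D.b x v = 0 :=
  (h.graph_p x v).trans (minusPart_eq_zero_iff x v).symm

theorem IsAssociated.G_eq_neg_iff (h : K.IsAssociated D) (x : M) (v : GT E x) :
    K.G x v = -v ↔ plusPart D.g D.b x v = 0 :=
  (h.graph_m x v).trans (plusPart_eq_zero_iff x v).symm

theorem G_add (x : M) (v w : GT E x) : K.G x (v + w) = K.G x v + K.G x w := by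
  rw [G, (K.J₂ x).map_add, (K.J₁ x).map_add, neg_add]
  rfl

theorem G_neg (x : M) (v : GT E x) : K.G x (-v) = -K.G x v := by
  rw [G, (K.J₂ x).map_neg, (K.J₁ x).map_neg]
  rfl

theorem G_J₁ (x : M) (v : GT E x) : K.G x (K.J₁ x v) = K.J₁ x (K.G x v) := by
  rw [G, G, ← K.comm, (K.J₁ x).map_neg]

theorem J₂_eq_J₁_G (x : M) (v : GT E x) : K.J₂ x v = K.J₁ x (K.G x v) := by
  rw [G, (K.J₁ x).map_neg, K.sq₁, neg_neg]

theorem G_G (x : M) (v : GT E x) : K.G x (K.G x v) = v := by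
  have h : K.J₂ x (K.G x v) = K.J₁ x v := by
    rw [G, (K.J₂ x).map_neg, ← K.comm, K.sq₂, (K.J₁ x).map_neg, neg_neg]
  conv_lhs => rw [G, h, K.sq₁, neg_neg]

theorem pairing_G (x : M) (v w : GT E x) : pairing (K.G x v) w = pairing v (K.G x w) := by
  have h (v w : GT E x) : pairing (K.G x v) (K.G x w) = pairing v w := by
    have hn (v w : GT E x) : pairing (-v) (-w) = pairing v w := by simp [pairing]
    rw [G, G, hn, K.orth₁, K.orth₂]
  rw [← h, G_G]

/-- `𝒥₁` commutes with `G`, hence preserves its eigenspaces, where it is given by `J±`. -/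
theorem IsAssociated.J₁_eq (h : K.IsAssociated D) : K.J₁ = blockEnd D.g D.b D.Jp D.Jm := by
  funext x
  have hp (p : TangentSpace 𝓘(ℝ, E) x) :
      K.J₁ x (joinParts D.g D.b x p 0) = joinParts D.g D.b x (D.Jp x p) 0 := by
    have h₁ : minusPart D.g D.b x (K.J₁ x (joinParts D.g D.b x p 0)) = 0 := by
      rw [← h.G_eq_iff, G_J₁, (h.G_eq_iff x _).2 (minusPart_joinParts x p 0)]
    refine ext_parts (g := D.g) (b := D.b) ?_ ?_
    · have h₂ := plusPart_add_minusPart (g := D.g) (b := D.b) x (K.J₁ x (joinParts D.g D.b x p 0))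
      rw [h₁, add_zero] at h₂
      rw [plusPart_joinParts, h₂, joinParts_zero_right, h.transport_p]
    · rw [h₁, minusPart_joinParts]
  have hm (q : TangentSpace 𝓘(ℝ, E) x) :
      K.J₁ x (joinParts D.g D.b x 0 q) = joinParts D.g D.b x 0 (D.Jm x q) := by
    have h₁ : plusPart D.g D.b x (K.J₁ x (joinParts D.g D.b x 0 q)) = 0 := by
      rw [← h.G_eq_neg_iff, G_J₁, (h.G_eq_neg_iff x _).2 (plusPart_joinParts x 0 q),
        (K.J₁ x).map_neg]
    refine ext_parts (g := D.g) (b := D.b) ?_ ?_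
    · rw [h₁, plusPart_joinParts]
    · have h₂ := plusPart_add_minusPart (g := D.g) (b := D.b) x (K.J₁ x (joinParts D.g D.b x 0 q))
      rw [h₁, zero_add] at h₂
      rw [minusPart_joinParts, h₂, joinParts_zero_left, h.transport_m]
  have hadd (p q : TangentSpace 𝓘(ℝ, E) x) : joinParts D.g D.b x p q
      = joinParts D.g D.b x p 0 + joinParts D.g D.b x 0 q := by
    refine ext_parts (g := D.g) (b := D.b) ?_ ?_
    · simp only [(plusPart D.g D.b x).map_add, plusPart_joinParts, add_zero]
    · simp only [(minusPart D.g D.b x).map_add, minusPart_joinParts, zero_add]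
  refine ContinuousLinearMap.ext fun v ↦ ?_
  rw [blockEnd_apply, ← joinParts_parts (g := D.g) (b := D.b) x v, plusPart_joinParts,
    minusPart_joinParts, hadd, (K.J₁ x).map_add, hp, hm, ← hadd]

/-- As `𝒥₂ = 𝒥₁ G`, it agrees with `𝒥₁` on `C₊` and with `-𝒥₁` on `C₋`. -/
theorem IsAssociated.J₂_eq (h : K.IsAssociated D) :
    K.J₂ = blockEnd D.g D.b D.Jp (fun x ↦ -D.Jm x) := by
  funext x
  refine ContinuousLinearMap.ext fun v ↦ ?_
  have hG : K.G x v = joinParts D.g D.b x (plusPart D.g D.b x v) (-minusPart D.g D.b x v) := by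
    have hp := (h.G_eq_iff x (v + K.G x v)).1 (by rw [G_add, G_G, add_comm])
    have hm := (h.G_eq_neg_iff x (v - K.G x v)).1 (by
      rw [sub_eq_add_neg, G_add, G_neg, G_G, neg_add, neg_neg, add_comm])
    rw [(minusPart D.g D.b x).map_add, add_comm, ← eq_neg_iff_add_eq_zero] at hp
    rw [(plusPart D.g D.b x).map_sub, sub_eq_zero] at hm
    rw [hm, ← hp, joinParts_parts]
  rw [J₂_eq_J₁_G, hG, h.J₁_eq, blockEnd_apply, blockEnd_apply, plusPart_joinParts,
    minusPart_joinParts, (D.Jm x).map_neg]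
  rfl

end AlmostGenKahler

theorem AlmostBiHermitian.isAssociated_toGenKahler (D : AlmostBiHermitian E M) :
    D.toGenKahler.IsAssociated D := by
  have hp (x : M) (v : GT E x) :
      plusPart D.g D.b x (D.toGenKahler.G x v) = plusPart D.g D.b x v := by
    rw [AlmostGenKahler.G, (plusPart D.g D.b x).map_neg]
    simp only [toGenKahler, plusPart_blockEnd, D.sq_Jp, neg_neg]
  have hm (x : M) (v : GT E x) :
      minusPart D.g D.b x (D.toGenKahler.G x v) = -minusPart D.g D.b x v := by
    rw [AlmostGenKahler.G, (minusPart D.g D.b x).map_neg]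
    simp only [toGenKahler, minusPart_blockEnd, neg_apply, map_neg, D.sq_Jm, neg_neg]
  have hneg {x : M} (u : TangentSpace 𝓘(ℝ, E) x) (h : u = -u) : u = 0 := by
    rw [eq_neg_iff_add_eq_zero, ← two_smul ℝ] at h
    exact (smul_eq_zero_iff_right two_ne_zero).1 h
  refine ⟨fun x v ↦ ?_, fun x v ↦ ?_, fun x u ↦ ?_, fun x u ↦ ?_⟩
  · rw [← minusPart_eq_zero_iff]
    constructor
    · intro h
      have := hm x v
      rw [h] at this
      exact hneg _ this
    · intro h
      exact ext_parts (hp x v) (by rw [hm, h, neg_zero])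
  · rw [← plusPart_eq_zero_iff]
    constructor
    · intro h
      have := hp x v
      rw [h, (plusPart D.g D.b x).map_neg] at this
      exact hneg _ this.symm
    · intro h
      exact ext_parts (by rw [hp, (plusPart D.g D.b x).map_neg, h, neg_zero])
        (by rw [hm, (minusPart D.g D.b x).map_neg])
  · rw [← joinParts_zero_right, toGenKahler, blockEnd_apply, plusPart_joinParts,
      minusPart_joinParts, map_zero, joinParts_zero_right]
  · rw [← joinParts_zero_left, toGenKahler, blockEnd_apply, plusPart_joinParts,
      minusPart_joinParts, map_zero, joinParts_zero_left]

theorem AlmostBiHermitian.existsUnique_genKahler (D : AlmostBiHermitian E M) :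
    ∃! K : AlmostGenKahler E M, K.IsAssociated D := by
  refine ⟨D.toGenKahler, D.isAssociated_toGenKahler, fun K hK ↦ ?_⟩
  have h₁ := hK.J₁_eq
  have h₂ := hK.J₂_eq
  obtain ⟨J₁, J₂⟩ := K
  subst h₁ h₂
  rfl

end Correspondence

section Extraction

/-! ### The bi-Hermitian data of an almost generalized Kähler structure -/

variable {E : Type*} [NormedAddCommGroup E] [NormedSpace ℝ E] [FiniteDimensional ℝ E]
  {M : Type*} [TopologicalSpace M] [ChartedSpace E M] [IsManifold 𝓘(ℝ, E) ∞ M]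

/-- The unit ball of a positive definite bilinear form on a finite-dimensional space is bounded: the
form has a positive minimum on the unit sphere. -/
theorem isVonNBounded_of_pos (B : E →L[ℝ] E →L[ℝ] ℝ) (hB : ∀ v, v ≠ 0 → 0 < B v v) :
    Bornology.IsVonNBounded ℝ {v : E | B v v < 1} := by
  rw [NormedSpace.isVonNBounded_iff]
  rcases subsingleton_or_nontrivial E with hE | hE
  · exact (Set.toFinite _).isBounded
  have : ProperSpace E := FiniteDimensional.proper_real E
  obtain ⟨v₀, hv₀, hmin⟩ := (isCompact_sphere (0 : E) 1).exists_isMinOn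
    (NormedSpace.sphere_nonempty.2 zero_le_one)
    (f := fun v ↦ B v v) (B.continuous.clm_apply continuous_id).continuousOn
  have hm : 0 < B v₀ v₀ := hB v₀ (ne_zero_of_mem_unit_sphere ⟨v₀, hv₀⟩)
  refine isBounded_iff_forall_norm_le.2 ⟨Real.sqrt (1 / B v₀ v₀), fun v hv ↦ ?_⟩
  refine Real.le_sqrt_of_sq_le ?_
  rw [le_div_iff₀ hm]
  rcases eq_or_ne v 0 with rfl | hv0
  · simp
  have hn : ‖v‖ ≠ 0 := norm_ne_zero_iff.2 hv0
  have h : B v₀ v₀ ≤ B (‖v‖⁻¹ • v) (‖v‖⁻¹ • v) :=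
    hmin (by simp [norm_smul, hn])
  have hv' : B v v < 1 := hv
  simp only [map_smul, smul_apply, smul_eq_mul] at h
  calc ‖v‖ ^ 2 * B v₀ v₀ ≤ ‖v‖ ^ 2 * (‖v‖⁻¹ * (‖v‖⁻¹ * B v v)) := by gcongr
    _ = B v v := by field_simp
    _ ≤ 1 := hv'.le

namespace AlmostGenKahler

variable (K : AlmostGenKahler E M)

/-- `G` as a field of endomorphisms. -/
def GEnd : GEndField E M := fun x ↦ -(K.J₁ x ∘L K.J₂ x)

/-- The map `ξ ↦ G(ξ)_T` from `T*` to `T`, which is the inverse of the metric. -/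
def cometric (x : M) : (TangentSpace 𝓘(ℝ, E) x →L[ℝ] ℝ) →L[ℝ] TangentSpace 𝓘(ℝ, E) x :=
  ContinuousLinearMap.fst ℝ _ _ ∘L K.GEnd x ∘L ContinuousLinearMap.inr ℝ _ _

/-- The map `u ↦ G(u)_T` from `T` to `T`, which is `-g⁻¹b`. -/
def tangentG (x : M) : TangentSpace 𝓘(ℝ, E) x →L[ℝ] TangentSpace 𝓘(ℝ, E) x :=
  ContinuousLinearMap.fst ℝ _ _ ∘L K.GEnd x ∘L ContinuousLinearMap.inl ℝ _ _

theorem cometric_apply (x : M) (ξ : TangentSpace 𝓘(ℝ, E) x →L[ℝ] ℝ) :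
    K.cometric x ξ = (K.G x (0, ξ)).1 := rfl

theorem tangentG_apply (x : M) (u : TangentSpace 𝓘(ℝ, E) x) :
    K.tangentG x u = (K.G x (u, 0)).1 := rfl

/-- The block decomposition of the tangent component of `G`. -/
theorem G_fst (x : M) (v : GT E x) : (K.G x v).1 = K.tangentG x v.1 + K.cometric x v.2 := by
  have hv : v = (v.1, 0) + (0, v.2) := by simp
  rw [tangentG_apply, cometric_apply, ← Prod.fst_add, ← G_add, ← hv]

theorem cometric_symm (x : M) (ξ η : TangentSpace 𝓘(ℝ, E) x →L[ℝ] ℝ) :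
    η (K.cometric x ξ) = ξ (K.cometric x η) := by
  have h := K.pairing_G x (0, ξ) (0, η)
  simp only [pairing, ← cometric_apply, map_zero] at h
  linarith

theorem cometric_pos (x : M) (ξ : TangentSpace 𝓘(ℝ, E) x →L[ℝ] ℝ) (hξ : ξ ≠ 0) :
    0 < ξ (K.cometric x ξ) := by
  have h : 0 < pairing (K.G x (0, ξ)) (0, ξ) := K.pos x (0, ξ) (by simpa using hξ)
  simp only [pairing, ← cometric_apply, map_zero] at h
  linarith

/-- The inverse of the cometric. -/
def flat (x : M) : TangentSpace 𝓘(ℝ, E) x →L[ℝ] TangentSpace 𝓘(ℝ, E) x →L[ℝ] ℝ :=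
  (K.cometric x).inverse

theorem exists_equiv_cometric (x : M) :
    ∃ e : (TangentSpace 𝓘(ℝ, E) x →L[ℝ] ℝ) ≃L[ℝ] TangentSpace 𝓘(ℝ, E) x, K.cometric x = e := by
  have hinj : Function.Injective (K.cometric x).toLinearMap := by
    rw [injective_iff_map_eq_zero]
    intro ξ hξ
    by_contra h
    have h' := K.cometric_pos x ξ h
    have hξ' : K.cometric x ξ = 0 := hξ
    simp [hξ'] at h'
  exact ⟨(LinearEquiv.ofInjectiveOfFinrankEq (K.cometric x).toLinearMap hinj
    (finrank_cotangentSpace x)).toContinuousLinearEquiv, by ext1 v; rfl⟩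

theorem flat_cometric (x : M) (ξ : TangentSpace 𝓘(ℝ, E) x →L[ℝ] ℝ) :
    K.flat x (K.cometric x ξ) = ξ := by
  obtain ⟨e, he⟩ := K.exists_equiv_cometric x
  rw [flat, he, ContinuousLinearMap.inverse_equiv]
  exact e.symm_apply_apply ξ

theorem cometric_flat (x : M) (u : TangentSpace 𝓘(ℝ, E) x) : K.cometric x (K.flat x u) = u := by
  obtain ⟨e, he⟩ := K.exists_equiv_cometric x
  rw [flat, he, ContinuousLinearMap.inverse_equiv]
  exact e.apply_symm_apply u

theorem flat_pos (x : M) (u : TangentSpace 𝓘(ℝ, E) x) (hu : u ≠ 0) : 0 < K.flat x u u := by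
  have h := K.cometric_pos x (K.flat x u) fun h ↦ hu (by rw [← K.cometric_flat x u, h, map_zero])
  rwa [cometric_flat] at h

theorem smooth_J₁_apply {A : GSection E M} {x : M} (hA : SmoothGSectionAt A x) :
    SmoothGSectionAt (fun y ↦ K.J₁ y (A y)) x :=
  ContMDiffAt.clm_bundle_apply (F₁ := E × (E →L[ℝ] ℝ)) (F₂ := E × (E →L[ℝ] ℝ))
    (E₁ := fun x : M ↦ GT E x) (E₂ := fun x : M ↦ GT E x) (ContMDiff.contMDiffAt K.smooth₁) hA

theorem smooth_J₂_apply {A : GSection E M} {x : M} (hA : SmoothGSectionAt A x) :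
    SmoothGSectionAt (fun y ↦ K.J₂ y (A y)) x :=
  ContMDiffAt.clm_bundle_apply (F₁ := E × (E →L[ℝ] ℝ)) (F₂ := E × (E →L[ℝ] ℝ))
    (E₁ := fun x : M ↦ GT E x) (E₂ := fun x : M ↦ GT E x) (ContMDiff.contMDiffAt K.smooth₂) hA

theorem smooth_G_fst {A : GSection E M} {x : M} (hA : SmoothGSectionAt A x) :
    SmoothVFieldAt (fun y ↦ (K.G y (A y)).1) x :=
  (smoothGSectionAt_iff.1 (K.smooth_J₁_apply (K.smooth_J₂_apply hA))).1.neg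

theorem smoothOneFormAt_zero (x : M) : SmoothOneFormAt (E := E) (M := M) (fun _ ↦ 0) x :=
  ContMDiff.contMDiffAt (contMDiff_zeroSection ℝ _)

theorem smooth_flat : SmoothBForm K.flat := fun x ↦
  contMDiffAt_hom_inverse (F₁ := E →L[ℝ] ℝ) (F₂ := E)
    (E₁ := fun x : M ↦ TangentSpace 𝓘(ℝ, E) x →L[ℝ] ℝ)
    (E₂ := fun x : M ↦ TangentSpace 𝓘(ℝ, E) x) (φ := K.cometric) (ψ := K.flat)
    K.flat_cometric K.cometric_flat
    (contMDiffAt_hom_of_apply (F₁ := E →L[ℝ] ℝ) (F₂ := E)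
      (E₁ := fun x : M ↦ TangentSpace 𝓘(ℝ, E) x →L[ℝ] ℝ)
      (E₂ := fun x : M ↦ TangentSpace 𝓘(ℝ, E) x) fun _ h ↦
        K.smooth_G_fst (smoothGSectionAt_iff.2 ⟨smoothVFieldAt_zero x, h⟩))

/-- The Riemannian metric associated with `(𝒥₁, 𝒥₂)`. -/
def metric : Metric E M where
  inner := K.flat
  symm x u v := by
    have h := K.cometric_symm x (K.flat x u) (K.flat x v)
    rw [cometric_flat, cometric_flat] at h
    exact h.symm
  pos := K.flat_pos
  isVonNBounded x := isVonNBounded_of_pos (E := E) (K.flat x) (K.flat_pos x)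
  contMDiff := K.smooth_flat

/-- The 2-form associated with `(𝒥₁, 𝒥₂)`. -/
def bField : BForm E M := fun x ↦ -(K.flat x ∘L K.tangentG x)

theorem bField_apply (x : M) (u : TangentSpace 𝓘(ℝ, E) x) :
    K.bField x u = -K.flat x (K.tangentG x u) := rfl

theorem smooth_bField : SmoothBForm K.bField := fun x ↦
  contMDiffAt_hom_of_apply (F₁ := E) (F₂ := E →L[ℝ] ℝ)
    (E₁ := fun x : M ↦ TangentSpace 𝓘(ℝ, E) x)
    (E₂ := fun x : M ↦ TangentSpace 𝓘(ℝ, E) x →L[ℝ] ℝ) fun _ h ↦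
      ContMDiffAt.neg_section (K.smooth_flat.apply
        (K.smooth_G_fst (smoothGSectionAt_iff.2 ⟨h, smoothOneFormAt_zero x⟩)))

theorem eq_zero_of_pairing_G {x : M} {v : GT E x} (h : pairing (K.G x v) v = 0) : v = 0 := by
  by_contra hv
  exact (K.pos x v hv).ne' h

/-- An element of `T ⊕ T*` is fixed by `G` as soon as its tangent component is. -/
theorem G_eq_iff_fst (x : M) (v : GT E x) : K.G x v = v ↔ (K.G x v).1 = v.1 := by
  refine ⟨congrArg Prod.fst, fun h ↦ ?_⟩
  have h₁ : (K.G x v - v).1 = 0 := by rw [Prod.fst_sub, h, sub_self]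
  have h₂ : K.G x (K.G x v - v) = -(K.G x v - v) := by
    rw [sub_eq_add_neg, G_add, G_neg, G_G]; abel
  refine sub_eq_zero.1 (K.eq_zero_of_pairing_G (x := x) ?_)
  simp only [h₂, pairing, Prod.fst_neg, h₁, neg_zero, map_zero, add_zero, mul_zero]

/-- The analogue of `G_eq_iff_fst` for the eigenvalue `-1`. -/
theorem G_eq_neg_iff_fst (x : M) (v : GT E x) : K.G x v = -v ↔ (K.G x v).1 = -v.1 := by
  refine ⟨congrArg Prod.fst, fun h ↦ ?_⟩
  have h₁ : (K.G x v + v).1 = 0 := by rw [Prod.fst_add, h, neg_add_cancel]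
  have h₂ : K.G x (K.G x v + v) = K.G x v + v := by
    rw [G_add, G_G, add_comm]
  refine eq_neg_of_add_eq_zero_left (K.eq_zero_of_pairing_G (x := x) ?_)
  simp only [h₂, pairing, h₁, map_zero, add_zero, mul_zero]

theorem flat_G_fst (x : M) (v : GT E x) : K.flat x (K.G x v).1 = v.2 - K.bField x v.1 := by
  rw [G_fst, map_add, flat_cometric, bField_apply, sub_neg_eq_add, add_comm]

theorem flat_injective (x : M) : Function.Injective (K.flat x) :=
  Function.LeftInverse.injective (K.cometric_flat x)

/-- The `+1`-eigenspace of `G` is the graph of `b + g`. -/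
theorem G_eq_iff_graph (x : M) (v : GT E x) :
    K.G x v = v ↔ v.2 = K.bField x v.1 + K.flat x v.1 := by
  rw [G_eq_iff_fst, ← (K.flat_injective x).eq_iff, flat_G_fst, sub_eq_iff_eq_add']

/-- The `-1`-eigenspace of `G` is the graph of `b - g`. -/
theorem G_eq_neg_iff_graph (x : M) (v : GT E x) :
    K.G x v = -v ↔ v.2 = K.bField x v.1 - K.flat x v.1 := by
  rw [G_eq_neg_iff_fst, ← (K.flat_injective x).eq_iff, flat_G_fst, (K.flat x).map_neg,
    sub_eq_iff_eq_add', sub_eq_add_neg]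

/-- The two eigenspaces of `G` are orthogonal. -/
theorem bField_skew (x : M) (u v : TangentSpace 𝓘(ℝ, E) x) :
    K.bField x u v = -K.bField x v u := by
  have h := K.pairing_G x (u, K.bField x u + K.flat x u) (v, K.bField x v - K.flat x v)
  rw [(K.G_eq_iff_graph x _).2 rfl, (K.G_eq_neg_iff_graph x _).2 rfl] at h
  have hs : K.flat x u v = K.flat x v u := K.metric.symm x u v
  simp only [pairing, Prod.fst_neg, Prod.snd_neg, add_apply, sub_apply, neg_apply, map_neg] at h
  linarith

/-- The endomorphism of `T` obtained from `𝒥₁` on the graph of `b + cg`. -/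
def transport (c : ℝ) : EndField E M := fun x ↦
  ContinuousLinearMap.fst ℝ _ _ ∘L K.J₁ x ∘L
    (ContinuousLinearMap.id ℝ _).prod (K.bField x + c • K.flat x)

theorem transport_apply (c : ℝ) (x : M) (u : TangentSpace 𝓘(ℝ, E) x) :
    K.transport c x u = (K.J₁ x (u, K.bField x u + c • K.flat x u)).1 := rfl

theorem smooth_transport (c : ℝ) : SmoothEndField (K.transport c) := fun _ ↦
  contMDiffAt_hom_of_apply (F₁ := E) (F₂ := E)
    (E₁ := fun x : M ↦ TangentSpace 𝓘(ℝ, E) x)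
    (E₂ := fun x : M ↦ TangentSpace 𝓘(ℝ, E) x) fun X h ↦
      (smoothGSectionAt_iff.1 (K.smooth_J₁_apply (smoothGSectionAt_iff
        (A := fun y ↦ (X y, K.bField y (X y) + c • K.flat y (X y))) |>.2 ⟨h,
        (K.smooth_bField.apply h).add (ContMDiffAt.const_smul_section (K.smooth_flat.apply h))⟩))).1

theorem neg_one_smul_form {x : M} (ξ : TangentSpace 𝓘(ℝ, E) x →L[ℝ] ℝ) : (-1 : ℝ) • ξ = -ξ := by
  ext
  simp

theorem G_eq_smul_iff {c : ℝ} (hc : c = 1 ∨ c = -1) (x : M) (v : GT E x) :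
    K.G x v = c • v ↔ v.2 = K.bField x v.1 + c • K.flat x v.1 := by
  rcases hc with rfl | rfl
  · rw [one_smul, one_smul, G_eq_iff_graph]
  · have h₁ : (-1 : ℝ) • v = -v := by ext <;> simp
    rw [h₁, neg_one_smul_form, ← sub_eq_add_neg, G_eq_neg_iff_graph]

/-- `𝒥₁` preserves the eigenspaces of `G`. -/
theorem J₁_graph {c : ℝ} (hc : c = 1 ∨ c = -1) (x : M) (u : TangentSpace 𝓘(ℝ, E) x) :
    K.J₁ x (u, K.bField x u + c • K.flat x u)
      = (K.transport c x u, K.bField x (K.transport c x u) + c • K.flat x (K.transport c x u)) := by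
  have h := (K.G_eq_smul_iff hc x (K.J₁ x (u, K.bField x u + c • K.flat x u))).1 (by
    rw [G_J₁, (K.G_eq_smul_iff hc x _).2 rfl, (K.J₁ x).map_smul])
  exact Prod.ext rfl h

theorem transport_sq {c : ℝ} (hc : c = 1 ∨ c = -1) (x : M) (u : TangentSpace 𝓘(ℝ, E) x) :
    K.transport c x (K.transport c x u) = -u := by
  rw [K.transport_apply c x (K.transport c x u), ← K.J₁_graph hc, K.sq₁]
  rfl

theorem transport_orth {c : ℝ} (hc : c = 1 ∨ c = -1) (x : M) (u v : TangentSpace 𝓘(ℝ, E) x) :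
    K.flat x (K.transport c x u) (K.transport c x v) = K.flat x u v := by
  have hpair (u v : TangentSpace 𝓘(ℝ, E) x) :
      pairing (u, K.bField x u + c • K.flat x u) (v, K.bField x v + c • K.flat x v)
        = c * K.flat x u v := by
    have hs : K.flat x u v = K.flat x v u := K.metric.symm x u v
    simp only [pairing, add_apply, smul_apply, smul_eq_mul, K.bField_skew x u v, hs]
    ring
  have h := K.orth₁ x (u, K.bField x u + c • K.flat x u) (v, K.bField x v + c • K.flat x v)
  rw [K.J₁_graph hc, K.J₁_graph hc, hpair, hpair] at h
  exact mul_left_cancel₀ (by rcases hc with rfl | rfl <;> norm_num) h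

/-- The bi-Hermitian data associated with `(𝒥₁, 𝒥₂)`. -/
def toBiHermitian : AlmostBiHermitian E M where
  g := K.metric
  b := K.bField
  Jp := K.transport 1
  Jm := K.transport (-1)
  smooth_b := K.smooth_bField
  skew_b := K.bField_skew
  smooth_Jp := K.smooth_transport 1
  smooth_Jm := K.smooth_transport (-1)
  sq_Jp := K.transport_sq (.inl rfl)
  sq_Jm := K.transport_sq (.inr rfl)
  orth_Jp := K.transport_orth (.inl rfl)
  orth_Jm := K.transport_orth (.inr rfl)

theorem isAssociated_toBiHermitian : K.IsAssociated K.toBiHermitian where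
  graph_p := K.G_eq_iff_graph
  graph_m := K.G_eq_neg_iff_graph
  transport_p x u := by
    change _ = K.transport 1 x u
    rw [transport_apply, one_smul]
    rfl
  transport_m x u := by
    change _ = K.transport (-1) x u
    rw [transport_apply, neg_one_smul_form, ← sub_eq_add_neg]
    rfl

theorem existsUnique_biHermitian : ∃! D : AlmostBiHermitian E M, K.IsAssociated D := by
  refine ⟨K.toBiHermitian, K.isAssociated_toBiHermitian, fun D hD ↦ ?_⟩
  generalize K.toBiHermitian = D', K.isAssociated_toBiHermitian = hD'
  have hp (x : M) (u : TangentSpace 𝓘(ℝ, E) x) :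
      D.b x u + D.g.inner x u = D'.b x u + D'.g.inner x u :=
    (hD'.graph_p x (u, D.b x u + D.g.inner x u)).1 ((hD.graph_p x _).2 rfl)
  have hm (x : M) (u : TangentSpace 𝓘(ℝ, E) x) :
      D.b x u - D.g.inner x u = D'.b x u - D'.g.inner x u :=
    (hD'.graph_m x (u, D.b x u - D.g.inner x u)).1 ((hD.graph_m x _).2 rfl)
  have hb : D.b = D'.b := by
    ext x u v
    have h₁ := congrArg (fun L ↦ L v) (hp x u)
    have h₂ := congrArg (fun L ↦ L v) (hm x u)
    simp only [add_apply, sub_apply] at h₁ h₂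
    linarith
  have hg : D.g.inner = D'.g.inner := by
    ext x u v
    have h₁ := congrArg (fun L ↦ L v) (hp x u)
    have h₂ := congrArg (fun L ↦ L v) (hm x u)
    simp only [add_apply, sub_apply] at h₁ h₂
    linarith
  have hJp : D.Jp = D'.Jp := by
    ext x u
    rw [← hD.transport_p, ← hD'.transport_p, hp]
  have hJm : D.Jm = D'.Jm := by
    ext x u
    rw [← hD.transport_m, ← hD'.transport_m, hm]
  obtain ⟨⟨g⟩, b, Jp, Jm⟩ := D
  obtain ⟨⟨g'⟩, b', Jp', Jm'⟩ := D'
  subst hb hg hJp hJm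
  rfl

end AlmostGenKahler

end Extraction

section Bismut

/-! ### Bismut connections -/

variable {E : Type*} [NormedAddCommGroup E] [NormedSpace ℝ E] [FiniteDimensional ℝ E]
  {M : Type*} [TopologicalSpace M] [ChartedSpace E M] [IsManifold 𝓘(ℝ, E) ∞ M]
  {g : Metric E M} {J : EndField E M}

/-- The difference of two Bismut connections is a totally skew-symmetric 3-form commuting with `J`
in its last two arguments, and such a form vanishes. -/
theorem IsBismut.unique (hs : SmoothEndField J) (hJ : ∀ x u, J x (J x u) = -u)
    (ho : ∀ x u v, g.inner x (J x u) (J x v) = g.inner x u v) {nabla nabla' : Connection E M}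
    (h : IsBismut g J nabla) (h' : IsBismut g J nabla') (x : M) (Y : VField E M)
    (hY : MDiffAt (T% Y) x) : nabla Y x = nabla' Y x := by
  obtain ⟨A, hA⟩ : ∃ A : TangentSpace 𝓘(ℝ, E) x →L[ℝ] TangentSpace 𝓘(ℝ, E) x →L[ℝ]
      TangentSpace 𝓘(ℝ, E) x, ∀ Y : VField E M, MDiffAt (T% Y) x →
        A (Y x) = nabla Y x - nabla' Y x :=
    ⟨nabla.isCovariantDerivativeOnUniv.difference nabla'.isCovariantDerivativeOnUniv x,
      fun Y hY ↦ IsCovariantDerivativeOn.difference_apply _ _ (Set.mem_univ x) hY⟩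
  set a := fun u v w : TangentSpace 𝓘(ℝ, E) x ↦ g.inner x (A v u) w with ha
  have hd (v : TangentSpace 𝓘(ℝ, E) x) := mdifferentiableAt_extend_tangent (E := E) v
  have he (v u : TangentSpace 𝓘(ℝ, E) x) :
      A v u = nabla (FiberBundle.extend E v) x u - nabla' (FiberBundle.extend E v) x u := by
    have := congrArg (fun L ↦ L u) (hA _ (hd v))
    rwa [FiberBundle.extend_apply_self] at this
  have h₂₃ (u v w) : a u v w = -a u w v := by
    have h₁ := h.metric x _ _ (hd v) (hd w) u
    rw [h'.metric x _ _ (hd v) (hd w) u] at h₁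
    simp only [FiberBundle.extend_apply_self] at h₁
    simp only [ha, he, map_sub, sub_apply]
    rw [g.symm x _ v, g.symm x _ v]
    linarith
  have htor (u v w) : a u v w - a v u w = -(a u w v - a w u v) := by
    have h₁ := h.skew_torsion x u v w
    have h₂ := h'.skew_torsion x u v w
    simp only [CovariantDerivative.torsion_apply_eq_extend, FiberBundle.extend_apply_self, map_sub,
      sub_apply] at h₁ h₂
    simp only [ha, he, map_sub, sub_apply]
    linarith
  have h₁₂ (u v w) : a u v w = -a v u w := by
    linarith [htor u v w, htor v w u, htor w u v, h₂₃ u v w, h₂₃ v w u, h₂₃ w u v]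
  have hinv (u v w) : a u (J x v) (J x w) = a u v w := by
    have h₁ := hA _ (hs.mdifferentiableAt (hd v))
    rw [FiberBundle.extend_apply_self] at h₁
    simp only [ha]
    rw [h₁, sub_apply, h.parallel x _ (hd v), h'.parallel x _ (hd v), ← (J x).map_sub, ho, he]
  have hhom : Homogeneous₃ a := ⟨fun c u v w ↦ by simp [ha], fun c u v w ↦ by simp [ha],
    fun c u v w ↦ by simp [ha]⟩
  refine sub_eq_zero.1 ((hA Y hY).symm.trans ?_)
  ext u
  refine inner_ext g fun w ↦ ?_
  rw [zero_apply, map_zero, zero_apply]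
  exact eq_zero_of_skew_of_invariant (hJ x) hhom h₁₂ h₂₃ hinv u (Y x) w

theorem isBismut_torsionConnection {b : BForm E M} (hb : SmoothBForm b)
    (hsk : ∀ x u v, b x u v = -b x v u) {c : ℝ}
    (hp : IsParallel J (torsionConnection g b hb hsk c)) :
    IsBismut g J (torsionConnection g b hb hsk c) where
  metric := torsionConnection_metric g b hb hsk c
  parallel := hp
  skew_torsion x u v w := by
    have h : extDeriv₂ b x u v w = -extDeriv₂ b x u w v := by
      rw [extDeriv₂_cyc b x u v, extDeriv₂_skew hsk, extDeriv₂_cyc b x u w]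
    rw [torsionConnection_torsion, torsionConnection_torsion, map_smul, map_smul, smul_apply,
      smul_apply, inner_raisedDeriv, inner_raisedDeriv, h, smul_neg]

end Bismut

section OneSide

/-! ### The equivalent conditions for one of the two almost complex structures -/

variable {E : Type*} [NormedAddCommGroup E] [NormedSpace ℝ E] [FiniteDimensional ℝ E]
  {M : Type*} [TopologicalSpace M] [ChartedSpace E M] [IsManifold 𝓘(ℝ, E) ∞ M]
  {g : Metric E M} {J : EndField E M}

variable (hs : SmoothEndField J) (hJ : ∀ x u, J x (J x u) = -u)
  (ho : ∀ x u v, g.inner x (J x u) (J x v) = g.inner x u v)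
include hs hJ ho

/-- For integrable `J` the operator `d^c` on `ω = gJ` is `-dω(J·, J·, J·)`. -/
theorem dc_fundForm (hi : IsIntegrableACS J) (x : M) (u v w : TangentSpace 𝓘(ℝ, E) x) :
    dc J (fundForm g J) x u v w
      = ((-extDeriv₂ (fundForm g J) x (J x u) (J x v) (J x w) : ℝ) : ℂ) := by
  have ha := nablaForm_homogeneous (g := g) hs hJ ho x
  have hhom : Homogeneous₃ (cyclicSum (nablaForm g J x)) :=
    ⟨fun c u v w ↦ by simp only [cyclicSum, ha.smul₁, ha.smul₂, ha.smul₃, mul_add],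
      fun c u v w ↦ by simp only [cyclicSum, ha.smul₁, ha.smul₂, ha.smul₃, mul_add],
      fun c u v w ↦ by simp only [cyclicSum, ha.smul₁, ha.smul₂, ha.smul₃, mul_add]⟩
  rw [dc, extDeriv₂_fundForm hs hJ ho]
  exact I_mul_part12_sub_part21 hhom (((isIntegrableACS_iff hs hJ ho).1 hi x).cyclicSum_apply
    (hJ x) ha (nablaForm_anti hs hJ ho x)) u v w

variable {b : BForm E M} (hb : SmoothBForm b) (hsk : ∀ x u v, b x u v = -b x v u) {c : ℝ}
  (hc : c = 1 ∨ c = -1)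
include hc

theorem isType21_of_parallel (hp : IsParallel J (torsionConnection g b hb hsk c))
    (hi : IsIntegrableACS J) (x : M) : IsType21 (J x) (extDeriv₂ b x) := by
  have h := ((isParallel_torsionConnection_iff hs hJ ho hb hsk c).1 hp x).type21 (hJ x)
    ((extDeriv₂_homogeneous hb hsk x).const_mul c) ((isIntegrableACS_iff hs hJ ho).1 hi x)
  intro u v w
  have := h u v w
  rcases hc with rfl | rfl <;> linarith

/-- For integrable `J`, being parallel for `∇ + (c/2) g⁻¹h` with `c = ±1` means
`h = c dω(J·, J·, J·)`. -/
theorem isParallel_iff_extDeriv₂_eq (hi : IsIntegrableACS J) :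
    IsParallel J (torsionConnection g b hb hsk c) ↔ ∀ x u v w,
      extDeriv₂ b x u v w = c * extDeriv₂ (fundForm g J) x (J x u) (J x v) (J x w) := by
  have hcc : c * c = 1 := by rcases hc with rfl | rfl <;> norm_num
  constructor
  · intro hp x u v w
    have ht := isType21_of_parallel hs hJ ho hb hsk hc hp hi x
    have h := ((isParallel_torsionConnection_iff hs hJ ho hb hsk c).1 hp x).eq_cyclicSum (hJ x)
      ((extDeriv₂_homogeneous hb hsk x).const_mul c)
      (fun u v w ↦ by rw [extDeriv₂_cyc]) (ht.const_mul c) u v w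
    rw [extDeriv₂_fundForm hs hJ ho, ← h, ← mul_assoc, hcc, one_mul]
  · intro h
    refine (isParallel_torsionConnection_iff hs hJ ho hb hsk c).2 fun x ↦ ?_
    refine ((isIntegrableACS_iff hs hJ ho).1 hi x).parallelForm (hJ x)
      (nablaForm_homogeneous hs hJ ho x) (nablaForm_skew hs hJ ho x) (nablaForm_anti hs hJ ho x)
      fun u v w ↦ ?_
    rw [h, ← mul_assoc, hcc, one_mul, extDeriv₂_fundForm hs hJ ho]

end OneSide

section Subbundles

/-! ### Intersections and conjugates of involutive subbundles -/

variable {E : Type*} [NormedAddCommGroup E] [NormedSpace ℝ E] [FiniteDimensional ℝ E]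
  {M : Type*} [TopologicalSpace M] [ChartedSpace E M] [IsManifold 𝓘(ℝ, E) ∞ M]

theorem CourantInvolutive.inf {L L' : Π x : M, Submodule ℂ (ℂ ⊗[ℝ] GT E x)}
    (h : CourantInvolutive L) (h' : CourantInvolutive L') :
    CourantInvolutive fun x ↦ L x ⊓ L' x :=
  fun U hU A A' B B' hA hA' hB hB' hAA hBB x hx ↦
    ⟨h U hU A A' B B' hA hA' hB hB' (fun y hy ↦ (hAA y hy).1) (fun y hy ↦ (hBB y hy).1) x hx,
      h' U hU A A' B B' hA hA' hB hB' (fun y hy ↦ (hAA y hy).2) (fun y hy ↦ (hBB y hy).2) x hx⟩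

theorem courant_swap (A B : GSection E M) (x : M) : courant A B x = -courant B A x := by
  refine Prod.ext mlieBracket_swap_apply ?_
  have h : (fun y ↦ (B y).2 (A y).1 - (A y).2 (B y).1)
      = -fun y ↦ (A y).2 (B y).1 - (B y).2 (A y).1 := by
    ext y
    simp
  simp only [courant, Prod.snd_neg]
  rw [h, mvfderiv_neg, smul_neg]
  abel

theorem MDiffOneForm.neg {η : OneForm E M} {x : M} (hη : MDiffOneForm η x) :
    MDiffOneForm (fun y ↦ -η y) x :=
  mdifferentiableAt_neg_section hη

/-- The compatibility of the bracket with signs, used to pass to complex conjugate sections. -/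
theorem courant_neg_right {A B : GSection E M} {x : M}
    (hA' : MDiffOneForm (fun y ↦ (A y).2) x) (hB : MDiffAt (T% fun y ↦ (B y).1) x)
    (hB' : MDiffOneForm (fun y ↦ (B y).2) x) :
    courant A (fun y ↦ -B y) x = -courant A B x := by
  refine Prod.ext (mlieBracket_neg_right hB) ?_
  have h : (fun y ↦ -(B y).2 (A y).1 - (A y).2 (-(B y).1))
      = -fun y ↦ (B y).2 (A y).1 - (A y).2 (B y).1 := by
    ext y
    simp
    ring
  ext u
  have hu := mdifferentiableAt_extend_tangent u
  have hf : (fun y ↦ -(B y).2 (FiberBundle.extend E u y))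
      = -fun y ↦ (B y).2 (FiberBundle.extend E u y) := rfl
  rw [← FiberBundle.extend_apply_self E u]
  simp only [courant, Prod.snd_neg, Prod.fst_neg, sub_apply, neg_apply, smul_apply,
    lieDeriv_apply _ hB' hu, lieDeriv_apply _ hB'.neg hu, lieDeriv_apply _ hA' hu,
    mlieBracket_neg_left hB]
  rw [h, hf, mvfderiv_neg, mvfderiv_neg]
  simp only [map_neg, neg_apply, smul_eq_mul]
  ring

/-- The complex conjugate of an involutive subbundle is involutive. -/
theorem CourantInvolutive.conj {L L' : Π x : M, Submodule ℂ (ℂ ⊗[ℝ] GT E x)}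
    (h : CourantInvolutive L) (hL : ∀ x (v w : GT E x), cx v w ∈ L' x ↔ cx v (-w) ∈ L x) :
    CourantInvolutive L' := by
  intro U hU A A' B B' hA hA' hB hB' hAA hBB x hx
  have hneg {A : GSection E M} (hA : SmoothGSection A U) : SmoothGSection (fun y ↦ -A y) U := by
    rw [smoothGSection_iff hU] at hA ⊢
    exact fun y hy ↦ smoothGSectionAt_iff.2 ⟨(smoothGSectionAt_iff.1 (hA y hy)).1.neg,
      ContMDiffAt.neg_section (smoothGSectionAt_iff.1 (hA y hy)).2⟩
  have h₁ {A : GSection E M} (hA : SmoothGSection A U) : MDiffAt (T% fun y ↦ (A y).1) x :=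
    (smoothGSectionAt_iff.1 ((smoothGSection_iff hU).1 hA x hx)).1.mdifferentiableAt
  have h₂ {A : GSection E M} (hA : SmoothGSection A U) : MDiffOneForm (fun y ↦ (A y).2) x :=
    ContMDiffAt.mdifferentiableAt (smoothGSectionAt_iff.1 ((smoothGSection_iff hU).1 hA x hx)).2
      (by simp)
  have hr {A B : GSection E M} (hA : SmoothGSection A U) (hB : SmoothGSection B U) :
      courant A (fun y ↦ -B y) x = -courant A B x :=
    courant_neg_right (h₂ hA) (h₁ hB) (h₂ hB)
  have hl {A B : GSection E M} (hA : SmoothGSection A U) (hB : SmoothGSection B U) :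
      courant (fun y ↦ -A y) B x = -courant A B x := by
    rw [courant_swap, hr hB hA, courant_swap A B]
  have key := h U hU A (fun y ↦ -A' y) B (fun y ↦ -B' y) hA (hneg hA') hB (hneg hB')
    (fun y hy ↦ (hL y _ _).1 (hAA y hy)) (fun y hy ↦ (hL y _ _).1 (hBB y hy)) x hx
  rw [hr (hneg hA') hB', hl hA' hB', neg_neg, hr hA hB', hl hA' hB, ← neg_add] at key
  exact (hL x _ _).2 key

/-! ### The eigenbundles of `𝒥₁` and `𝒥₂` -/

namespace AlmostGenKahler

variable {K : AlmostGenKahler E M} {D : AlmostBiHermitian E M}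

theorem mem_L₁ {x : M} {v w : GT E x} : cx v w ∈ K.L₁ x ↔ w = -K.J₁ x v :=
  mem_cxEigenspace_I (J := (K.J₁ x).toLinearMap) (K.sq₁ x)

theorem mem_L₂ {x : M} {v w : GT E x} : cx v w ∈ K.L₂ x ↔ w = -K.J₂ x v :=
  mem_cxEigenspace_I (J := (K.J₂ x).toLinearMap) (K.sq₂ x)

theorem mem_conj_L₂ {x : M} {v w : GT E x} :
    cx v w ∈ cxEigenspace (K.J₂ x).toLinearMap (-Complex.I) ↔ w = K.J₂ x v :=
  mem_cxEigenspace_neg_I (J := (K.J₂ x).toLinearMap) (K.sq₂ x)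

theorem eq_neg_blockEnd_iff {g : Metric E M} {b : BForm E M} {J J' : EndField E M} {x : M}
    {v w : GT E x} : w = -blockEnd g b J J' x v ↔
      plusPart g b x w = -J x (plusPart g b x v) ∧
        minusPart g b x w = -J' x (minusPart g b x v) := by
  constructor
  · rintro rfl
    rw [(plusPart g b x).map_neg, (minusPart g b x).map_neg, plusPart_blockEnd, minusPart_blockEnd]
    exact ⟨rfl, rfl⟩
  · rintro ⟨h₁, h₂⟩
    refine ext_parts (g := g) (b := b) ?_ ?_
    · rw [(plusPart g b x).map_neg, plusPart_blockEnd, h₁]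
    · rw [(minusPart g b x).map_neg, minusPart_blockEnd, h₂]

theorem IsAssociated.mem_L₁ (h : K.IsAssociated D) (x : M) (v w : GT E x) : cx v w ∈ K.L₁ x ↔
    plusPart D.g D.b x w = -D.Jp x (plusPart D.g D.b x v) ∧
      minusPart D.g D.b x w = -D.Jm x (minusPart D.g D.b x v) := by
  rw [AlmostGenKahler.mem_L₁, h.J₁_eq, eq_neg_blockEnd_iff]

theorem IsAssociated.mem_L₂ (h : K.IsAssociated D) (x : M) (v w : GT E x) : cx v w ∈ K.L₂ x ↔
    plusPart D.g D.b x w = -D.Jp x (plusPart D.g D.b x v) ∧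
      minusPart D.g D.b x w = -(-D.Jm x) (minusPart D.g D.b x v) := by
  rw [AlmostGenKahler.mem_L₂, h.J₂_eq, eq_neg_blockEnd_iff]

theorem eq_zero_of_J_eq_zero {J : EndField E M} (hJ : ∀ x u, J x (J x u) = -u) {x : M}
    {u : TangentSpace 𝓘(ℝ, E) x} (h : -J x u = J x u) : u = 0 := by
  rw [neg_eq_iff_add_eq_zero, ← (J x).map_add, ← two_smul ℝ] at h
  have h₂ := hJ x ((2 : ℝ) • u)
  rw [h, map_zero, eq_comm, neg_eq_zero] at h₂
  exact (smul_eq_zero_iff_right two_ne_zero).1 h₂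

/-- `L₁⁺` is the `+i`-eigenbundle of `J₊` in `C₊ ⊗ ℂ`. -/
theorem IsAssociated.mem_L₁p (h : K.IsAssociated D) (x : M) (v w : GT E x) : cx v w ∈ K.L₁p x ↔
    minusPart D.g D.b x v = 0 ∧ minusPart D.g D.b x w = 0 ∧
      plusPart D.g D.b x w = -D.Jp x (plusPart D.g D.b x v) := by
  have hmem : cx v w ∈ K.L₁p x ↔ cx v w ∈ K.L₁ x ∧ cx v w ∈ K.L₂ x := Iff.rfl
  have hn (u : TangentSpace 𝓘(ℝ, E) x) : -(-D.Jm x) u = D.Jm x u := by simp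
  rw [hmem, h.mem_L₁, h.mem_L₂, hn]
  constructor
  · rintro ⟨⟨h₁, h₂⟩, -, h₃⟩
    have h₀ := eq_zero_of_J_eq_zero D.sq_Jm (h₂.symm.trans h₃)
    exact ⟨h₀, by rw [h₃, h₀, map_zero], h₁⟩
  · rintro ⟨h₁, h₂, h₃⟩
    rw [h₁, h₂, map_zero, neg_zero]
    exact ⟨⟨h₃, rfl⟩, h₃, rfl⟩

/-- `L₁⁻` is the `+i`-eigenbundle of `J₋` in `C₋ ⊗ ℂ`. -/
theorem IsAssociated.mem_L₁m (h : K.IsAssociated D) (x : M) (v w : GT E x) : cx v w ∈ K.L₁m x ↔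
    plusPart D.g D.b x v = 0 ∧ plusPart D.g D.b x w = 0 ∧
      minusPart D.g D.b x w = -D.Jm x (minusPart D.g D.b x v) := by
  have hmem : cx v w ∈ K.L₁m x ↔ cx v w ∈ K.L₁ x ∧ w = K.J₂ x v :=
    and_congr_right fun _ ↦ mem_conj_L₂
  have hw : w = K.J₂ x v ↔ plusPart D.g D.b x w = D.Jp x (plusPart D.g D.b x v) ∧
      minusPart D.g D.b x w = -D.Jm x (minusPart D.g D.b x v) := by
    rw [h.J₂_eq]
    constructor
    · rintro rfl
      exact ⟨plusPart_blockEnd x v, minusPart_blockEnd x v⟩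
    · rintro ⟨h₁, h₂⟩
      have h₃ : minusPart D.g D.b x w = (-D.Jm x) (minusPart D.g D.b x v) := h₂
      refine ext_parts (g := D.g) (b := D.b) ?_ ?_
      · rw [h₁, plusPart_blockEnd]
      · rw [h₃, minusPart_blockEnd]
  rw [hmem, h.mem_L₁, hw]
  constructor
  · rintro ⟨⟨h₁, h₂⟩, h₃, -⟩
    have h₀ := eq_zero_of_J_eq_zero D.sq_Jp (h₁.symm.trans h₃)
    exact ⟨h₀, by rw [h₃, h₀, map_zero], h₂⟩
  · rintro ⟨h₁, h₂, h₃⟩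
    rw [h₁, h₂, map_zero, neg_zero]
    exact ⟨⟨rfl, h₃⟩, rfl, h₃⟩

theorem IsIntegrable.involutive_L₁p (h : K.IsIntegrable) : CourantInvolutive K.L₁p :=
  h.1.inf h.2

/-- `L₁⁻` is the intersection of `L₁` with the conjugate of `L₂`. -/
theorem IsIntegrable.involutive_L₁m (h : K.IsIntegrable) : CourantInvolutive K.L₁m :=
  h.1.inf (h.2.conj fun x v w ↦ by rw [mem_conj_L₂, mem_L₂, neg_inj])

end AlmostGenKahler

/-! ### The equivalent forms of integrability -/

theorem AlmostBiHermitian.typeCondition_iff (D : AlmostBiHermitian E M) :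
    D.TypeCondition ↔
      ∀ x, IsType21 (D.Jp x) (extDeriv₂ D.b x) ∧ IsType21 (D.Jm x) (extDeriv₂ D.b x) := by
  have hh := extDeriv₂_homogeneous D.smooth_b D.skew_b
  refine forall_congr' fun x ↦ ?_
  rw [isType21_iff_part30_part03 (D.sq_Jp x) (hh x), isType21_iff_part30_part03 (D.sq_Jm x) (hh x)]
  exact ⟨fun h ↦ ⟨fun u v w ↦ ⟨(h u v w).1, (h u v w).2.1⟩, fun u v w ↦ (h u v w).2.2⟩,
    fun h u v w ↦ ⟨(h.1 u v w).1, (h.1 u v w).2, h.2 u v w⟩⟩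

namespace AlmostGenKahler

variable {K : AlmostGenKahler E M} {D : AlmostBiHermitian E M}

theorem IsAssociated.parallel_of_involutive (hKD : K.IsAssociated D)
    (hp : CourantInvolutive K.L₁p) (hm : CourantInvolutive K.L₁m) :
    IsParallel D.Jp D.nablaP ∧ IsParallel D.Jm D.nablaM ∧
      IsIntegrableACS D.Jp ∧ IsIntegrableACS D.Jm :=
  ⟨isParallel_of_plus D.smooth_b D.skew_b D.smooth_Jp D.sq_Jp D.orth_Jp hp hKD.mem_L₁p,
    isParallel_of_minus D.smooth_b D.skew_b D.smooth_Jm D.sq_Jm D.orth_Jm hm hKD.mem_L₁m,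
    isIntegrableACS_of_plus D.smooth_b hp D.sq_Jp hKD.mem_L₁p,
    isIntegrableACS_of_minus D.smooth_b hm D.sq_Jm hKD.mem_L₁m⟩

theorem IsAssociated.isIntegrable_of_parallel (hKD : K.IsAssociated D)
    (hp : IsParallel D.Jp D.nablaP) (hm : IsParallel D.Jm D.nablaM) (ht : D.TypeCondition) :
    K.IsIntegrable := by
  rw [D.typeCondition_iff] at ht
  -- `𝒥₂` is obtained from `𝒥₁` by replacing `J₋` with `-J₋`.
  refine ⟨courantInvolutive_of_parallel D.smooth_b D.skew_b D.smooth_Jp D.smooth_Jm D.sq_Jp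
    D.sq_Jm D.orth_Jp D.orth_Jm hp hm (fun x ↦ (ht x).1) (fun x ↦ (ht x).2) hKD.mem_L₁,
    courantInvolutive_of_parallel (J' := fun x ↦ -D.Jm x) D.smooth_b D.skew_b D.smooth_Jp
      D.smooth_Jm.neg_section D.sq_Jp
      (fun x u ↦ by simp [D.sq_Jm]) D.orth_Jp (fun x u v ↦ by simp [D.orth_Jm]) hp ?_
      (fun x ↦ (ht x).1) ?_ hKD.mem_L₂⟩
  · intro x Y hY u
    have h := Connection.map_neg D.nablaM (D.smooth_Jm.mdifferentiableAt hY) u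
    rw [hm x Y hY u] at h
    exact h
  · intro x u v w
    have h := (ht x).2 u v w
    have hh := extDeriv₂_homogeneous D.smooth_b D.skew_b x
    simp only [neg_apply, hh.neg₁, hh.neg₂, hh.neg₃, neg_neg]
    exact h

theorem IsAssociated.tfae (hKD : K.IsAssociated D) : List.TFAE [
    K.IsIntegrable,
    CourantInvolutive K.L₁p ∧ CourantInvolutive K.L₁m,
    IsIntegrableACS D.Jp ∧ IsIntegrableACS D.Jm ∧ D.DcCondition,
    IsIntegrableACS D.Jp ∧ IsIntegrableACS D.Jm ∧ D.RealDcCondition,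
    IsParallel D.Jp D.nablaP ∧ IsParallel D.Jm D.nablaM ∧ D.TypeCondition,
    IsParallel D.Jp D.nablaP ∧ IsParallel D.Jm D.nablaM ∧
      IsIntegrableACS D.Jp ∧ IsIntegrableACS D.Jm] := by
  tfae_have 1 → 2 := fun h ↦ ⟨h.involutive_L₁p, h.involutive_L₁m⟩
  tfae_have 2 → 6 := fun h ↦ hKD.parallel_of_involutive h.1 h.2
  tfae_have 6 → 5 := fun ⟨hp, hm, ip, im⟩ ↦ ⟨hp, hm, D.typeCondition_iff.2 fun x ↦
    ⟨isType21_of_parallel D.smooth_Jp D.sq_Jp D.orth_Jp D.smooth_b D.skew_b (.inl rfl) hp ip x,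
      isType21_of_parallel D.smooth_Jm D.sq_Jm D.orth_Jm D.smooth_b D.skew_b (.inr rfl) hm im x⟩⟩
  tfae_have 5 → 1 := fun ⟨hp, hm, ht⟩ ↦ hKD.isIntegrable_of_parallel hp hm ht
  have key : IsIntegrableACS D.Jp → IsIntegrableACS D.Jm →
      (IsParallel D.Jp D.nablaP ∧ IsParallel D.Jm D.nablaM ↔ D.RealDcCondition) := by
    intro ip im
    have h₁ := isParallel_iff_extDeriv₂_eq D.smooth_Jp D.sq_Jp D.orth_Jp D.smooth_b D.skew_b
      (.inl rfl) ip
    have h₂ := isParallel_iff_extDeriv₂_eq D.smooth_Jm D.sq_Jm D.orth_Jm D.smooth_b D.skew_b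
      (.inr rfl) im
    refine (and_congr h₁ h₂).trans ?_
    simp only [one_mul, neg_one_mul]
    exact ⟨fun h x u v w ↦ ⟨h.1 x u v w, h.2 x u v w⟩,
      fun h ↦ ⟨fun x u v w ↦ (h x u v w).1, fun x u v w ↦ (h x u v w).2⟩⟩
  tfae_have 6 ↔ 4 :=
    ⟨fun ⟨hp, hm, ip, im⟩ ↦ ⟨ip, im, (key ip im).1 ⟨hp, hm⟩⟩,
      fun ⟨ip, im, h⟩ ↦ ⟨((key ip im).2 h).1, ((key ip im).2 h).2, ip, im⟩⟩
  tfae_have 4 ↔ 3 := by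
    refine and_congr_right fun ip ↦ and_congr_right fun im ↦ ?_
    refine forall_congr' fun x ↦ forall_congr' fun u ↦ forall_congr' fun v ↦
      forall_congr' fun w ↦ ?_
    have h₁ : dc D.Jp D.ωp x u v w = _ :=
      dc_fundForm D.smooth_Jp D.sq_Jp D.orth_Jp ip x u v w
    have h₂ : dc D.Jm D.ωm x u v w = _ :=
      dc_fundForm D.smooth_Jm D.sq_Jm D.orth_Jm im x u v w
    rw [h₁, h₂, ← Complex.ofReal_neg, neg_neg, Complex.ofReal_inj, Complex.ofReal_inj, and_comm]
    exact and_congr eq_comm eq_comm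
  tfae_finish

end AlmostGenKahler

end Subbundles

end

end GenKahler

theorem mainTheorem3 {E : Type*} [NormedAddCommGroup E] [NormedSpace ℝ E] [FiniteDimensional ℝ E]
    {M : Type*} [TopologicalSpace M] [ChartedSpace E M] [IsManifold 𝓘(ℝ, E) ∞ M] :
    -- every almost generalized Kähler structure has unique associated data, and conversely
    (∀ K : GenKahler.AlmostGenKahler E M,
      ∃! D : GenKahler.AlmostBiHermitian E M, K.IsAssociated D) ∧
    (∀ D : GenKahler.AlmostBiHermitian E M,
      ∃! K : GenKahler.AlmostGenKahler E M, K.IsAssociated D) ∧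
    ∀ (K : GenKahler.AlmostGenKahler E M) (D : GenKahler.AlmostBiHermitian E M),
      K.IsAssociated D →
      -- the connections `∇±` are metric with torsion `± g⁻¹h`
      (GenKahler.IsMetricConnection D.g D.nablaP ∧ GenKahler.IsMetricConnection D.g D.nablaM ∧
        (∀ x u v, D.nablaP.torsion x u v = D.gInvH x u v) ∧
        (∀ x u v, D.nablaM.torsion x u v = -D.gInvH x u v)) ∧
      -- the equivalent forms of integrability
      List.TFAE [
        K.IsIntegrable,
        GenKahler.CourantInvolutive K.L₁p ∧ GenKahler.CourantInvolutive K.L₁m,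
        GenKahler.IsIntegrableACS D.Jp ∧ GenKahler.IsIntegrableACS D.Jm ∧ D.DcCondition,
        GenKahler.IsIntegrableACS D.Jp ∧ GenKahler.IsIntegrableACS D.Jm ∧ D.RealDcCondition,
        GenKahler.IsParallel D.Jp D.nablaP ∧ GenKahler.IsParallel D.Jm D.nablaM ∧ D.TypeCondition,
        GenKahler.IsParallel D.Jp D.nablaP ∧ GenKahler.IsParallel D.Jm D.nablaM ∧
          GenKahler.IsIntegrableACS D.Jp ∧ GenKahler.IsIntegrableACS D.Jm] ∧
      -- in the integrable case `∇±` are the Bismut connections of `(g, J±)`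
      (K.IsIntegrable →
        (GenKahler.IsBismut D.g D.Jp D.nablaP ∧
          ∀ nabla : GenKahler.Connection E M, GenKahler.IsBismut D.g D.Jp nabla →
            ∀ (x : M) (Y : GenKahler.VField E M), MDiffAt (T% Y) x →
              nabla Y x = D.nablaP Y x) ∧
        (GenKahler.IsBismut D.g D.Jm D.nablaM ∧
          ∀ nabla : GenKahler.Connection E M, GenKahler.IsBismut D.g D.Jm nabla →
            ∀ (x : M) (Y : GenKahler.VField E M), MDiffAt (T% Y) x →
              nabla Y x = D.nablaM Y x)) := by
  refine ⟨fun K ↦ K.existsUnique_biHermitian, fun D ↦ D.existsUnique_genKahler, fun K D hKD ↦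
    ⟨⟨GenKahler.torsionConnection_metric _ _ _ _ _, GenKahler.torsionConnection_metric _ _ _ _ _,
      fun x u v ↦ ?_, fun x u v ↦ ?_⟩, hKD.tfae, fun h ↦ ?_⟩⟩
  · exact (GenKahler.torsionConnection_torsion _ _ _ _ _ x u v).trans (one_smul ℝ _)
  · exact (GenKahler.torsionConnection_torsion _ _ _ _ _ x u v).trans (neg_one_smul ℝ _)
  · obtain ⟨hp, hm, -⟩ := hKD.parallel_of_involutive h.involutive_L₁p h.involutive_L₁m
    have bp := GenKahler.isBismut_torsionConnection D.smooth_b D.skew_b hp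
    have bm := GenKahler.isBismut_torsionConnection D.smooth_b D.skew_b hm
    exact ⟨⟨bp, fun nabla hn ↦ hn.unique D.smooth_Jp D.sq_Jp D.orth_Jp bp⟩,
      bm, fun nabla hn ↦ hn.unique D.smooth_Jm D.sq_Jm D.orth_Jm bm⟩
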